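/- Let $N\ge 1$ be an integer and $-1<a<1$. Write points of $\mathbb R^{N+1}$ as $X=(x,y)$ with $x=(x_1,\dots,x_N)\in\mathbb R^N$, $y=x_{N+1}\in\mathbb R$, and let $\mathbb R^{N+1}_+=\{y>0\}$. On $\mathbb R^{N+1}$ let $\mu$ be the probability measure $$d\mu=\frac{1}{2^{1+a}\Gamma(\frac{1+a}{2})(4\pi)^{N/2}}\,|y|^a e^{-|X|^2/4}\,dX,$$ and on $\mathbb R^{N+1}_+$ let $\mu$ be the probability measure $$d\mu=\frac{1}{2^{a}\Gamma(\frac{1+a}{2})(4\pi)^{N/2}}\,y^a e^{-|X|^2/4}\,dX .$$ Let $H^1(\mathbb R^{N+1},d\mu)$, $H^1(\mathbb R^{N+1}_+,d\mu)$ and $H^1_0(\mathbb R^{N+1}_+,d\mu)$ be the closures of $C_c^\infty(\mathbb R^{N+1})$, $C_c^\infty(\overline{\mathbb R^{N+1}_+})$ and $C_c^\infty(\mathbb R^{N+1}_+)$, respectively, in the norm given by $\|V\|^2=\int V^2\,d\mu+\int|\nabla V|^2\,d\mu$. Then the following hold. (i) For every $V\in H^1(\mathbb R^{N+1},d\mu)$,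 $$\int_{\mathbb R^{N+1}}V^2\,d\mu-\Big(\int_{\mathbb R^{N+1}}V\,d\mu\Big)^2\le \frac{2}{\min\{1,1-a\}}\int_{\mathbb R^{N+1}}|\nabla V|^2\,d\mu .$$ Equality holds if and only if, almost everywhere, $V(x,y)=A+\sum_{j=1}^N b_jx_j$ (when $a<0$), $V(x,y)=A+\sum_{j=1}^{N+1} b_jx_j$ (when $a=0$), $V(x,y)=A+B\,y|y|^{-a}$ (when $a>0$), for some real constants $A,B,b_j$. (ii) For every $V\in H^1_0(\mathbb R^{N+1}_+,d\mu)$, $$\int_{\mathbb R^{N+1}_+}V^2\,d\mu\le \frac{2}{1-a}\int_{\mathbb R^{N+1}_+}|\nabla V|^2\,d\mu .$$ Equality holds if and only if $V(x,y)=A\,y^{1-a}$ almost everywhere for some $A\in\mathbb R$. (iii) For every $V\in H^1(\mathbb R^{N+1}_+,d\mu)$, $$\int_{\mathbb R^{N+1}_+}V^2\,d\mu-\Big(\int_{\mathbb R^{N+1}_+}V\,d\mu\Big)^2\le 2\int_{\mathbb R^{N+1}_+}|\nabla V|^2\,d\mu .$$ Equality holds if and only if $V(x,y)=A+\sum_{j=1}^N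 b_jx_j$ almost everywhere for some $A,b_1,\dots,b_N\in\mathbb R$. In each part all the functions listed in the equality case belong to the space in question, and the constant in the inequality is the smallest possible. -/

import Mathlib

open MeasureTheory
open scoped ContDiff

noncomputable section

/-- `ℝ^{N+1}` with its Euclidean structure; a point is `X = (x, y)` with
`x = (x_1, …, x_N) ∈ ℝ^N` and `y = x_{N+1} ∈ ℝ`. -/
abbrev Space (N : ℕ) : Type := EuclideanSpace ℝ (Fin (N + 1))

/-- The last coordinate `y` of `X = (x, y)`. -/
def yCoord {N : ℕ} (X : Space N) : ℝ := X (Fin.last N)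

/-- The coordinate `x_j`, `1 ≤ j ≤ N`, of `X = (x, y)`. -/
def xCoord {N : ℕ} (X : Space N) (j : Fin N) : ℝ := X j.castSucc

/-- The open half-space `ℝ^{N+1}_+ = {y > 0}`. -/
def upperHalf (N : ℕ) : Set (Space N) := {X | 0 < yCoord X}

/-- The kernel `𝒢_a(X, 1)` normalised for the half-space `ℝ^{N+1}_+`,
`(2^a Γ((1+a)/2) (4π)^{N/2})⁻¹ e^{-|X|²/4}`. -/
def kernelHalf (N : ℕ) (a : ℝ) (X : Space N) : ℝ :=
  1 / ((2 : ℝ) ^ a * Real.Gamma ((1 + a) / 2) * (4 * Real.pi) ^ ((N : ℝ) / 2))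
    * Real.exp (-(‖X‖ ^ 2) / 4)

/-- The kernel `𝒢_a(X, 1)` normalised for the whole space `ℝ^{N+1}`: one half of the previous one,
`(2^{1+a} Γ((1+a)/2) (4π)^{N/2})⁻¹ e^{-|X|²/4}`. -/
def kernelWhole (N : ℕ) (a : ℝ) (X : Space N) : ℝ :=
  1 / ((2 : ℝ) ^ (1 + a) * Real.Gamma ((1 + a) / 2) * (4 * Real.pi) ^ ((N : ℝ) / 2))
    * Real.exp (-(‖X‖ ^ 2) / 4)

/-- The probability measure `dμ = |y|^a 𝒢_a(X, 1) dX` on `ℝ^{N+1}`. -/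
def muWhole (N : ℕ) (a : ℝ) : Measure (Space N) :=
  volume.withDensity fun X => ENNReal.ofReal (|yCoord X| ^ a * kernelWhole N a X)

/-- The probability measure `dμ = y^a 𝒢_a(X, 1) dX` on `ℝ^{N+1}_+`, seen as a measure on
`ℝ^{N+1}` which is concentrated on `ℝ^{N+1}_+`. -/
def muHalf (N : ℕ) (a : ℝ) : Measure (Space N) :=
  (volume.restrict (upperHalf N)).withDensity fun X =>
    ENNReal.ofReal (yCoord X ^ a * kernelHalf N a X)

/-- `C_c^∞(ℝ^{N+1})`. The restrictions of these functions to the closed half-space form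
`C_c^∞` of the closed half-space. -/
def testFunctions (N : ℕ) : Set (Space N → ℝ) :=
  {φ | ContDiff ℝ ∞ φ ∧ HasCompactSupport φ}

/-- `C_c^∞(ℝ^{N+1}_+)`: the support is a compact subset of the open half-space. -/
def testFunctionsHalf (N : ℕ) : Set (Space N → ℝ) :=
  {φ | ContDiff ℝ ∞ φ ∧ HasCompactSupport φ ∧ tsupport φ ⊆ upperHalf N}

/-- `V` belongs to the closure of the class `D` of smooth functions with respect to the Sobolev norm
`‖V‖² = ∫ V² dμ + ∫ |∇V|² dμ`, and `G` is its gradient `∇V`, that is the limit in `L²(μ)` of the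
gradients of functions of `D` that approximate `V`. Functions are identified when they agree
`μ`-almost everywhere. -/
structure IsSobolev {N : ℕ} (D : Set (Space N → ℝ)) (μ : Measure (Space N))
    (V : Space N → ℝ) (G : Space N → Space N) : Prop where
  memLp : MemLp V 2 μ
  grad_memLp : MemLp G 2 μ
  approx : ∀ ε : ℝ, 0 < ε → ∃ φ ∈ D,
    ∫ X, (V X - φ X) ^ 2 ∂μ + ∫ X, ‖G X - gradient φ X‖ ^ 2 ∂μ < ε

/-- `V ∈ H^1(ℝ^{N+1}, dμ)` with gradient `∇V = G`. -/
def IsH1Whole (N : ℕ) (a : ℝ) (V : Space N → ℝ) (G : Space N → Space N) : Prop :=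
  IsSobolev (testFunctions N) (muWhole N a) V G

/-- `V ∈ H^1(ℝ^{N+1}_+, dμ)` with gradient `∇V = G`. -/
def IsH1Half (N : ℕ) (a : ℝ) (V : Space N → ℝ) (G : Space N → Space N) : Prop :=
  IsSobolev (testFunctions N) (muHalf N a) V G

/-- `V ∈ H^1_0(ℝ^{N+1}_+, dμ)` with gradient `∇V = G`. -/
def IsH1ZeroHalf (N : ℕ) (a : ℝ) (V : Space N → ℝ) (G : Space N → Space N) : Prop :=
  IsSobolev (testFunctionsHalf N) (muHalf N a) V G

/-- The extremal functions on `ℝ^{N+1}`: constants plus linear functions of `x` if `a < 0`,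
constants plus linear functions of `X = (x, y)` if `a = 0`,
constants plus multiples of `y|y|^{-a}` if `a > 0`. -/
def extremalsWhole (N : ℕ) (a : ℝ) : Set (Space N → ℝ) :=
  {W | (a < 0 ∧ ∃ (A : ℝ) (b : Fin N → ℝ), W = fun X => A + ∑ j, b j * xCoord X j) ∨
       (a = 0 ∧ ∃ (A : ℝ) (b : Fin (N + 1) → ℝ), W = fun X => A + ∑ j, b j * X j) ∨
       (0 < a ∧ ∃ A B : ℝ, W = fun X => A + B * (yCoord X * |yCoord X| ^ (-a)))}

/-- The extremal functions in `H^1_0` of the half-space: the multiples of `y^{1-a}`. -/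
def extremalsZeroHalf (N : ℕ) (a : ℝ) : Set (Space N → ℝ) :=
  {W | ∃ A : ℝ, W = fun X => A * yCoord X ^ (1 - a)}

/-- The extremal functions in `H^1` of the half-space: constants plus linear functions of `x`. -/
def extremalsHalf (N : ℕ) : Set (Space N → ℝ) :=
  {W | ∃ (A : ℝ) (b : Fin N → ℝ), W = fun X => A + ∑ j, b j * xCoord X j}

end

noncomputable section

/-! On the half-space the quadratic form `∫ |∇V|² dμ` belongs to the operator `-LV` with `LV = ΔV +
(a/y) ∂_y V - (X/2)·∇V`, which separates in the coordinates. Its eigenfunctions are the products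
`y^κ ∏ p_i(X_i)`, where the `p_i` are Hermite polynomials in the `x_j` and a Laguerre-type
polynomial in `y²`. The exponent `κ` solves `κ(κ - 1 + a) = 0`: `κ = 0` is the Neumann problem and
`κ = 1 - a` the Dirichlet problem. The eigenvalue is `κ/2 + n_y + ∑ n_j/2`, so the sharp constants
are read off from the bottom of the two spectra.

No compactness is needed. Integration by parts (`integral_lineDeriv_mul_muHalf`) gives `∫ ∇V·∇e_n =
λ_n ∫ V e_n` for test functions (`integral_inner_eigGrad`), and then for their Sobolev closure
(`IsSobolev.integral_inner_eq`). The family `e_n` is orthogonal, and it is complete because a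
function with exponential moments is determined by its polynomial moments (`ae_eq_zero_of_moments`,
`ae_eq_zero_of_integral_mul_eig`). Parseval for `V` together with Bessel for `∇V` against the
orthogonal family `∇e_n` gives `Λ ‖V‖² ≤ ‖∇V‖²` as soon as `V` has no component below the level `Λ`.
Equality leaves only components at level `Λ` (`mul_norm_sq_le_of_eigen`).

For (iii) the mean is subtracted, which removes the constant mode. The next Neumann level is `1/2`,
with eigenfunctions `x_1, …, x_N`. For (ii) the lowest Dirichlet level is `(1 - a)/2`, with the
single eigenfunction `y^{1-a}`. For (i) the even and odd parts in `y` decouple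
(`integral_norm_sq_eq_add`): the even part satisfies (iii), the odd part satisfies the Dirichlet
inequality, and the larger of `2` and `2/(1 - a)` wins. The sign of `a` decides which part may be
nontrivial in the equality case.

Conversely, an extremal attains equality by the same eigenvalue identity, once uniqueness of the
weak gradient (`IsSobolev.grad_unique`) has identified its gradient. Membership of the extremals is
proved by cutting off near `y = 0` and at infinity. Optimality follows by inserting an extremal of
positive energy. -/

section Auxiliary

open Filter Topology Set

/-! ### The half-space measure: densities, Gaussian integrals, normalisation. -/

section Measure

variable {N : ℕ} {a : ℝ}

/-- The density `y^a 𝒢_a(X, 1)` of `muHalf`. -/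
def weight (N : ℕ) (a : ℝ) (X : Space N) : ℝ := yCoord X ^ a * kernelHalf N a X

lemma continuous_yCoord : Continuous (yCoord : Space N → ℝ) := by
  unfold yCoord; fun_prop

lemma measurable_yCoord : Measurable (yCoord : Space N → ℝ) := continuous_yCoord.measurable

lemma isOpen_upperHalf : IsOpen (upperHalf N) := isOpen_lt continuous_const continuous_yCoord

lemma measurableSet_upperHalf : MeasurableSet (upperHalf N) := isOpen_upperHalf.measurableSet

lemma continuous_kernelHalf : Continuous (kernelHalf N a) := by
  unfold kernelHalf; fun_prop

lemma measurable_weight : Measurable (weight N a) :=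
  (measurable_yCoord.pow_const a).mul continuous_kernelHalf.measurable

/-- The normalising constant in `kernelHalf`. -/
def kernelConst (N : ℕ) (a : ℝ) : ℝ :=
  1 / ((2 : ℝ) ^ a * Real.Gamma ((1 + a) / 2) * (4 * Real.pi) ^ ((N : ℝ) / 2))

lemma kernelConst_pos (ha : -1 < a) : 0 < kernelConst N a := by
  have : 0 < Real.Gamma ((1 + a) / 2) := Real.Gamma_pos_of_pos (by linarith)
  unfold kernelConst; positivity

lemma kernelHalf_eq (X : Space N) :
    kernelHalf N a X = kernelConst N a * Real.exp (-(‖X‖ ^ 2) / 4) := rfl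

lemma weight_pos (ha : -1 < a) {X : Space N} (hX : 0 < yCoord X) : 0 < weight N a X := by
  have := kernelConst_pos (N := N) ha
  unfold weight; rw [kernelHalf_eq]; positivity

lemma ae_yCoord_pos : ∀ᵐ X ∂(muHalf N a), 0 < yCoord X :=
  (withDensity_absolutelyContinuous _ _).ae_le (ae_restrict_mem measurableSet_upperHalf)

lemma muHalf_eq : muHalf N a = (volume.restrict (upperHalf N)).withDensity
    fun X => ENNReal.ofReal (weight N a X) := rfl

lemma integral_muHalf (ha : -1 < a) {E : Type*} [NormedAddCommGroup E] [NormedSpace ℝ E]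
    (f : Space N → E) :
    ∫ X, f X ∂(muHalf N a) = ∫ X in upperHalf N, weight N a X • f X := by
  rw [muHalf_eq]
  rw [integral_withDensity_eq_integral_toReal_smul measurable_weight.ennreal_ofReal
    (ae_of_all _ fun _ => ENNReal.ofReal_lt_top)]
  refine setIntegral_congr_fun measurableSet_upperHalf fun X hX => ?_
  rw [ENNReal.toReal_ofReal (weight_pos ha hX).le]

lemma integrable_muHalf (ha : -1 < a) {E : Type*} [NormedAddCommGroup E] [NormedSpace ℝ E]
    (f : Space N → E) :
    Integrable f (muHalf N a) ↔ IntegrableOn (fun X => weight N a X • f X) (upperHalf N) := by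
  rw [muHalf_eq]
  rw [integrable_withDensity_iff_integrable_smul' measurable_weight.ennreal_ofReal
    (ae_of_all _ fun _ => ENNReal.ofReal_lt_top)]
  refine integrableOn_congr_fun (fun X hX => ?_) measurableSet_upperHalf
  rw [ENNReal.toReal_ofReal (weight_pos ha hX).le]

/-- One-dimensional factors of `1_{y > 0} y^s e^{-b|X|²}`. -/
def gaussFactor (N : ℕ) (s b : ℝ) (i : Fin (N + 1)) (t : ℝ) : ℝ :=
  if i = Fin.last N then (Ioi (0 : ℝ)).indicator (fun t => t ^ s * Real.exp (-b * t ^ 2)) t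
  else Real.exp (-b * t ^ 2)

lemma prod_gaussFactor (s b : ℝ) (X : Space N) :
    ∏ i, gaussFactor N s b i (X i)
      = (upperHalf N).indicator (fun X => yCoord X ^ s * Real.exp (-b * ‖X‖ ^ 2)) X := by
  rw [Fin.prod_univ_castSucc]
  have h1 : ∀ j : Fin N, gaussFactor N s b j.castSucc (X j.castSucc)
      = Real.exp (-b * X j.castSucc ^ 2) := fun j => by
    simp [gaussFactor, (Fin.castSucc_lt_last j).ne]
  simp only [h1, ← Real.exp_sum]
  by_cases hX : 0 < yCoord X
  · rw [indicator_of_mem (show X ∈ upperHalf N from hX)]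
    have hX' : 0 < X (Fin.last N) := hX
    simp only [gaussFactor, if_true, indicator_of_mem (show X (Fin.last N) ∈ Ioi (0:ℝ) from hX')]
    rw [EuclideanSpace.real_norm_sq_eq, Fin.sum_univ_castSucc, mul_add, Real.exp_add, Finset.mul_sum,
      yCoord]
    ring
  · rw [indicator_of_notMem (show X ∉ upperHalf N from hX)]
    have hX' : ¬ 0 < X (Fin.last N) := hX
    simp [gaussFactor, hX']

lemma integrable_gaussFactor {s b : ℝ} (hs : -1 < s) (hb : 0 < b) (i : Fin (N + 1)) :
    Integrable (gaussFactor N s b i) := by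
  unfold gaussFactor
  split_ifs
  · exact (integrableOn_rpow_mul_exp_neg_mul_sq hb hs).integrable_indicator measurableSet_Ioi
  · exact integrable_exp_neg_mul_sq hb

lemma integrableOn_rpow_gauss {s b : ℝ} (hs : -1 < s) (hb : 0 < b) :
    IntegrableOn (fun X : Space N => yCoord X ^ s * Real.exp (-b * ‖X‖ ^ 2)) (upperHalf N) := by
  rw [← integrable_indicator_iff measurableSet_upperHalf]
  have h := Integrable.fintype_prod (f := gaussFactor N s b)
    (μ := fun _ => volume) fun i => integrable_gaussFactor hs hb i
  have h2 := (PiLp.volume_preserving_ofLp (Fin (N + 1))).integrable_comp_of_integrable h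
  refine h2.congr (ae_of_all _ fun X => ?_)
  exact prod_gaussFactor s b X

lemma integral_rpow_gauss {s b : ℝ} (hs : -1 < s) (hb : 0 < b) :
    ∫ X : Space N in upperHalf N, yCoord X ^ s * Real.exp (-b * ‖X‖ ^ 2)
      = √(Real.pi / b) ^ N * (b ^ (-(s + 1) / 2) * (1 / 2) * Real.Gamma ((s + 1) / 2)) := by
  rw [← integral_indicator measurableSet_upperHalf]
  have h := integral_fintype_prod_volume_eq_prod (𝕜 := ℝ) (gaussFactor N s b)
  have h2 := (PiLp.volume_preserving_ofLp (Fin (N + 1))).integral_comp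
    (MeasurableEquiv.toLp 2 (Fin (N + 1) → ℝ)).symm.measurableEmbedding
    (fun x => ∏ i, gaussFactor N s b i (x i))
  simp only [← prod_gaussFactor s b]
  rw [h2, h, Fin.prod_univ_castSucc]
  have h1 : ∀ j : Fin N, ∫ t, gaussFactor N s b j.castSucc t = √(Real.pi / b) := fun j => by
    simp only [gaussFactor, (Fin.castSucc_lt_last j).ne, if_false]
    exact integral_gaussian b
  simp only [h1, Finset.prod_const, Finset.card_univ, Fintype.card_fin]
  simp only [gaussFactor, if_true]
  rw [integral_indicator measurableSet_Ioi, ← integral_rpow_mul_exp_neg_mul_rpow two_pos hs hb]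
  simp

/-- Completing the square, `r²/8 - cr + 2c² = (r - 4c)²/8 ≥ 0`: half of the Gaussian absorbs any
exponential factor. -/
lemma exp_mul_gauss_le (c r : ℝ) :
    Real.exp (c * r) * Real.exp (-(r ^ 2) / 4) ≤ Real.exp (2 * c ^ 2) * Real.exp (-(1 / 8) * r ^ 2) := by
  rw [← Real.exp_add, ← Real.exp_add]
  apply Real.exp_le_exp.2
  nlinarith [sq_nonneg (r - 4 * c)]

lemma integrable_rpow_mul_exp (ha : -1 < a) {s : ℝ} (hs : -1 < s + a) (c : ℝ) :
    Integrable (fun X : Space N => yCoord X ^ s * Real.exp (c * ‖X‖)) (muHalf N a) := by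
  rw [integrable_muHalf ha]
  refine Integrable.mono' (((integrableOn_rpow_gauss (N := N) hs (b := 1 / 8) (by norm_num)).const_mul
    (kernelConst N a * Real.exp (2 * c ^ 2)))) ?_ ?_
  · refine (measurable_weight.smul ((measurable_yCoord.pow_const s).mul ?_)).aestronglyMeasurable
    exact (by fun_prop : Continuous fun X : Space N => Real.exp (c * ‖X‖)).measurable
  · filter_upwards [ae_restrict_mem measurableSet_upperHalf] with X hX
    have hX' : 0 < yCoord X := hX
    have hk := kernelConst_pos (N := N) ha
    rw [smul_eq_mul, weight, kernelHalf_eq, Real.norm_of_nonneg (by positivity)]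
    calc yCoord X ^ a * (kernelConst N a * Real.exp (-‖X‖ ^ 2 / 4))
          * (yCoord X ^ s * Real.exp (c * ‖X‖))
        = kernelConst N a * (yCoord X ^ (s + a))
          * (Real.exp (c * ‖X‖) * Real.exp (-‖X‖ ^ 2 / 4)) := by
          rw [Real.rpow_add hX']; ring
      _ ≤ kernelConst N a * (yCoord X ^ (s + a))
          * (Real.exp (2 * c ^ 2) * Real.exp (-(1 / 8) * ‖X‖ ^ 2)) := by
          gcongr ?_ * ?_
          exact exp_mul_gauss_le _ _
      _ = _ := by ring

lemma integral_one_muHalf (ha : -1 < a) : ∫ _ : Space N, (1 : ℝ) ∂(muHalf N a) = 1 := by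
  rw [integral_muHalf ha]
  have : ∀ X : Space N, weight N a X • (1 : ℝ)
      = kernelConst N a * (yCoord X ^ a * Real.exp (-(1 / 4) * ‖X‖ ^ 2)) := fun X => by
    rw [weight, kernelHalf_eq, smul_eq_mul, show -‖X‖ ^ 2 / 4 = -(1 / 4) * ‖X‖ ^ 2 by ring]; ring
  simp only [this]
  rw [integral_const_mul, integral_rpow_gauss ha (by norm_num)]
  have hG : 0 < Real.Gamma ((1 + a) / 2) := Real.Gamma_pos_of_pos (by linarith)
  have h1 : √(Real.pi / (1 / 4)) ^ N = (4 * Real.pi) ^ ((N : ℝ) / 2) := by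
    rw [show Real.pi / (1 / 4) = 4 * Real.pi by ring, Real.sqrt_eq_rpow, ← Real.rpow_natCast,
      ← Real.rpow_mul (by positivity)]
    congr 1; ring
  have h2 : ((1 / 4 : ℝ)) ^ (-(a + 1) / 2) * (1 / 2) = 2 ^ a := by
    rw [show (1 / 4 : ℝ) = 2 ^ (-2 : ℝ) by norm_num [Real.rpow_neg], ← Real.rpow_mul (by norm_num),
      show -2 * (-(a + 1) / 2) = a + 1 by ring, Real.rpow_add_one (by norm_num)]
    ring
  rw [h1, h2, kernelConst, add_comm a 1]
  have : (0 : ℝ) < 2 ^ a := by positivity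
  have : 0 < (4 * Real.pi) ^ ((N : ℝ) / 2) := by positivity
  field_simp

lemma isProbabilityMeasure_muHalf (ha : -1 < a) : IsProbabilityMeasure (muHalf N a) := by
  have h1 : Integrable (fun _ : Space N => (1 : ℝ)) (muHalf N a) := by
    -- The integral of a nonintegrable function is `0` by convention, so the computed value `1`
    -- already forces integrability.
    by_contra h
    have := integral_one_muHalf (N := N) ha
    rw [integral_undef h] at this
    exact zero_ne_one this
  have hf : IsFiniteMeasure (muHalf N a) := by
    rcases (integrable_const_iff (c := (1 : ℝ))).1 h1 with h | h
    · norm_num at h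
    · exact h
  have h2 := integral_one_muHalf (N := N) ha
  rw [integral_const, smul_eq_mul, mul_one] at h2
  refine ⟨?_⟩
  rw [← ENNReal.toReal_eq_one_iff]; exact h2

end Measure

/-! ### A calculus of growth bounds, used for all integrability claims. -/

section Growth

variable {N : ℕ} {a : ℝ}

/-- `f = O(y^s e^{c|X|})` on the half-space. -/
def Growth (s : ℝ) (f : Space N → ℝ) : Prop :=
  ∃ C c : ℝ, 0 ≤ C ∧ 0 ≤ c ∧ ∀ X, 0 < yCoord X → |f X| ≤ C * (yCoord X ^ s * Real.exp (c * ‖X‖))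

lemma yCoord_le_norm (X : Space N) : yCoord X ≤ ‖X‖ :=
  (le_abs_self _).trans (PiLp.norm_apply_le X (Fin.last N))

namespace Growth

variable {s t : ℝ} {f g : Space N → ℝ}

lemma congr (hf : Growth s f) (h : ∀ X, 0 < yCoord X → g X = f X) : Growth s g := by
  obtain ⟨C, c, hC, hc, hb⟩ := hf
  exact ⟨C, c, hC, hc, fun X hX => by rw [h X hX]; exact hb X hX⟩

lemma mul (hf : Growth s f) (hg : Growth t g) : Growth (s + t) fun X => f X * g X := by
  obtain ⟨C, c, hC, hc, hb⟩ := hf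
  obtain ⟨D, d, hD, hd, hb'⟩ := hg
  refine ⟨C * D, c + d, by positivity, by positivity, fun X hX => ?_⟩
  rw [abs_mul, Real.rpow_add hX, add_mul, Real.exp_add]
  calc |f X| * |g X| ≤ (C * (yCoord X ^ s * Real.exp (c * ‖X‖)))
        * (D * (yCoord X ^ t * Real.exp (d * ‖X‖))) := by
        gcongr
        · exact hb X hX
        · exact hb' X hX
    _ = _ := by ring

lemma add (hf : Growth s f) (hg : Growth s g) : Growth s fun X => f X + g X := by
  obtain ⟨C, c, hC, hc, hb⟩ := hf
  obtain ⟨D, d, hD, hd, hb'⟩ := hg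
  refine ⟨C + D, c + d, by positivity, by positivity, fun X hX => ?_⟩
  have h1 : Real.exp (c * ‖X‖) ≤ Real.exp ((c + d) * ‖X‖) :=
    Real.exp_le_exp.2 (by nlinarith [norm_nonneg X])
  have h2 : Real.exp (d * ‖X‖) ≤ Real.exp ((c + d) * ‖X‖) :=
    Real.exp_le_exp.2 (by nlinarith [norm_nonneg X])
  calc |f X + g X| ≤ |f X| + |g X| := abs_add_le _ _
    _ ≤ C * (yCoord X ^ s * Real.exp (c * ‖X‖)) + D * (yCoord X ^ s * Real.exp (d * ‖X‖)) :=
        add_le_add (hb X hX) (hb' X hX)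
    _ ≤ C * (yCoord X ^ s * Real.exp ((c + d) * ‖X‖))
        + D * (yCoord X ^ s * Real.exp ((c + d) * ‖X‖)) := by gcongr
    _ = _ := by ring

/-- Since `y ≤ |X| ≤ e^{|X|}`, the surplus power `y^{s-t}` can be paid for by a larger exponential
rate. -/
lemma mono (hf : Growth s f) (h : t ≤ s) : Growth t f := by
  obtain ⟨C, c, hC, hc, hb⟩ := hf
  refine ⟨C, c + (s - t), hC, by linarith, fun X hX => (hb X hX).trans ?_⟩
  have h1 : yCoord X ^ (s - t) ≤ Real.exp ((s - t) * ‖X‖) := by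
    rw [mul_comm, Real.exp_mul]
    refine Real.rpow_le_rpow hX.le ?_ (by linarith)
    have := Real.add_one_le_exp ‖X‖
    linarith [yCoord_le_norm X]
  calc C * (yCoord X ^ s * Real.exp (c * ‖X‖))
      = C * (yCoord X ^ t * yCoord X ^ (s - t) * Real.exp (c * ‖X‖)) := by
        rw [← Real.rpow_add hX]; ring_nf
    _ ≤ C * (yCoord X ^ t * Real.exp ((s - t) * ‖X‖) * Real.exp (c * ‖X‖)) := by gcongr
    _ = _ := by rw [add_mul, Real.exp_add]; ring

lemma of_bounded {C : ℝ} (h : ∀ X, 0 < yCoord X → |f X| ≤ C) : Growth 0 f := by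
  refine ⟨max C 0, 0, le_max_right _ _, le_rfl, fun X hX => ?_⟩
  simpa using Or.inl (h X hX)

lemma const (k : ℝ) : Growth 0 (fun _ : Space N => k) := of_bounded (C := |k|) fun _ _ => le_rfl

lemma const_mul (hf : Growth s f) (k : ℝ) : Growth s fun X => k * f X := by
  simpa using (const (N := N) k).mul hf

lemma neg (hf : Growth s f) : Growth s fun X => -f X := by
  simpa using hf.const_mul (-1)

lemma rpow (s : ℝ) : Growth s (fun X : Space N => yCoord X ^ s) := by
  refine ⟨1, 0, zero_le_one, le_rfl, fun X hX => ?_⟩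
  rw [abs_of_pos (by positivity)]; simp

lemma inv : Growth (-1) (fun X : Space N => (yCoord X)⁻¹) :=
  (rpow (-1)).congr fun _ _ => (Real.rpow_neg_one _).symm

lemma coord (i : Fin (N + 1)) : Growth 0 (fun X : Space N => X i) := by
  refine ⟨1, 1, zero_le_one, zero_le_one, fun X _ => ?_⟩
  have h1 := PiLp.norm_apply_le X i
  have h2 := Real.add_one_le_exp ‖X‖
  rw [Real.norm_eq_abs] at h1
  simp; linarith

lemma norm : Growth 0 (fun X : Space N => ‖X‖) := by
  refine ⟨1, 1, zero_le_one, zero_le_one, fun X _ => ?_⟩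
  have h2 := Real.add_one_le_exp ‖X‖
  simp; linarith

lemma pow (hf : Growth 0 f) (n : ℕ) : Growth 0 fun X => f X ^ n := by
  induction n with
  | zero => simpa using const 1
  | succ n ih => simpa [pow_succ] using ih.mul hf

lemma polyEval (hf : Growth 0 f) (p : Polynomial ℝ) : Growth 0 fun X => p.eval (f X) := by
  induction p using Polynomial.induction_on' with
  | add p q hp hq => simpa using hp.add hq
  | monomial n k => simpa using (hf.pow n).const_mul k

lemma prod {ι : Type*} (S : Finset ι) {F : ι → Space N → ℝ} (h : ∀ i ∈ S, Growth 0 (F i)) :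
    Growth 0 fun X => ∏ i ∈ S, F i X := by
  classical
  induction S using Finset.induction_on with
  | empty => simpa using const 1
  | insert i S hi ih =>
    simp only [Finset.prod_insert hi]
    simpa using (h i (by simp)).mul (ih fun j hj => h j (by simp [hj]))

/-- The Gaussian takes care of infinity, so only the singularity `y^{s+a}` at the boundary matters.
-/
lemma integrable (ha : -1 < a) (hs : -1 < s + a) (hf : Growth s f)
    (hm : AEStronglyMeasurable f (muHalf N a)) : Integrable f (muHalf N a) := by
  obtain ⟨C, c, hC, hc, hb⟩ := hf
  refine ((integrable_rpow_mul_exp ha hs c).const_mul C).mono' hm ?_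
  filter_upwards [ae_yCoord_pos] with X hX using hb X hX

lemma memLp (ha : -1 < a) (hs : -1 < 2 * s + a) (hf : Growth s f)
    (hm : AEStronglyMeasurable f (muHalf N a)) : MemLp f 2 (muHalf N a) := by
  rw [memLp_two_iff_integrable_sq hm]
  have h2 := hf.mul hf
  rw [← two_mul] at h2
  refine (h2.congr fun X _ => sq (f X)).integrable ha hs (hm.pow 2)

end Growth

end Growth

/-! ### Directional derivatives of the weight and the divergence theorem. -/

section IntegrationByParts

variable {N : ℕ} {a : ℝ}

/-- The `i`-th standard basis vector. -/
abbrev basisVec (i : Fin (N + 1)) : Space N := EuclideanSpace.single i (1 : ℝ)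

/-- `1` if `i` is the last index and `0` otherwise. -/
def lastInd (i : Fin (N + 1)) : ℝ := if i = Fin.last N then 1 else 0

lemma yCoord_add_smul (X : Space N) (t : ℝ) (i : Fin (N + 1)) :
    yCoord (X + t • basisVec i) = yCoord X + t * lastInd i := by
  by_cases h : i = Fin.last N
  · subst h; simp [yCoord, lastInd]
  · simp [yCoord, lastInd, h, Ne.symm h]

lemma coord_add_smul_self (X : Space N) (t : ℝ) (i : Fin (N + 1)) :
    (X + t • basisVec i) i = X i + t := by simp

lemma coord_add_smul_of_ne (X : Space N) (t : ℝ) {i j : Fin (N + 1)} (h : j ≠ i) :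
    (X + t • basisVec i) j = X j := by simp [h]

lemma hasLineDerivAt_yCoord (X : Space N) (i : Fin (N + 1)) :
    HasLineDerivAt ℝ yCoord (lastInd i) X (basisVec i) := by
  unfold HasLineDerivAt
  simp only [yCoord_add_smul]
  simpa using ((hasDerivAt_id (0 : ℝ)).mul_const (lastInd i)).const_add (yCoord X)

lemma hasLineDerivAt_comp {f : Space N → ℝ} {f' : ℝ} {g : ℝ → ℝ} {g' : ℝ} {X v : Space N}
    (hg : HasDerivAt g g' (f X)) (hf : HasLineDerivAt ℝ f f' X v) :
    HasLineDerivAt ℝ (fun Y => g (f Y)) (g' * f') X v := by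
  unfold HasLineDerivAt at *
  exact HasDerivAt.comp (0 : ℝ) (by simpa using hg) hf

lemma hasLineDerivAt_mul {f g : Space N → ℝ} {f' g' : ℝ} {X v : Space N}
    (hf : HasLineDerivAt ℝ f f' X v) (hg : HasLineDerivAt ℝ g g' X v) :
    HasLineDerivAt ℝ (fun Y => f Y * g Y) (f' * g X + f X * g') X v := by
  have h := HasDerivAt.mul (𝕜 := ℝ) hf hg
  simp only [zero_smul, add_zero] at h
  exact h

lemma hasLineDerivAt_norm_sq (X : Space N) (i : Fin (N + 1)) :
    HasLineDerivAt ℝ (fun Y : Space N => ‖Y‖ ^ 2) (2 * X i) X (basisVec i) := by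
  have h := (hasStrictFDerivAt_norm_sq X).hasFDerivAt.hasLineDerivAt (basisVec i)
  convert! h using 1
  simp [EuclideanSpace.inner_single_right]

lemma hasLineDerivAt_weight {X : Space N} (hX : 0 < yCoord X) (i : Fin (N + 1)) :
    HasLineDerivAt ℝ (weight N a) (weight N a X * (a * lastInd i / yCoord X - X i / 2)) X
      (basisVec i) := by
  have h1 := hasLineDerivAt_comp (Real.hasDerivAt_rpow_const (p := a) (Or.inl hX.ne'))
    (hasLineDerivAt_yCoord X i)
  have h2 : HasDerivAt (fun r : ℝ => kernelConst N a * Real.exp (-r / 4))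
      (kernelConst N a * (Real.exp (-(‖X‖ ^ 2) / 4) * (-1 / 4))) (‖X‖ ^ 2) :=
    (((hasDerivAt_id _).neg.div_const 4).exp).const_mul _
  have h := hasLineDerivAt_mul h1 (hasLineDerivAt_comp h2 (hasLineDerivAt_norm_sq X i))
  convert! h using 1
  rw [weight, kernelHalf_eq, Real.rpow_sub_one hX.ne']
  field_simp
  ring

/-- The divergence theorem for `muHalf`, for functions supported away from the boundary. -/
lemma integral_lineDeriv_muHalf (ha : -1 < a) (i : Fin (N + 1)) {f f' : Space N → ℝ} {δ : ℝ}
    (hδ : 0 < δ) (hf : ∀ X, 0 < yCoord X → HasLineDerivAt ℝ f (f' X) X (basisVec i))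
    (h0 : ∀ X, yCoord X ≤ δ → f X = 0)
    (hi' : Integrable f' (muHalf N a)) (hi : Integrable f (muHalf N a))
    (hi2 : Integrable (fun X => f X * (a * lastInd i / yCoord X - X i / 2)) (muHalf N a)) :
    ∫ X, f' X ∂(muHalf N a)
      = -∫ X, f X * (a * lastInd i / yCoord X - X i / 2) ∂(muHalf N a) := by
  set q : Space N → ℝ := fun X => a * lastInd i / yCoord X - X i / 2 with hq
  set F : Space N → ℝ := (upperHalf N).indicator fun X => weight N a X * f X
  set F' : Space N → ℝ := (upperHalf N).indicator
    fun X => weight N a X * f' X + weight N a X * (f X * q X)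
  have hF : ∀ X, HasLineDerivAt ℝ F (F' X) X (basisVec i) := by
    intro X
    by_cases hX : 0 < yCoord X
    · have h1 : F' X = weight N a X * f' X + weight N a X * (f X * q X) :=
        indicator_of_mem (show X ∈ upperHalf N from hX) _
      have h2 := hasLineDerivAt_mul (hasLineDerivAt_weight (a := a) hX i) (hf X hX)
      rw [h1]
      refine HasLineDerivAt.congr_of_eventuallyEq (f := fun X => weight N a X * f X) ?_ ?_
      · convert! h2 using 1; simp only [hq]; ring
      · filter_upwards [isOpen_upperHalf.mem_nhds (show X ∈ upperHalf N from hX)] with Y hY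
        exact indicator_of_mem hY _
    · have h1 : F' X = 0 := indicator_of_notMem (show X ∉ upperHalf N from hX) _
      rw [h1]
      refine HasLineDerivAt.congr_of_eventuallyEq (f := fun _ => (0 : ℝ)) ?_ ?_
      · simpa [HasLineDerivAt] using hasDerivAt_const (0 : ℝ) (0 : ℝ)
      -- Vanishing below height `δ` makes the extension by zero differentiable across `y = 0`, where
      -- the weight itself is singular.
      · have : ∀ᶠ Y in 𝓝 X, yCoord Y < δ :=
          continuous_yCoord.continuousAt.eventually_lt continuousAt_const (by linarith)
        filter_upwards [this] with Y hY
        simp [F, indicator, h0 Y hY.le]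
  have hiF : Integrable F := by
    rw [integrable_indicator_iff measurableSet_upperHalf]
    exact (integrable_muHalf ha f).1 hi
  have e1 : IntegrableOn (fun X => weight N a X * f' X) (upperHalf N) :=
    (integrable_muHalf ha f').1 hi'
  have e2 : IntegrableOn (fun X => weight N a X * (f X * q X)) (upperHalf N) :=
    (integrable_muHalf ha _).1 hi2
  have hiF' : Integrable F' := by
    rw [integrable_indicator_iff measurableSet_upperHalf]
    exact e1.add e2
  -- Pairing with the constant function `1` says that the integral of the directional derivative
  -- `F'` is zero.
  have h := integral_bilinear_hasLineDerivAt_right_eq_neg_left_of_integrable (μ := volume)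
    (f := fun _ : Space N => (1 : ℝ)) (f' := fun _ => 0) (g := F) (g' := F') (v := basisVec i)
    (B := ContinuousLinearMap.mul ℝ ℝ) (by simp) (by simpa using hiF') (by simpa using hiF)
    (fun x _ => by simpa [HasLineDerivAt] using hasDerivAt_const (0 : ℝ) (1 : ℝ))
    (fun x _ => hF x)
  simp only [ContinuousLinearMap.mul_apply', one_mul, zero_mul, integral_zero, neg_zero] at h
  rw [integral_indicator measurableSet_upperHalf, integral_add e1 e2] at h
  rw [integral_muHalf ha, integral_muHalf ha]
  simp only [smul_eq_mul]
  linarith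

end IntegrationByParts

/-! ### Smooth cutoffs near the boundary `y = 0`. -/

section Cutoff

lemma exists_bound_deriv_smoothTransition :
    ∃ M : ℝ, 0 ≤ M ∧ ∀ x, |deriv Real.smoothTransition x| ≤ M := by
  have hc : Continuous (deriv Real.smoothTransition) :=
    (Real.smoothTransition.contDiff (n := 1)).continuous_deriv le_rfl
  obtain ⟨M, hM⟩ := (isCompact_Icc (a := (0 : ℝ)) (b := 1)).exists_bound_of_continuousOn
    hc.continuousOn
  refine ⟨max M 0, le_max_right _ _, fun x => ?_⟩
  by_cases hx : x ∈ Icc (0 : ℝ) 1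
  · exact (hM x hx).trans (le_max_left _ _)
  · have : deriv Real.smoothTransition x = 0 := by
      rw [mem_Icc, not_and_or, not_le, not_le] at hx
      rcases hx with hx | hx
      · have : Real.smoothTransition =ᶠ[𝓝 x] fun _ => 0 := by
          filter_upwards [Iio_mem_nhds hx] with y hy
          exact Real.smoothTransition.zero_of_nonpos (le_of_lt hy)
        rw [this.deriv_eq, deriv_const]
      · have : Real.smoothTransition =ᶠ[𝓝 x] fun _ => 1 := by
          filter_upwards [Ioi_mem_nhds hx] with y hy
          exact Real.smoothTransition.one_of_one_le (le_of_lt hy)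
        rw [this.deriv_eq, deriv_const]
    simp [this]

lemma deriv_smoothTransition_of_one_lt {x : ℝ} (hx : 1 < x) :
    deriv Real.smoothTransition x = 0 := by
  have : Real.smoothTransition =ᶠ[𝓝 x] fun _ => 1 := by
    filter_upwards [Ioi_mem_nhds hx] with y hy
    exact Real.smoothTransition.one_of_one_le (le_of_lt hy)
  rw [this.deriv_eq, deriv_const]

lemma continuous_deriv_smoothTransition : Continuous (deriv Real.smoothTransition) :=
  (Real.smoothTransition.contDiff (n := 1)).continuous_deriv le_rfl

lemma hasDerivAt_smoothTransition (x : ℝ) :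
    HasDerivAt Real.smoothTransition (deriv Real.smoothTransition x) x :=
  ((Real.smoothTransition.contDiff (n := 1)).differentiable one_ne_zero x).hasDerivAt

/-- A smooth function of `y` vanishing for `y ≤ 1/n` and equal to `1` for `y ≥ 2/n`. -/
def zeroCut (n : ℕ) (y : ℝ) : ℝ := Real.smoothTransition (n * y - 1)

/-- The derivative of `zeroCut n`. -/
def zeroCutDeriv (n : ℕ) (y : ℝ) : ℝ := n * deriv Real.smoothTransition (n * y - 1)

lemma hasDerivAt_zeroCut (n : ℕ) (y : ℝ) : HasDerivAt (zeroCut n) (zeroCutDeriv n y) y := by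
  have h := (hasDerivAt_smoothTransition (n * y - 1)).comp y
    (((hasDerivAt_id y).const_mul (n : ℝ)).sub_const 1)
  convert! h using 1
  simp [zeroCutDeriv, mul_comm]

lemma contDiff_zeroCut (n : ℕ) : ContDiff ℝ ∞ (zeroCut n) :=
  Real.smoothTransition.contDiff.comp (by fun_prop)

lemma continuous_zeroCutDeriv (n : ℕ) : Continuous (zeroCutDeriv n) :=
  continuous_const.mul (continuous_deriv_smoothTransition.comp (by fun_prop))

lemma abs_zeroCut_le (n : ℕ) (y : ℝ) : |zeroCut n y| ≤ 1 :=
  abs_le.2 ⟨(by norm_num : (-1 : ℝ) ≤ 0).trans (Real.smoothTransition.nonneg _),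
    Real.smoothTransition.le_one _⟩

lemma zeroCut_eq_zero {n : ℕ} {y : ℝ} (h : n * y ≤ 1) : zeroCut n y = 0 :=
  Real.smoothTransition.zero_of_nonpos (by linarith)

/-- The derivative is of size `n`, but it vanishes for `n y > 2`, so a factor `y` compensates
uniformly in `n`. Cutoff errors are thus controlled by an integrable multiple of `1/y`. -/
lemma exists_bound_zeroCutDeriv :
    ∃ K : ℝ, 0 ≤ K ∧ ∀ (n : ℕ) (y : ℝ), 0 < y → |y * zeroCutDeriv n y| ≤ K := by
  obtain ⟨M, hM0, hM⟩ := exists_bound_deriv_smoothTransition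
  refine ⟨2 * M, by positivity, fun n y hy => ?_⟩
  by_cases h : 1 < n * y - 1
  · rw [zeroCutDeriv, deriv_smoothTransition_of_one_lt h]
    simpa using hM0
  · rw [zeroCutDeriv, ← mul_assoc, abs_mul, abs_of_nonneg (by positivity : 0 ≤ y * (n : ℝ))]
    have : y * n ≤ 2 := by linarith
    exact mul_le_mul this (hM _) (abs_nonneg _) (by norm_num)

lemma eventually_lt_mul_sub_one {y : ℝ} (hy : 0 < y) : ∀ᶠ n : ℕ in atTop, 1 < n * y - 1 := by
  have h : Tendsto (fun n : ℕ => (n : ℝ) * y) atTop atTop :=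
    tendsto_natCast_atTop_atTop.atTop_mul_const hy
  filter_upwards [h.eventually_gt_atTop 2] with n hn
  linarith

lemma tendsto_zeroCut {y : ℝ} (hy : 0 < y) : Tendsto (fun n => zeroCut n y) atTop (𝓝 1) := by
  refine tendsto_const_nhds.congr' ?_
  filter_upwards [eventually_lt_mul_sub_one hy] with n hn
  exact (Real.smoothTransition.one_of_one_le hn.le).symm

lemma tendsto_zeroCutDeriv {y : ℝ} (hy : 0 < y) :
    Tendsto (fun n => zeroCutDeriv n y) atTop (𝓝 0) := by
  refine tendsto_const_nhds.congr' ?_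
  filter_upwards [eventually_lt_mul_sub_one hy] with n hn
  rw [zeroCutDeriv, deriv_smoothTransition_of_one_lt hn, mul_zero]

end Cutoff

/-! ### Integration by parts for products, up to the boundary. -/

section IntegrationByPartsMul

lemma integrable_mul_of_ae_bound {α : Type*} [MeasurableSpace α] {μ : Measure α} {g h : α → ℝ}
    {K : ℝ} (hg : Integrable g μ) (hm : AEStronglyMeasurable h μ) (hb : ∀ᵐ x ∂μ, |h x| ≤ K) :
    Integrable (fun x => g x * h x) μ := by
  simpa [mul_comm] using hg.bdd_mul hm hb

lemma tendsto_integral_mul_of_ae_bound {α : Type*} [MeasurableSpace α] {μ : Measure α}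
    {g : α → ℝ} {h : ℕ → α → ℝ} {k : α → ℝ} {K : ℝ} (hg : Integrable g μ)
    (hm : ∀ n, AEStronglyMeasurable (h n) μ) (hb : ∀ n, ∀ᵐ x ∂μ, |h n x| ≤ K)
    (hl : ∀ᵐ x ∂μ, Tendsto (fun n => h n x) atTop (𝓝 (k x))) :
    Tendsto (fun n => ∫ x, g x * h n x ∂μ) atTop (𝓝 (∫ x, g x * k x ∂μ)) := by
  refine tendsto_integral_of_dominated_convergence (fun x => |g x| * K)
    (fun n => hg.aestronglyMeasurable.mul (hm n)) (hg.abs.mul_const K) (fun n => ?_) ?_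
  · filter_upwards [hb n] with x hx
    rw [Real.norm_eq_abs, abs_mul]
    gcongr
  · filter_upwards [hl] with x hx using hx.const_mul _

variable {N : ℕ} {a : ℝ}

/-- Integration by parts for `muHalf`, without boundary term. -/
lemma integral_lineDeriv_mul_muHalf (ha : -1 < a) (i : Fin (N + 1)) {φ φ' d d' : Space N → ℝ}
    (hφ : ∀ X, 0 < yCoord X → HasLineDerivAt ℝ φ (φ' X) X (basisVec i))
    (hd : ∀ X, 0 < yCoord X → HasLineDerivAt ℝ d (d' X) X (basisVec i))
    (I1 : Integrable (fun X => φ' X * d X) (muHalf N a))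
    (I2 : Integrable (fun X => φ X * d' X) (muHalf N a))
    (I3 : Integrable (fun X => φ X * d X) (muHalf N a))
    (I4 : Integrable (fun X => φ X * d X * X i) (muHalf N a))
    (I5 : Integrable (fun X => φ X * d X * (lastInd i * (yCoord X)⁻¹)) (muHalf N a)) :
    ∫ X, φ' X * d X ∂(muHalf N a)
      = -∫ X, φ X * (d' X + (a * lastInd i / yCoord X - X i / 2) * d X) ∂(muHalf N a) := by
  obtain ⟨K, hK0, hK⟩ := exists_bound_zeroCutDeriv
  set μ := muHalf N a
  have m1 : ∀ n, AEStronglyMeasurable (fun X : Space N => zeroCut n (yCoord X)) μ := fun n =>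
    ((contDiff_zeroCut n).continuous.comp continuous_yCoord).aestronglyMeasurable
  have m2 : ∀ n, AEStronglyMeasurable (fun X : Space N => yCoord X * zeroCutDeriv n (yCoord X)) μ :=
    fun n => (continuous_yCoord.mul
      ((continuous_zeroCutDeriv n).comp continuous_yCoord)).aestronglyMeasurable
  have b1 : ∀ n, ∀ᵐ X ∂μ, |zeroCut n (yCoord X)| ≤ 1 :=
    fun n => ae_of_all _ fun X => abs_zeroCut_le n _
  have b2 : ∀ n, ∀ᵐ X ∂μ, |yCoord X * zeroCutDeriv n (yCoord X)| ≤ K :=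
    fun n => by filter_upwards [ae_yCoord_pos] with X hX using hK n _ hX
  have t1 : ∀ᵐ X ∂μ, Tendsto (fun n => zeroCut n (yCoord X)) atTop (𝓝 ((fun _ => (1 : ℝ)) X)) := by
    filter_upwards [ae_yCoord_pos] with X hX using tendsto_zeroCut hX
  have t2 : ∀ᵐ X ∂μ, Tendsto (fun n => yCoord X * zeroCutDeriv n (yCoord X)) atTop
      (𝓝 ((fun _ => (0 : ℝ)) X)) := by
    filter_upwards [ae_yCoord_pos] with X hX
    simpa using (tendsto_zeroCutDeriv hX).const_mul (yCoord X)
  have I12 : Integrable (fun X => φ' X * d X + φ X * d' X) μ := I1.add I2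
  have Iq : Integrable (fun X => φ X * d X * (a * lastInd i / yCoord X - X i / 2)) μ := by
    refine ((I5.const_mul a).sub (I4.const_mul (1 / 2))).congr (ae_of_all _ fun X => ?_)
    simp only [Pi.sub_apply]; ring
  -- The derivative of the cutoff is written as `y⁻¹ · (y χ_n')`. The factor `y⁻¹` is covered by
  -- `I5`, while `y χ_n'` is bounded and tends to `0` pointwise, so no boundary term survives in the
  -- limit.
  have key : ∀ n : ℕ, 1 ≤ n →
      (∫ X, (φ' X * d X + φ X * d' X) * zeroCut n (yCoord X) ∂μ)
        + ∫ X, φ X * d X * (lastInd i * (yCoord X)⁻¹) * (yCoord X * zeroCutDeriv n (yCoord X)) ∂μ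
      = -∫ X, φ X * d X * (a * lastInd i / yCoord X - X i / 2) * zeroCut n (yCoord X) ∂μ := by
    intro n hn
    have hn' : (0 : ℝ) < n := by exact_mod_cast hn
    have J1 := integrable_mul_of_ae_bound I12 (m1 n) (b1 n)
    have J2 := integrable_mul_of_ae_bound I5 (m2 n) (b2 n)
    have J3 := integrable_mul_of_ae_bound Iq (m1 n) (b1 n)
    have J4 := integrable_mul_of_ae_bound I3 (m1 n) (b1 n)
    rw [← integral_add J1 J2]
    have h := integral_lineDeriv_muHalf ha i (δ := 1 / n) (by positivity)
      (f := fun X => φ X * d X * zeroCut n (yCoord X))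
      (f' := fun X => (φ' X * d X + φ X * d' X) * zeroCut n (yCoord X)
        + φ X * d X * (lastInd i * (yCoord X)⁻¹) * (yCoord X * zeroCutDeriv n (yCoord X)))
      ?_ ?_ (J1.add J2) J4 ?_
    · rw [h]
      congr 2; ext X; ring
    · intro X hX
      have := hasLineDerivAt_mul (hasLineDerivAt_mul (hφ X hX) (hd X hX))
        (hasLineDerivAt_comp (hasDerivAt_zeroCut n (yCoord X)) (hasLineDerivAt_yCoord X i))
      convert! this using 1
      field_simp
    · intro X hX
      rw [zeroCut_eq_zero, mul_zero]
      rw [le_div_iff₀ hn'] at hX; linarith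
    · refine J3.congr (ae_of_all _ fun X => ?_)
      ring
  have l1 := tendsto_integral_mul_of_ae_bound I12 m1 b1 t1
  have l2 := tendsto_integral_mul_of_ae_bound I5 m2 b2 t2
  have l3 := tendsto_integral_mul_of_ae_bound Iq m1 b1 t1
  have hlim := tendsto_nhds_unique ((l1.add l2).congr' ((eventually_ge_atTop 1).mono key)) l3.neg
  simp only [mul_one, mul_zero, integral_zero, add_zero] at hlim
  rw [integral_add I1 I2] at hlim
  have e : ∫ X, φ X * (d' X + (a * lastInd i / yCoord X - X i / 2) * d X) ∂μ
      = ∫ X, φ X * d' X ∂μ + ∫ X, φ X * d X * (a * lastInd i / yCoord X - X i / 2) ∂μ := by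
    rw [← integral_add I2 Iq]
    congr 1; ext X; ring
  rw [e]; linarith

end IntegrationByPartsMul

/-! ### The Hermite and Laguerre-type polynomials and their differential equations. -/

section Polynomials

open Polynomial

/-- Hermite polynomials of the Gaussian of variance `2`. -/
def herm : ℕ → ℝ[X]
  | 0 => 1
  | n + 1 => X * herm n - C 2 * derivative (herm n)

/-- This Appell property turns the defining recursion into the Hermite equation `herm_ode`. -/
lemma derivative_herm_succ (n : ℕ) : derivative (herm (n + 1)) = C ((n : ℝ) + 1) * herm n := by
  induction n with
  | zero => simp [herm]
  | succ n ih =>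
    rw [herm, derivative_sub, derivative_mul, derivative_C_mul, derivative_X, ih, derivative_C_mul]
    have : herm (n + 1) = X * herm n - C 2 * derivative (herm n) := rfl
    rw [this]
    simp only [Nat.cast_add, Nat.cast_one, map_add, map_one]
    ring

lemma herm_ode (n : ℕ) :
    C 2 * derivative (derivative (herm n)) - X * derivative (herm n) + C (n : ℝ) * herm n = 0 := by
  cases n with
  | zero => simp [herm]
  | succ n =>
    rw [derivative_herm_succ, derivative_C_mul]
    have : herm (n + 1) = X * herm n - C 2 * derivative (herm n) := rfl
    rw [this]
    simp only [Nat.cast_add, Nat.cast_one, map_add, map_one]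
    ring

lemma herm_one : herm 1 = X := by simp [herm]

lemma monic_herm (n : ℕ) : (herm n).Monic ∧ (herm n).natDegree = n := by
  induction n with
  | zero => simp [herm]
  | succ n ih =>
    obtain ⟨hm, hd⟩ := ih
    have hXm : (X * herm n).Monic := monic_X.mul hm
    have hXd : (X * herm n).natDegree = n + 1 := by
      rw [natDegree_X_mul hm.ne_zero, hd]
    have hlt : (C 2 * derivative (herm n)).degree < (X * herm n).degree := by
      have h1 : (C 2 * derivative (herm n)).degree ≤ ((n : ℕ) : WithBot ℕ) := by
        rw [degree_C_mul two_ne_zero]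
        exact (degree_derivative_le.trans degree_le_natDegree).trans_eq (by rw [hd])
      refine h1.trans_lt ?_
      rw [degree_eq_natDegree hXm.ne_zero, hXd]
      exact_mod_cast Nat.lt_succ_self n
    refine ⟨hXm.sub_of_left hlt, ?_⟩
    rw [herm, natDegree_eq_of_degree_eq (degree_sub_eq_left_of_degree_lt hlt), hXd]

/-- Coefficients of the Laguerre-type polynomial `lag c k`. -/
def lagCoeff (c : ℝ) (k : ℕ) : ℕ → ℝ
  | 0 => 1
  | j + 1 => ((j : ℝ) - k) / ((j + 1) * (4 * j + c)) * lagCoeff c k j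

/-- The polynomial solution of `4 s w'' + (c - s) w' + k w = 0`. -/
def lag (c : ℝ) (k : ℕ) : ℝ[X] := ∑ j ∈ Finset.range (k + 1), monomial j (lagCoeff c k j)

/-- The factor `j - k` in the recursion vanishes at `j = k`: the power series solution terminates.
-/
lemma lagCoeff_eq_zero (c : ℝ) (k : ℕ) {j : ℕ} (h : k < j) : lagCoeff c k j = 0 := by
  induction j with
  | zero => omega
  | succ j ih =>
    rcases Nat.lt_succ_iff_lt_or_eq.1 h with h | h
    · rw [lagCoeff, ih h, mul_zero]
    · subst h; simp [lagCoeff]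

lemma lagCoeff_ne_zero {c : ℝ} (hc : 0 < c) (k : ℕ) {j : ℕ} (h : j ≤ k) : lagCoeff c k j ≠ 0 := by
  induction j with
  | zero => simp [lagCoeff]
  | succ j ih =>
    rw [lagCoeff]
    have h1 : ((j : ℝ) - k) ≠ 0 := by
      have : (j : ℝ) < k := by exact_mod_cast h
      linarith
    have h2 : ((j : ℝ) + 1) * (4 * j + c) ≠ 0 := by positivity
    exact mul_ne_zero (div_ne_zero h1 h2) (ih (by omega))

lemma coeff_lag (c : ℝ) (k j : ℕ) : (lag c k).coeff j = lagCoeff c k j := by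
  simp only [lag, finsetSum_coeff, coeff_monomial]
  rw [Finset.sum_ite_eq']
  split_ifs with h
  · rfl
  · rw [Finset.mem_range] at h
    exact (lagCoeff_eq_zero c k (by omega)).symm

lemma lag_zero (c : ℝ) : lag c 0 = 1 := by simp [lag, lagCoeff]

lemma natDegree_lag {c : ℝ} (hc : 0 < c) (k : ℕ) : (lag c k).natDegree = k := by
  refine natDegree_eq_of_le_of_coeff_ne_zero ?_ ?_
  · rw [natDegree_le_iff_coeff_eq_zero]
    intro j hj
    rw [coeff_lag, lagCoeff_eq_zero c k hj]
  · rw [coeff_lag]; exact lagCoeff_ne_zero hc k le_rfl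

/-- Comparing coefficients of `s^j` gives `(j + 1)(4j + c) w_{j+1} = (j - k) w_j`, which is the
recursion for `lagCoeff`; `c > 0` keeps the denominators nonzero. -/
lemma lag_ode {c : ℝ} (hc : 0 < c) (k : ℕ) :
    C 4 * (X * derivative (derivative (lag c k))) + C c * derivative (lag c k)
      - X * derivative (lag c k) + C (k : ℝ) * lag c k = 0 := by
  ext j
  cases j with
  | zero =>
    simp only [coeff_add, coeff_sub, coeff_C_mul, coeff_derivative, coeff_X_mul_zero, coeff_lag,
      lagCoeff, coeff_zero]
    field_simp
    push_cast
    ring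
  | succ j =>
    simp only [coeff_add, coeff_sub, coeff_C_mul, coeff_derivative, coeff_X_mul, coeff_lag,
      coeff_zero]
    rw [show lagCoeff c k (j + 1 + 1) = (((j + 1 : ℕ) : ℝ) - k)
      / ((((j + 1 : ℕ) : ℝ) + 1) * (4 * ((j + 1 : ℕ) : ℝ) + c)) * lagCoeff c k (j + 1) from rfl]
    push_cast
    have h1 : ((j : ℝ) + 1 + 1) ≠ 0 := by positivity
    have h2 : (4 * ((j : ℝ) + 1) + c) ≠ 0 := by positivity
    field_simp
    ring

end Polynomials

/-! ### Product eigenfunctions and their pointwise equations. -/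

section Eigenfunctions

open Polynomial

variable {N : ℕ} {a κ : ℝ}

/-- The polynomial factor of the eigenfunctions in the variable `X_i`. -/
def eigPoly (N : ℕ) (a κ : ℝ) (i : Fin (N + 1)) (n : ℕ) : ℝ[X] :=
  if i = Fin.last N then (lag (2 + 4 * κ + 2 * a) n).comp (X ^ 2) else herm n

/-- The eigenvalue in direction `i`. -/
def eigVal (N : ℕ) (κ : ℝ) (i : Fin (N + 1)) (n : ℕ) : ℝ :=
  if i = Fin.last N then κ / 2 + n else n / 2

lemma eigVal_injective (i : Fin (N + 1)) : Function.Injective (eigVal N κ i) := by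
  intro m n h
  unfold eigVal at h
  split_ifs at h
  · exact_mod_cast add_left_cancel h
  · have : (m : ℝ) = n := by linarith
    exact_mod_cast this

/-- In the last variable put `p(y) = w(y²)`. Then `p' = 2y w'` and `p'' = 2w' + 4y² w''`, and the
equation becomes `4s w'' + (2 + 4κ + 2a - s) w' + n w = 0` at `s = y²`; this explains the parameter
of `lag`. The coefficient `(2κ + a)/y` arises from conjugating by `y^κ`. -/
lemma eigPoly_ode (hc : 0 < 2 + 4 * κ + 2 * a) (i : Fin (N + 1)) (n : ℕ) {t : ℝ}
    (ht : i = Fin.last N → t ≠ 0) :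
    (derivative (derivative (eigPoly N a κ i n))).eval t
      + (lastInd i * (2 * κ + a) / t - t / 2) * (derivative (eigPoly N a κ i n)).eval t
      + (eigVal N κ i n - lastInd i * κ / 2) * (eigPoly N a κ i n).eval t = 0 := by
  unfold eigPoly eigVal lastInd
  split_ifs with h
  · have ht' := ht h
    have ho := congrArg (eval (t ^ 2)) (lag_ode hc n)
    simp only [eval_add, eval_sub, eval_mul, eval_C, eval_X, eval_zero] at ho
    simp only [derivative_comp, derivative_X_pow, derivative_mul, eval_add, eval_mul,
      eval_comp, eval_pow, eval_X, Nat.cast_ofNat, map_ofNat, eval_ofNat, derivative_ofNat, eval_zero,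
      Nat.add_one_sub_one, pow_one, derivative_X, eval_one, one_mul]
    field_simp
    linear_combination 2 * ho
  · have ho := congrArg (eval t) (herm_ode n)
    simp only [eval_add, eval_sub, eval_mul, eval_C, eval_X, eval_zero] at ho
    linear_combination ho / 2

/-- The product of the polynomial factors in all variables but `X_i`. -/
def eigRest (N : ℕ) (a κ : ℝ) (n : Fin (N + 1) → ℕ) (i : Fin (N + 1)) (X : Space N) : ℝ :=
  ∏ j ∈ Finset.univ.erase i, (eigPoly N a κ j (n j)).eval (X j)

/-- The eigenfunctions. -/
def eig (N : ℕ) (a κ : ℝ) (n : Fin (N + 1) → ℕ) (X : Space N) : ℝ :=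
  yCoord X ^ κ * ∏ j, (eigPoly N a κ j (n j)).eval (X j)

/-- The partial derivatives of the eigenfunctions. -/
def eigD (N : ℕ) (a κ : ℝ) (n : Fin (N + 1) → ℕ) (i : Fin (N + 1)) (X : Space N) : ℝ :=
  (κ * lastInd i * yCoord X ^ (κ - 1) * (eigPoly N a κ i (n i)).eval (X i)
    + yCoord X ^ κ * (derivative (eigPoly N a κ i (n i))).eval (X i)) * eigRest N a κ n i X

/-- The pure second partial derivatives of the eigenfunctions. -/
def eigDD (N : ℕ) (a κ : ℝ) (n : Fin (N + 1) → ℕ) (i : Fin (N + 1)) (X : Space N) : ℝ :=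
  (κ * (κ - 1) * lastInd i * yCoord X ^ (κ - 2) * (eigPoly N a κ i (n i)).eval (X i)
    + 2 * κ * lastInd i * yCoord X ^ (κ - 1) * (derivative (eigPoly N a κ i (n i))).eval (X i)
    + yCoord X ^ κ * (derivative (derivative (eigPoly N a κ i (n i)))).eval (X i))
      * eigRest N a κ n i X

lemma eig_eq (n : Fin (N + 1) → ℕ) (i : Fin (N + 1)) (X : Space N) :
    eig N a κ n X = yCoord X ^ κ * (eigPoly N a κ i (n i)).eval (X i) * eigRest N a κ n i X := by
  rw [eig, eigRest, mul_assoc, 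
    Finset.mul_prod_erase Finset.univ (fun j => (eigPoly N a κ j (n j)).eval (X j))
      (Finset.mem_univ i)]

lemma hasLineDerivAt_eigRest (n : Fin (N + 1) → ℕ) (i : Fin (N + 1)) (X : Space N) :
    HasLineDerivAt ℝ (eigRest N a κ n i) 0 X (basisVec i) := by
  have : ∀ t : ℝ, eigRest N a κ n i (X + t • basisVec i) = eigRest N a κ n i X := fun t => by
    unfold eigRest
    refine Finset.prod_congr rfl fun j hj => ?_
    rw [coord_add_smul_of_ne X t (Finset.ne_of_mem_erase hj)]
  unfold HasLineDerivAt
  simp only [this]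
  exact hasDerivAt_const _ _

lemma hasLineDerivAt_coord (i : Fin (N + 1)) (X : Space N) :
    HasLineDerivAt ℝ (fun Y : Space N => Y i) 1 X (basisVec i) := by
  unfold HasLineDerivAt
  simp only [coord_add_smul_self]
  exact (hasDerivAt_id (0 : ℝ)).const_add _

lemma hasLineDerivAt_add {f g : Space N → ℝ} {f' g' : ℝ} {X v : Space N}
    (hf : HasLineDerivAt ℝ f f' X v) (hg : HasLineDerivAt ℝ g g' X v) :
    HasLineDerivAt ℝ (fun Y => f Y + g Y) (f' + g') X v :=
  HasDerivAt.add (𝕜 := ℝ) hf hg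

lemma hasLineDerivAt_rpow_mul_poly {X : Space N} (hX : 0 < yCoord X) (i : Fin (N + 1)) (s : ℝ)
    (p : ℝ[X]) :
    HasLineDerivAt ℝ (fun Y : Space N => yCoord Y ^ s * p.eval (Y i))
      (s * lastInd i * yCoord X ^ (s - 1) * p.eval (X i)
        + yCoord X ^ s * (derivative p).eval (X i)) X (basisVec i) := by
  have h1 := hasLineDerivAt_comp (Real.hasDerivAt_rpow_const (p := s) (Or.inl hX.ne'))
    (hasLineDerivAt_yCoord X i)
  have h2 := hasLineDerivAt_comp (p.hasDerivAt (X i)) (hasLineDerivAt_coord i X)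
  convert! hasLineDerivAt_mul h1 h2 using 1
  ring

lemma hasLineDerivAt_eig (n : Fin (N + 1) → ℕ) (i : Fin (N + 1)) {X : Space N}
    (hX : 0 < yCoord X) :
    HasLineDerivAt ℝ (eig N a κ n) (eigD N a κ n i X) X (basisVec i) := by
  have h := hasLineDerivAt_mul (hasLineDerivAt_rpow_mul_poly hX i κ (eigPoly N a κ i (n i)))
    (hasLineDerivAt_eigRest (a := a) (κ := κ) n i X)
  have e : eig N a κ n = fun Y => yCoord Y ^ κ * (eigPoly N a κ i (n i)).eval (Y i)
      * eigRest N a κ n i Y := funext fun Y => eig_eq n i Y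
  rw [e]
  convert! h using 1
  rw [eigD, mul_zero, add_zero]

lemma hasLineDerivAt_eigD (n : Fin (N + 1) → ℕ) (i : Fin (N + 1)) {X : Space N}
    (hX : 0 < yCoord X) :
    HasLineDerivAt ℝ (eigD N a κ n i) (eigDD N a κ n i X) X (basisVec i) := by
  have h1 := hasLineDerivAt_comp ((hasDerivAt_id (yCoord X ^ (κ - 1) *
    (eigPoly N a κ i (n i)).eval (X i))).const_mul (κ * lastInd i))
    (hasLineDerivAt_rpow_mul_poly hX i (κ - 1) (eigPoly N a κ i (n i)))
  have h2 := hasLineDerivAt_rpow_mul_poly hX i κ (derivative (eigPoly N a κ i (n i)))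
  have h := hasLineDerivAt_mul (hasLineDerivAt_add h1 h2)
    (hasLineDerivAt_eigRest (a := a) (κ := κ) n i X)
  convert! h using 1
  · ext Y; simp [eigD, mul_assoc]
  · rw [eigDD, show κ - 1 - 1 = κ - 2 by ring, mul_zero, add_zero]
    have : lastInd i * lastInd i = lastInd i := by unfold lastInd; split_ifs <;> simp
    linear_combination (-κ * (κ - 1) * yCoord X ^ (κ - 2) * (eigPoly N a κ i (n i)).eval (X i)
      * eigRest N a κ n i X) * this

/-- The eigenvalue equation in direction `i`. -/
lemma eigDD_add (hκ : κ = 0 ∨ κ = 1 - a) (hc : 0 < 2 + 4 * κ + 2 * a) (n : Fin (N + 1) → ℕ)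
    (i : Fin (N + 1)) {X : Space N} (hX : 0 < yCoord X) :
    eigDD N a κ n i X + (a * lastInd i / yCoord X - X i / 2) * eigD N a κ n i X
      = -(eigVal N κ i (n i) * eig N a κ n X) := by
  have ho := eigPoly_ode hc i (n i) (t := X i) (fun h => by subst h; exact hX.ne')
  rw [eigDD, eigD, eig_eq n i, show κ - 2 = κ - 1 - 1 by ring, Real.rpow_sub_one hX.ne',
    Real.rpow_sub_one hX.ne']
  -- The indicial equation at `y = 0`; it cancels the terms of order `y^{κ-2}`.
  have hk : κ * (κ - 1 + a) = 0 := by rcases hκ with h | h <;> subst h <;> ring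
  unfold lastInd at *
  split_ifs at * with h
  · have hy : X i = yCoord X := by rw [h]; rfl
    rw [hy] at ho ⊢
    field_simp at ho ⊢
    linear_combination yCoord X * eigRest N a κ n i X * ho
      + 2 * eigRest N a κ n i X * (eigPoly N a κ i (n i)).eval (yCoord X) * hk
  · linear_combination yCoord X ^ κ * eigRest N a κ n i X * ho

end Eigenfunctions

/-! ### The weak eigenvalue identity and orthogonality. -/

section EigenIdentity

open Polynomial

variable {N : ℕ} {a κ : ℝ}

lemma growth_eigPolyEval (i : Fin (N + 1)) (p : ℝ[X]) :
    Growth 0 (fun X : Space N => p.eval (X i)) := (Growth.coord i).polyEval p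

lemma growth_eigRest (n : Fin (N + 1) → ℕ) (i : Fin (N + 1)) : Growth 0 (eigRest N a κ n i) :=
  Growth.prod _ fun j _ => growth_eigPolyEval j _

lemma growth_rpow_mul (s : ℝ) {f : Space N → ℝ} (hf : Growth 0 f) (k : ℝ) :
    Growth s fun X => k * yCoord X ^ s * f X := by
  simpa using ((Growth.rpow (N := N) s).const_mul k).mul hf

lemma growth_eig (n : Fin (N + 1) → ℕ) : Growth κ (eig N a κ n) := by
  exact (growth_rpow_mul κ (Growth.prod Finset.univ
    fun j _ => growth_eigPolyEval j (eigPoly N a κ j (n j))) 1).congr fun X _ => by simp [eig]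

lemma growth_eigD (n : Fin (N + 1) → ℕ) (i : Fin (N + 1)) :
    Growth (κ - 1) (eigD N a κ n i) := by
  have h1 := growth_rpow_mul (N := N) (κ - 1) (growth_eigPolyEval i (eigPoly N a κ i (n i)))
    (κ * lastInd i)
  have h2 := (growth_rpow_mul (N := N) κ
    (growth_eigPolyEval i (derivative (eigPoly N a κ i (n i)))) 1).mono
    (t := κ - 1) (by linarith)
  simpa using ((h1.add h2).mul (growth_eigRest (a := a) (κ := κ) n i)).congr
    (g := eigD N a κ n i) fun X _ => by simp [eigD]

lemma growth_eigDD (n : Fin (N + 1) → ℕ) (i : Fin (N + 1)) :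
    Growth (κ - 2) (eigDD N a κ n i) := by
  have h0 := growth_rpow_mul (N := N) (κ - 2) (growth_eigPolyEval i (eigPoly N a κ i (n i)))
    (κ * (κ - 1) * lastInd i)
  have h1 := (growth_rpow_mul (N := N) (κ - 1)
    (growth_eigPolyEval i (derivative (eigPoly N a κ i (n i)))) (2 * κ * lastInd i)).mono
    (t := κ - 2) (by linarith)
  have h2 := (growth_rpow_mul (N := N) κ
    (growth_eigPolyEval i (derivative (derivative (eigPoly N a κ i (n i))))) 1).mono
    (t := κ - 2) (by linarith)
  simpa using (((h0.add h1).add h2).mul (growth_eigRest (a := a) (κ := κ) n i)).congr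
    (g := eigDD N a κ n i) fun X _ => by simp [eigDD]

/-- For `κ = 0` the singular term of the derivative is absent. The general bound `y^{κ-1} = y^{-1}`
would not suffice, since `y^{a-1}` is not integrable at `0` when `a ≤ 0`. -/
lemma growth_eigD_zero (n : Fin (N + 1) → ℕ) (i : Fin (N + 1)) : Growth 0 (eigD N a 0 n i) := by
  simpa using ((growth_eigPolyEval i (derivative (eigPoly N a 0 i (n i)))).mul
    (growth_eigRest (a := a) (κ := 0) n i)).congr
    (g := eigD N a 0 n i) fun X _ => by simp [eigD]

lemma growth_eigDD_zero (n : Fin (N + 1) → ℕ) (i : Fin (N + 1)) :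
    Growth 0 (eigDD N a 0 n i) := by
  simpa using ((growth_eigPolyEval i (derivative (derivative (eigPoly N a 0 i (n i))))).mul
    (growth_eigRest (a := a) (κ := 0) n i)).congr
    (g := eigDD N a 0 n i) fun X _ => by simp [eigDD]

/-- The Neumann condition: the last factor is a polynomial in `y²`, so its derivative is divisible
by `y`. -/
lemma growth_eigD_zero_div (n : Fin (N + 1) → ℕ) (i : Fin (N + 1)) :
    Growth 0 (fun X => eigD N a 0 n i X * (lastInd i * (yCoord X)⁻¹)) := by
  by_cases h : i = Fin.last N
  · have h2 : Growth (N := N) 0 fun X => 2 *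
        (derivative (lag (2 + 4 * 0 + 2 * a) (n i))).eval (yCoord X ^ 2) :=
      (((Growth.coord (Fin.last N)).pow 2).polyEval _).const_mul 2
    have h3 := (h2.mul (growth_eigRest (a := a) (κ := 0) n i)).congr
      (g := fun X => eigD N a 0 n i X * (lastInd i * (yCoord X)⁻¹)) fun X hX => ?_
    · simpa using h3
    · have hy : X (Fin.last N) = yCoord X := rfl
      simp [eigD, eigPoly, lastInd, h, derivative_comp, hy]
      field_simp
      ring
  · exact (Growth.const 0).congr fun X _ => by simp [lastInd, h]

lemma measurable_coord (i : Fin (N + 1)) : Measurable (fun X : Space N => X i) :=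
  (by fun_prop : Continuous fun X : Space N => X i).measurable

lemma measurable_polyEval (i : Fin (N + 1)) (p : ℝ[X]) :
    Measurable (fun X : Space N => p.eval (X i)) := p.continuous.measurable.comp (measurable_coord i)

lemma measurable_eigRest (n : Fin (N + 1) → ℕ) (i : Fin (N + 1)) :
    Measurable (eigRest N a κ n i) :=
  Finset.measurable_fun_prod _ fun j _ => measurable_polyEval j _

lemma measurable_eig (n : Fin (N + 1) → ℕ) : Measurable (eig N a κ n) :=
  (measurable_yCoord.pow_const κ).mul
    (Finset.measurable_fun_prod _ fun j _ => measurable_polyEval j _)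

lemma measurable_eigD (n : Fin (N + 1) → ℕ) (i : Fin (N + 1)) : Measurable (eigD N a κ n i) :=
  ((((measurable_yCoord.pow_const _).const_mul _).mul (measurable_polyEval i _)).add
    ((measurable_yCoord.pow_const κ).mul (measurable_polyEval i _))).mul (measurable_eigRest n i)

lemma measurable_eigDD (n : Fin (N + 1) → ℕ) (i : Fin (N + 1)) : Measurable (eigDD N a κ n i) :=
  (((((measurable_yCoord.pow_const _).const_mul _).mul (measurable_polyEval i _)).add
    (((measurable_yCoord.pow_const _).const_mul _).mul (measurable_polyEval i _))).add
    ((measurable_yCoord.pow_const κ).mul (measurable_polyEval i _))).mul (measurable_eigRest n i)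

/-- Functions that may be integrated by parts against the eigenfunctions: `φ'` is the derivative of
`φ` in direction `i`, both with suitable bounds. -/
structure Admissible (N : ℕ) (a κ : ℝ) (i : Fin (N + 1)) (φ φ' : Space N → ℝ) : Prop where
  deriv : ∀ X, 0 < yCoord X → HasLineDerivAt ℝ φ (φ' X) X (basisVec i)
  meas : Measurable φ
  meas' : Measurable φ'
  growth : (κ = 0 ∧ Growth 0 φ ∧ Growth 0 φ') ∨
    (κ = 1 - a ∧ ∃ σ, 0 < σ ∧ Growth σ φ ∧ Growth (σ - 1) φ')

lemma admissible_eig (ha' : a < 1) (hκ : κ = 0 ∨ κ = 1 - a) (n : Fin (N + 1) → ℕ)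
    (i : Fin (N + 1)) : Admissible N a κ i (eig N a κ n) (eigD N a κ n i) where
  deriv X hX := hasLineDerivAt_eig n i hX
  meas := measurable_eig n
  meas' := measurable_eigD n i
  growth := by
    rcases hκ with h | h
    · subst h
      exact Or.inl ⟨rfl, growth_eig n, growth_eigD_zero n i⟩
    · exact Or.inr ⟨h, κ, by linarith, growth_eig n, growth_eigD n i⟩

/-- Integration by parts in direction `i` puts the one-dimensional operator on the eigenfunction,
where `eigDD_add` applies. If `κ = 0`, every integrand has growth exponent `0` at the boundary. If
`κ = 1 - a`, the worst ones are of order `y^{σ-1-a}`, which becomes `y^{σ-1}` with the weight and is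
integrable because `σ > 0`. -/
lemma Admissible.integral_mul_eigD (ha : -1 < a) (ha' : a < 1) {i : Fin (N + 1)}
    {φ φ' : Space N → ℝ} (h : Admissible N a κ i φ φ') (n : Fin (N + 1) → ℕ) :
    ∫ X, φ' X * eigD N a κ n i X ∂(muHalf N a)
      = eigVal N κ i (n i) * ∫ X, φ X * eig N a κ n X ∂(muHalf N a) := by
  have hκ : κ = 0 ∨ κ = 1 - a := h.growth.imp And.left And.left
  have hc : 0 < 2 + 4 * κ + 2 * a := by rcases hκ with h | h <;> linarith
  have m := h.meas
  have m' := h.meas'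
  have md := measurable_eigD (a := a) (κ := κ) n i
  have mdd := measurable_eigDD (a := a) (κ := κ) n i
  have my : Measurable fun X : Space N => lastInd i * (yCoord X)⁻¹ :=
    measurable_yCoord.inv.const_mul _
  have hI : Integrable (fun X => φ' X * eigD N a κ n i X) (muHalf N a) ∧
      Integrable (fun X => φ X * eigDD N a κ n i X) (muHalf N a) ∧
      Integrable (fun X => φ X * eigD N a κ n i X) (muHalf N a) ∧
      Integrable (fun X => φ X * eigD N a κ n i X * X i) (muHalf N a) ∧
      Integrable (fun X => φ X * eigD N a κ n i X * (lastInd i * (yCoord X)⁻¹)) (muHalf N a) := by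
    rcases h.growth with ⟨rfl, g, g'⟩ | ⟨hk, σ, hσ, g, g'⟩
    · have d := growth_eigD_zero (a := a) n i
      refine ⟨(g'.mul d).integrable ha (by linarith) (m'.mul md).aestronglyMeasurable,
        (g.mul (growth_eigDD_zero n i)).integrable ha (by linarith)
          (m.mul mdd).aestronglyMeasurable,
        (g.mul d).integrable ha (by linarith) (m.mul md).aestronglyMeasurable,
        ((g.mul d).mul (Growth.coord i)).integrable ha (by linarith)
          ((m.mul md).mul (measurable_coord i)).aestronglyMeasurable,
        ((g.mul (growth_eigD_zero_div n i)).congr fun X _ => mul_assoc _ _ _).integrable ha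
          (by linarith) ((m.mul md).mul my).aestronglyMeasurable⟩
    · have d := growth_eigD (a := a) (κ := κ) n i
      refine ⟨(g'.mul d).integrable ha (by linarith) (m'.mul md).aestronglyMeasurable,
        (g.mul (growth_eigDD n i)).integrable ha (by linarith) (m.mul mdd).aestronglyMeasurable,
        (g.mul d).integrable ha (by linarith) (m.mul md).aestronglyMeasurable,
        ((g.mul d).mul (Growth.coord i)).integrable ha (by linarith)
          ((m.mul md).mul (measurable_coord i)).aestronglyMeasurable,
        ((g.mul d).mul (Growth.inv.const_mul (lastInd i))).integrable ha
          (by linarith) ((m.mul md).mul my).aestronglyMeasurable⟩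
  obtain ⟨I1, I2, I3, I4, I5⟩ := hI
  rw [integral_lineDeriv_mul_muHalf ha i h.deriv (fun X hX => hasLineDerivAt_eigD n i hX)
    I1 I2 I3 I4 I5, ← integral_neg, ← integral_const_mul]
  refine integral_congr_ae ?_
  filter_upwards [ae_yCoord_pos] with X hX
  rw [eigDD_add hκ hc n i hX]
  ring

/-- Total eigenvalues may coincide for different indices, but in a direction where the indices
differ the one-dimensional eigenvalues are distinct. Symmetry of the identity in that direction then
forces orthogonality. -/
lemma integral_eig_mul_eig_of_ne (ha : -1 < a) (ha' : a < 1) (hκ : κ = 0 ∨ κ = 1 - a)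
    {m n : Fin (N + 1) → ℕ} (h : m ≠ n) :
    ∫ X, eig N a κ m X * eig N a κ n X ∂(muHalf N a) = 0 := by
  obtain ⟨i, hi⟩ := Function.ne_iff.1 h
  have h1 := (admissible_eig ha' hκ m i).integral_mul_eigD ha ha' n
  have h2 := (admissible_eig ha' hκ n i).integral_mul_eigD ha ha' m
  simp only [mul_comm (eigD N a κ n i _), mul_comm (eig N a κ n _)] at h2
  rw [h1] at h2
  have h3 : eigVal N κ i (n i) - eigVal N κ i (m i) ≠ 0 :=
    sub_ne_zero.2 fun e => hi (eigVal_injective i e).symm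
  have h4 : (eigVal N κ i (n i) - eigVal N κ i (m i))
      * ∫ X, eig N a κ m X * eig N a κ n X ∂(muHalf N a) = 0 := by linarith
  exact (mul_eq_zero.1 h4).resolve_left h3

lemma memLp_eig (ha : -1 < a) (ha' : a < 1) (hκ : κ = 0 ∨ κ = 1 - a) (n : Fin (N + 1) → ℕ) :
    MemLp (eig N a κ n) 2 (muHalf N a) :=
  (growth_eig n).memLp ha (by rcases hκ with h | h <;> linarith)
    (measurable_eig n).aestronglyMeasurable

lemma memLp_eigD (ha : -1 < a) (ha' : a < 1) (hκ : κ = 0 ∨ κ = 1 - a) (n : Fin (N + 1) → ℕ)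
    (i : Fin (N + 1)) : MemLp (eigD N a κ n i) 2 (muHalf N a) := by
  rcases hκ with rfl | h
  · exact (growth_eigD_zero n i).memLp ha (by linarith) (measurable_eigD n i).aestronglyMeasurable
  -- Here the derivative is of order `y^{-a}`; its square times the weight is `y^{-a}`, integrable
  -- because `a < 1`.
  · exact (growth_eigD n i).memLp ha (by linarith) (measurable_eigD n i).aestronglyMeasurable

/-- The gradients of the eigenfunctions. -/
def eigGrad (N : ℕ) (a κ : ℝ) (n : Fin (N + 1) → ℕ) (X : Space N) : Space N :=
  WithLp.toLp 2 fun i => eigD N a κ n i X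

/-- The eigenvalues. -/
def eigSum (N : ℕ) (κ : ℝ) (n : Fin (N + 1) → ℕ) : ℝ := ∑ i, eigVal N κ i (n i)

lemma memLp_eigGrad (ha : -1 < a) (ha' : a < 1) (hκ : κ = 0 ∨ κ = 1 - a)
    (n : Fin (N + 1) → ℕ) : MemLp (eigGrad N a κ n) 2 (muHalf N a) := by
  rw [memLp_piLp_iff]
  exact memLp_eigD ha ha' hκ n

/-- The weak eigenvalue equation. -/
lemma integral_inner_eigGrad (ha : -1 < a) (ha' : a < 1) (hκ : κ = 0 ∨ κ = 1 - a)
    {φ : Space N → ℝ} {Φ : Space N → Space N} (hΦ : MemLp Φ 2 (muHalf N a))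
    (h : ∀ i, Admissible N a κ i φ fun X => Φ X i) (n : Fin (N + 1) → ℕ) :
    ∫ X, inner ℝ (Φ X) (eigGrad N a κ n X) ∂(muHalf N a)
      = eigSum N κ n * ∫ X, φ X * eig N a κ n X ∂(muHalf N a) := by
  have e : ∀ X, inner ℝ (Φ X) (eigGrad N a κ n X) = ∑ i, Φ X i * eigD N a κ n i X := fun X => by
    simp [PiLp.inner_apply, eigGrad, mul_comm]
  simp only [e]
  rw [integral_finsetSum, eigSum, Finset.sum_mul]
  · exact Finset.sum_congr rfl fun i _ => (h i).integral_mul_eigD ha ha' n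
  · exact fun i _ => MemLp.integrable_mul ((memLp_piLp_iff.1 hΦ) i) (memLp_eigD ha ha' hκ n i)

end EigenIdentity

/-! ### Parseval, Bessel and an abstract Poincaré inequality. -/

section Hilbert

variable {H K ι : Type*} [NormedAddCommGroup H] [InnerProductSpace ℝ H]
  [NormedAddCommGroup K] [InnerProductSpace ℝ K]

/-- Parseval's identity for a complete orthogonal family, whose members may vanish. -/
lemma hasSum_inner_sq_div_of_complete [CompleteSpace H] {e : ι → H}
    (ho : ∀ m n, m ≠ n → inner ℝ (e m) (e n) = 0)
    (hc : ∀ v : H, (∀ n, inner ℝ v (e n) = 0) → v = 0) (v : H) :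
    HasSum (fun n => inner ℝ v (e n) ^ 2 / ‖e n‖ ^ 2) (‖v‖ ^ 2) := by
  let J : Set ι := {n | e n ≠ 0}
  let b : J → H := fun n => ‖e n‖⁻¹ • e n
  have hb : Orthonormal ℝ b := by
    refine ⟨fun n => ?_, fun m n hmn => ?_⟩
    · have : ‖e n‖ ≠ 0 := norm_ne_zero_iff.2 n.2
      simp [b, norm_smul, this]
    · simp [b, inner_smul_left, inner_smul_right, ho m n fun h => hmn (Subtype.ext h)]
  have hsp : (Submodule.span ℝ (Set.range b))ᗮ = ⊥ := by
    rw [Submodule.eq_bot_iff]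
    intro w hw
    refine hc w fun n => ?_
    by_cases hn : e n = 0
    · simp [hn]
    · have h1 := (Submodule.mem_orthogonal' _ _).1 hw _
        (Submodule.subset_span (Set.mem_range_self (⟨n, hn⟩ : J)))
      simp only [b, inner_smul_right, mul_eq_zero, inv_eq_zero, norm_eq_zero] at h1
      exact h1.resolve_left hn
  let B := HilbertBasis.mkOfOrthogonalEqBot hb hsp
  have hB := B.hasSum_inner_mul_inner v v
  have hBb : ⇑B = b := HilbertBasis.coe_mkOfOrthogonalEqBot _ _
  rw [hBb, real_inner_self_eq_norm_sq] at hB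
  have h2 : HasSum ((fun n => inner ℝ v (e n) ^ 2 / ‖e n‖ ^ 2) ∘ ((↑) : J → ι)) (‖v‖ ^ 2) := by
    convert! hB using 1
    ext n
    have hcomm : inner ℝ (b n) v = inner ℝ v (b n) := real_inner_comm _ _
    rw [hcomm]
    simp only [Function.comp, b, inner_smul_right]
    ring
  -- The discarded indices have `e n = 0` and contribute `0 / 0 = 0`.
  refine (hasSum_subtype_iff_of_support_subset (fun n hn => ?_)).1 h2
  intro h0
  simp [h0] at hn

/-- Poincaré inequality from the eigenvalue identity `⟨γ, g_n⟩ = λ_n ⟨v, e_n⟩`. -/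
lemma mul_norm_sq_le_of_eigen [CompleteSpace H] {e : ι → H} {g : ι → K} {lam : ι → ℝ} {Λ : ℝ}
    (ho : ∀ m n, m ≠ n → inner ℝ (e m) (e n) = 0)
    (hc : ∀ v : H, (∀ n, inner ℝ v (e n) = 0) → v = 0)
    (hg : ∀ m n, inner ℝ (g m) (g n) = lam n * inner ℝ (e m) (e n))
    {v : H} {γ : K} (hv : ∀ n, inner ℝ γ (g n) = lam n * inner ℝ v (e n))
    (hlow : ∀ n, lam n < Λ → inner ℝ v (e n) = 0) :
    Λ * ‖v‖ ^ 2 ≤ ‖γ‖ ^ 2 ∧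
      (Λ * ‖v‖ ^ 2 = ‖γ‖ ^ 2 → ∀ n, lam n ≠ Λ → inner ℝ v (e n) = 0) := by
  classical
  set p : ι → ℝ := fun n => inner ℝ v (e n) ^ 2 / ‖e n‖ ^ 2 with hp
  have hp0 : ∀ n, 0 ≤ p n := fun n => by positivity
  have hP : HasSum p (‖v‖ ^ 2) := hasSum_inner_sq_div_of_complete ho hc v
  -- Bessel's inequality for the orthogonal family `g_n`, with `‖g_n‖² = λ_n ‖e_n‖²`. The
  -- coefficients are those of `v` with respect to `e_n`, so completeness of the gradients is not
  -- needed.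
  have hB : ∀ F : Finset ι, ∑ n ∈ F, lam n * p n ≤ ‖γ‖ ^ 2 := by
    intro F
    set c : ι → ℝ := fun n => inner ℝ v (e n) / ‖e n‖ ^ 2 with hcdef
    have h1 : inner ℝ γ (∑ n ∈ F, c n • g n) = ∑ n ∈ F, lam n * p n := by
      rw [inner_sum]
      refine Finset.sum_congr rfl fun n _ => ?_
      rw [inner_smul_right, hv, hcdef, hp]
      simp only; ring
    have h2 : ‖∑ n ∈ F, c n • g n‖ ^ 2 = ∑ n ∈ F, lam n * p n := by
      rw [← real_inner_self_eq_norm_sq, sum_inner]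
      refine Finset.sum_congr rfl fun n hn => ?_
      rw [inner_sum, Finset.sum_eq_single n]
      · rw [inner_smul_left, inner_smul_right, hg, real_inner_self_eq_norm_sq, hcdef, hp]
        by_cases h0 : ‖e n‖ = 0
        · simp [h0]
        · simp only [conj_trivial]; field_simp
      · intro m _ hm
        rw [inner_smul_left, inner_smul_right, hg, ho n m hm.symm]; simp
      · exact fun h => absurd hn h
    have h3 : 0 ≤ ‖γ - ∑ n ∈ F, c n • g n‖ ^ 2 := by positivity
    rw [norm_sub_sq_real, h1, h2] at h3
    linarith
  have hle : ∀ n, Λ * p n ≤ lam n * p n := fun n => by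
    by_cases hn : lam n < Λ
    · simp [hp, hlow n hn]
    · exact mul_le_mul_of_nonneg_right (not_lt.1 hn) (hp0 n)
  -- Keeping the surplus of one index through the limit makes the equality case visible: the surplus
  -- must vanish.
  have hgap : ∀ m, Λ * ‖v‖ ^ 2 + (lam m - Λ) * p m ≤ ‖γ‖ ^ 2 := by
    intro m
    have hlim : Tendsto (fun F : Finset ι => Λ * ∑ n ∈ F, p n + (lam m - Λ) * p m) atTop
        (𝓝 (Λ * ‖v‖ ^ 2 + (lam m - Λ) * p m)) := (Tendsto.const_mul Λ hP).add_const _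
    refine le_of_tendsto hlim ?_
    filter_upwards [eventually_ge_atTop {m}] with F hF
    have hm : m ∈ F := hF (Finset.mem_singleton_self m)
    refine le_trans ?_ (hB F)
    rw [Finset.mul_sum, ← Finset.add_sum_erase _ _ hm, ← Finset.add_sum_erase F (fun n => lam n * p n) hm]
    have := Finset.sum_le_sum fun n (_ : n ∈ F.erase m) => hle n
    linarith
  refine ⟨?_, fun heq m hm => ?_⟩
  · refine le_of_tendsto (Tendsto.const_mul Λ hP) (Eventually.of_forall fun F => ?_)
    rw [Finset.mul_sum]
    exact (Finset.sum_le_sum fun n _ => hle n).trans (hB F)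
  · by_cases hl : lam m < Λ
    · exact hlow m hl
    · have h1 : 0 < lam m - Λ := sub_pos.2 (lt_of_le_of_ne (not_lt.1 hl) hm.symm)
      have h2 := hgap m
      have h3 : p m = 0 := by
        have := hp0 m
        nlinarith
      rcases (div_eq_zero_iff).1 h3 with h | h
      · exact pow_eq_zero_iff two_ne_zero |>.1 h
      · have : e m = 0 := norm_eq_zero.1 (pow_eq_zero_iff two_ne_zero |>.1 h)
        simp [this]

/-- A vector orthogonal to all but finitely many members of a complete orthogonal family is a
combination of these. -/
lemma eq_sum_of_inner_eq_zero {e : ι → H} (ho : ∀ m n, m ≠ n → inner ℝ (e m) (e n) = 0)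
    (hc : ∀ v : H, (∀ n, inner ℝ v (e n) = 0) → v = 0) {v : H} (F : Finset ι)
    (h : ∀ n, n ∉ F → inner ℝ v (e n) = 0) :
    v = ∑ n ∈ F, (inner ℝ v (e n) / ‖e n‖ ^ 2) • e n := by
  classical
  rw [← sub_eq_zero]
  refine hc _ fun n => ?_
  rw [inner_sub_left, sum_inner, sub_eq_zero]
  by_cases hn : n ∈ F
  · rw [Finset.sum_eq_single n]
    · rw [inner_smul_left, real_inner_self_eq_norm_sq]
      by_cases h0 : e n = 0
      · simp [h0]
      · have : ‖e n‖ ≠ 0 := norm_ne_zero_iff.2 h0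
        simp only [conj_trivial]; field_simp
    · intro m _ hm
      rw [inner_smul_left, ho m n hm, mul_zero]
    · exact fun h => absurd hn h
  · rw [h n hn, Finset.sum_eq_zero]
    intro m hm
    rw [inner_smul_left, ho m n (fun e => hn (e ▸ hm)), mul_zero]

end Hilbert

/-! ### Determination of a function by its moments. -/

section Moments

variable {E : Type*} [NormedAddCommGroup E] [InnerProductSpace ℝ E] [MeasurableSpace E]
  [BorelSpace E]

/-- Expand the exponential and integrate term by term; all partial sums are dominated by `|F|
e^{|t||X|}`, and each term is a vanishing moment. -/
lemma integral_mul_cexp_eq_zero {ν : Measure E} {F : E → ℝ} (t : E)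
    (hF : Integrable (fun X => F X * Real.exp (‖t‖ * ‖X‖)) ν)
    (hm : AEStronglyMeasurable F ν)
    (h0 : ∀ n : ℕ, ∫ X, F X * inner ℝ X t ^ n ∂ν = 0) :
    ∫ X, (F X : ℂ) * Complex.exp (inner ℝ X t * Complex.I) ∂ν = 0 := by
  have hc : Continuous fun X : E => (inner ℝ X t : ℝ) := by fun_prop
  have hs : HasSum (fun n : ℕ => ∫ X, (F X : ℂ) *
      ((inner ℝ X t * Complex.I) ^ n / (n.factorial : ℂ)) ∂ν)
      (∫ X, (F X : ℂ) * Complex.exp (inner ℝ X t * Complex.I) ∂ν) := by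
    have hb : ∀ X, HasSum (fun n : ℕ => |F X| * ((‖t‖ * ‖X‖) ^ n / (n.factorial : ℝ)))
        (|F X| * Real.exp (‖t‖ * ‖X‖)) := fun X => by
      rw [Real.exp_eq_exp_ℝ]
      exact (NormedSpace.expSeries_div_hasSum_exp (‖t‖ * ‖X‖)).mul_left _
    refine hasSum_integral_of_dominated_convergence
      (fun n X => |F X| * ((‖t‖ * ‖X‖) ^ n / (n.factorial : ℝ))) (fun n => ?_) (fun n => ?_)
      (ae_of_all _ fun X => (hb X).summable) ?_ (ae_of_all _ fun X => ?_)
    · refine (Complex.continuous_ofReal.comp_aestronglyMeasurable hm).mul ?_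
      exact (by fun_prop : Continuous fun X : E =>
        ((inner ℝ X t : ℝ) * Complex.I) ^ n / (n.factorial : ℂ)).aestronglyMeasurable
    · refine ae_of_all _ fun X => ?_
      rw [norm_mul, norm_div, norm_pow, norm_mul, Complex.norm_I, mul_one, Complex.norm_real,
        Complex.norm_real, Complex.norm_natCast, Real.norm_eq_abs]
      gcongr
      rw [mul_comm]; exact norm_inner_le_norm X t
    · simp only [(hb _).tsum_eq]
      refine hF.norm.congr (ae_of_all _ fun X => ?_)
      simp only [Real.norm_eq_abs, abs_mul, Real.abs_exp]
    · have hz : ∀ z : ℂ, HasSum (fun n : ℕ => z ^ n / (n.factorial : ℂ)) (Complex.exp z) := by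
        intro z
        rw [Complex.exp_eq_exp_ℂ]
        exact NormedSpace.expSeries_div_hasSum_exp z
      exact (hz _).mul_left _
  have hz : ∀ n : ℕ, ∫ X, (F X : ℂ) *
      ((inner ℝ X t * Complex.I) ^ n / (n.factorial : ℂ)) ∂ν = 0 := fun n => by
    have : ∀ X, (F X : ℂ) * ((inner ℝ X t * Complex.I) ^ n / (n.factorial : ℂ))
        = (Complex.I ^ n / (n.factorial : ℂ)) * ((F X * inner ℝ X t ^ n : ℝ) : ℂ) := fun X => by
      push_cast; rw [mul_pow]; ring
    simp only [this]
    rw [integral_const_mul, integral_complex_ofReal, h0 n]; simp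
  simp only [hz] at hs
  exact hs.unique hasSum_zero

/-- A function with exponential moments, all of whose polynomial moments vanish, is zero. -/
lemma ae_eq_zero_of_moments [CompleteSpace E] [SecondCountableTopology E] {ν : Measure E}
    {F : E → ℝ} (hm : Measurable F)
    (hF : ∀ c : ℝ, Integrable (fun X => F X * Real.exp (c * ‖X‖)) ν)
    (h0 : ∀ (t : E) (n : ℕ), ∫ X, F X * inner ℝ X t ^ n ∂ν = 0) :
    F =ᵐ[ν] 0 := by
  have hi : Integrable F ν := by simpa using hF 0
  have mp : Measurable fun X => ENNReal.ofReal (F X) := hm.ennreal_ofReal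
  have mn : Measurable fun X => ENNReal.ofReal (-F X) := hm.neg.ennreal_ofReal
  have fp : ∫⁻ X, ENNReal.ofReal (F X) ∂ν ≠ ⊤ := hi.lintegral_lt_top.ne
  have fn : ∫⁻ X, ENNReal.ofReal (-F X) ∂ν ≠ ⊤ := hi.neg.lintegral_lt_top.ne
  have _ := isFiniteMeasure_withDensity fp
  have _ := isFiniteMeasure_withDensity fn
  -- The positive and negative parts of `F dν` are finite measures. Their characteristic functions
  -- differ by the integral of `F e^{i⟨X,t⟩}`, which is zero, so the two measures coincide.
  have heq : ν.withDensity (fun X => ENNReal.ofReal (F X))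
      = ν.withDensity fun X => ENNReal.ofReal (-F X) := by
    refine Measure.ext_of_charFun ?_
    ext t
    have hce : Continuous fun X : E => Complex.exp ((inner ℝ X t : ℝ) * Complex.I) := by fun_prop
    have hint : ∀ g : E → ℝ, Measurable g → (∀ X, |g X| ≤ |F X|) →
        Integrable (fun X => g X • Complex.exp ((inner ℝ X t : ℝ) * Complex.I)) ν :=
      fun g hg hb => by
      refine hi.mono ((hg.smul hce.measurable).aestronglyMeasurable) (ae_of_all _ fun X => ?_)
      rw [norm_smul, Complex.norm_exp_ofReal_mul_I, mul_one]
      exact hb X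
    rw [charFun_apply, charFun_apply,
      integral_withDensity_eq_integral_toReal_smul mp (ae_of_all _ fun _ => ENNReal.ofReal_lt_top),
      integral_withDensity_eq_integral_toReal_smul mn (ae_of_all _ fun _ => ENNReal.ofReal_lt_top),
      ← sub_eq_zero, ← integral_sub]
    · refine Eq.trans ?_ (integral_mul_cexp_eq_zero t (hF ‖t‖) hi.aestronglyMeasurable (h0 t))
      refine integral_congr_ae (ae_of_all _ fun X => ?_)
      simp only
      rw [← sub_smul, ENNReal.toReal_ofReal', ENNReal.toReal_ofReal', Complex.real_smul]
      congr 2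
      rcases le_total (F X) 0 with h | h
      · rw [max_eq_right h, max_eq_left (by linarith)]; ring
      · rw [max_eq_left h, max_eq_right (by linarith)]; ring
    · refine hint _ mp.ennreal_toReal fun X => ?_
      rw [ENNReal.toReal_ofReal', abs_of_nonneg (le_max_right _ _)]
      exact max_le (le_abs_self _) (abs_nonneg _)
    · refine hint _ mn.ennreal_toReal fun X => ?_
      rw [ENNReal.toReal_ofReal', abs_of_nonneg (le_max_right _ _)]
      exact max_le (neg_le_abs _) (abs_nonneg _)
  have hae := (withDensity_eq_iff mp.aemeasurable mn.aemeasurable fp).1 heq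
  filter_upwards [hae] with X hX
  simp only [Pi.zero_apply]
  rcases le_total (F X) 0 with h | h
  · rw [ENNReal.ofReal_of_nonpos h, eq_comm, ENNReal.ofReal_eq_zero] at hX
    linarith
  · rw [ENNReal.ofReal_of_nonpos (by linarith : -F X ≤ 0), ENNReal.ofReal_eq_zero] at hX
    linarith

end Moments

/-! ### The reflection in the last variable. -/

section Reflection

variable {N : ℕ} {a κ : ℝ}

/-- The reflection `(x, y) ↦ (x, -y)`. -/
def reflY (N : ℕ) : Space N ≃ₗᵢ[ℝ] Space N :=
  LinearIsometryEquiv.piLpCongrRight 2 fun i =>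
    if i = Fin.last N then LinearIsometryEquiv.neg ℝ else LinearIsometryEquiv.refl ℝ ℝ

lemma reflY_apply (X : Space N) (i : Fin (N + 1)) :
    reflY N X i = if i = Fin.last N then -X i else X i := by
  simp only [reflY, LinearIsometryEquiv.piLpCongrRight_apply]
  split_ifs <;> simp

lemma yCoord_reflY (X : Space N) : yCoord (reflY N X) = -yCoord X := by
  simp [yCoord, reflY_apply]

lemma reflY_reflY (X : Space N) : reflY N (reflY N X) = X := by
  ext i
  simp only [reflY_apply]
  split_ifs <;> simp

lemma measurable_reflY : Measurable (reflY N) := (reflY N).continuous.measurable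

end Reflection

/-! ### Completeness of the eigenfunctions. -/

section Completeness

open Polynomial

variable {N : ℕ} {a κ : ℝ}

/-- The polynomials `eigPoly` in terms of `x_j` and `y²`. -/
def eigBasePoly (N : ℕ) (a κ : ℝ) (i : Fin (N + 1)) (n : ℕ) : ℝ[X] :=
  if i = Fin.last N then lag (2 + 4 * κ + 2 * a) n else herm n

/-- The variables `x_j` and `y²`. -/
def sqCoord (X : Space N) (i : Fin (N + 1)) : ℝ := if i = Fin.last N then X i ^ 2 else X i

lemma eval_eigPoly (i : Fin (N + 1)) (n : ℕ) (X : Space N) :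
    (eigPoly N a κ i n).eval (X i) = (eigBasePoly N a κ i n).eval (sqCoord X i) := by
  unfold eigPoly eigBasePoly sqCoord
  split_ifs <;> simp

lemma degree_eigBasePoly (hc : 0 < 2 + 4 * κ + 2 * a) (i : Fin (N + 1)) (n : ℕ) :
    (eigBasePoly N a κ i n).degree = n := by
  unfold eigBasePoly
  split_ifs
  · rw [degree_eq_natDegree, natDegree_lag hc]
    intro h
    have := lagCoeff_ne_zero hc n le_rfl
    rw [← coeff_lag, h, coeff_zero] at this
    exact this rfl
  · rw [degree_eq_natDegree (monic_herm n).1.ne_zero, (monic_herm n).2]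

/-- The basis of `ℝ[X]` formed by the polynomials `eigBasePoly`. -/
def eigBasis (hc : 0 < 2 + 4 * κ + 2 * a) (i : Fin (N + 1)) : Module.Basis ℕ ℝ ℝ[X] :=
  (Sequence.mk (eigBasePoly N a κ i) (degree_eigBasePoly hc i)).basis fun n =>
    (leadingCoeff_ne_zero.2 (Sequence.ne_zero _ n)).isUnit

lemma eigBasis_apply (hc : 0 < 2 + 4 * κ + 2 * a) (i : Fin (N + 1)) (n : ℕ) :
    eigBasis hc i n = eigBasePoly N a κ i n := Sequence.basis_eq_self _ _ n

lemma growth_mvPoly {ξ : Space N → Fin (N + 1) → ℝ} (hξ : ∀ i, Growth 0 fun X => ξ X i)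
    (P : MvPolynomial (Fin (N + 1)) ℝ) : Growth 0 fun X => MvPolynomial.eval (ξ X) P := by
  induction P using MvPolynomial.induction_on with
  | C r => simpa using Growth.const r
  | add p q hp hq => simpa using hp.add hq
  | mul_X p i hp => simpa using hp.mul (hξ i)

lemma growth_sqCoord (i : Fin (N + 1)) : Growth 0 fun X : Space N => sqCoord X i := by
  unfold sqCoord
  split_ifs
  · exact (Growth.coord i).pow 2
  · exact Growth.coord i

lemma measurable_mvPoly {ξ : Space N → Fin (N + 1) → ℝ} (hξ : ∀ i, Measurable fun X => ξ X i)
    (P : MvPolynomial (Fin (N + 1)) ℝ) : Measurable fun X => MvPolynomial.eval (ξ X) P := by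
  induction P using MvPolynomial.induction_on with
  | C r => simp only [MvPolynomial.eval_C, measurable_const]
  | add p q hp hq => simp only [map_add]; exact hp.add hq
  | mul_X p i hp => simp only [map_mul, MvPolynomial.eval_X]; exact hp.mul (hξ i)

lemma measurable_sqCoord (i : Fin (N + 1)) : Measurable fun X : Space N => sqCoord X i := by
  unfold sqCoord
  split_ifs
  · exact (measurable_coord i).pow_const 2
  · exact measurable_coord i

/-- Integration of polynomials in the variables `ξ` against `g`, as a linear functional. -/
def momentFunctional {μ : Measure (Space N)} (g : Space N → ℝ) (ξ : Space N → Fin (N + 1) → ℝ)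
    (hg : ∀ P, Integrable (fun X => g X * MvPolynomial.eval (ξ X) P) μ) :
    MvPolynomial (Fin (N + 1)) ℝ →ₗ[ℝ] ℝ where
  toFun P := ∫ X, g X * MvPolynomial.eval (ξ X) P ∂μ
  map_add' P Q := by
    rw [← integral_add (hg P) (hg Q)]
    simp [mul_add]
  map_smul' r P := by
    rw [RingHom.id_apply, smul_eq_mul, ← integral_const_mul]
    simp [MvPolynomial.smul_eval, mul_left_comm]

variable {g : Space N → ℝ}

/-- The integral is multilinear in the tuple of one-variable polynomials, so vanishing on tuples
from the basis `eigBasis` extends to all tuples, in particular to monomials. -/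
lemma integral_mul_prod_sqCoord_eq_zero (hc : 0 < 2 + 4 * κ + 2 * a)
    (hg : ∀ P, Integrable (fun X => g X * MvPolynomial.eval (sqCoord X) P) (muHalf N a))
    (h : ∀ n : Fin (N + 1) → ℕ,
      ∫ X, g X * ∏ i, (eigPoly N a κ i (n i)).eval (X i) ∂(muHalf N a) = 0)
    (β : Fin (N + 1) → ℕ) : ∫ X, g X * ∏ i, sqCoord X i ^ β i ∂(muHalf N a) = 0 := by
  let Ψ := momentFunctional g sqCoord hg
  let M : MultilinearMap ℝ (fun _ : Fin (N + 1) => ℝ[X]) ℝ :=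
    Ψ.compMultilinearMap ((MultilinearMap.mkPiAlgebra ℝ (Fin (N + 1))
      (MvPolynomial (Fin (N + 1)) ℝ)).compLinearMap fun i =>
        (Polynomial.aeval (MvPolynomial.X i : MvPolynomial (Fin (N + 1)) ℝ)).toLinearMap)
  have hM : ∀ p : Fin (N + 1) → ℝ[X],
      M p = ∫ X, g X * ∏ i, (p i).eval (sqCoord X i) ∂(muHalf N a) := fun p => by
    have e : ∀ (X : Space N) (i : Fin (N + 1)), MvPolynomial.eval (sqCoord X)
        (Polynomial.aeval (MvPolynomial.X i) (p i)) = (p i).eval (sqCoord X i) := fun X i => by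
      rw [Polynomial.aeval_def, Polynomial.hom_eval₂, MvPolynomial.eval_X, Polynomial.eval]
      congr 1
      ext r; simp
    simp [M, Ψ, momentFunctional, e, map_prod]
  have hM0 : M = 0 := by
    refine Module.Basis.ext_multilinear (eigBasis hc) fun n => ?_
    rw [hM, zero_apply, ← h n]
    simp only [eigBasis_apply, eval_eigPoly]
  have := hM fun i => X ^ β i
  rw [hM0] at this
  simpa using this.symm

/-- Symmetrisation in `y` kills monomials of odd degree in `y` and doubles the others, which are
monomials in the `x_j` and `y²`. This bridges the gap between polynomials in `y²` and all
polynomials. -/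
lemma integral_mul_mvPoly_even_eq_zero (hc : 0 < 2 + 4 * κ + 2 * a)
    (hg : ∀ {f : Space N → ℝ}, Growth 0 f → Measurable f →
      Integrable (fun X => g X * f X) (muHalf N a))
    (h : ∀ n : Fin (N + 1) → ℕ,
      ∫ X, g X * ∏ i, (eigPoly N a κ i (n i)).eval (X i) ∂(muHalf N a) = 0)
    (P : MvPolynomial (Fin (N + 1)) ℝ) :
    ∫ X, g X * (MvPolynomial.eval (⇑X) P + MvPolynomial.eval (⇑(reflY N X)) P) ∂(muHalf N a)
      = 0 := by
  have r1 : ∀ i, Growth 0 fun X : Space N => (reflY N X) i := fun i => by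
    simp only [reflY_apply]
    split_ifs
    · exact (Growth.coord i).neg
    · exact Growth.coord i
  have r2 : ∀ i, Measurable fun X : Space N => (reflY N X) i := fun i =>
    (measurable_coord i).comp measurable_reflY
  have hI : ∀ P : MvPolynomial (Fin (N + 1)) ℝ, Integrable (fun X => g X *
      (MvPolynomial.eval (⇑X) P + MvPolynomial.eval (⇑(reflY N X)) P)) (muHalf N a) := fun P =>
    hg ((growth_mvPoly (ξ := fun X => ⇑X) Growth.coord P).add (growth_mvPoly r1 P))
      ((measurable_mvPoly (ξ := fun X => ⇑X) measurable_coord P).add (measurable_mvPoly r2 P))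
  induction P using MvPolynomial.induction_on' with
  | add p q hp hq =>
    have := integral_add (hI p) (hI q)
    rw [hp, hq, add_zero] at this
    rw [← this]
    congr 1; ext X
    simp only [map_add]; ring
  | monomial α r =>
    have hprod : ∀ X : Space N, ∏ i, (reflY N X) i ^ α i
        = (-1) ^ α (Fin.last N) * ∏ i, X i ^ α i := fun X => by
      rw [Fin.prod_univ_castSucc, Fin.prod_univ_castSucc]
      simp [reflY_apply, (Fin.castSucc_lt_last _).ne, neg_pow (X (Fin.last N))]
      ring
    simp only [MvPolynomial.eval_monomial, Finsupp.prod_fintype _ _ fun _ => pow_zero _, hprod]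
    rcases Nat.even_or_odd (α (Fin.last N)) with he | ho
    · obtain ⟨k, hk⟩ := he
      have h1 := integral_mul_prod_sqCoord_eq_zero hc
        (fun P => hg (growth_mvPoly growth_sqCoord P) (measurable_mvPoly measurable_sqCoord P)) h
        (Function.update (⇑α) (Fin.last N) k)
      have h2 : ∀ X : Space N, ∏ i, sqCoord X i ^ (Function.update (⇑α) (Fin.last N) k) i
          = ∏ i, X i ^ α i := fun X => by
        refine Finset.prod_congr rfl fun i _ => ?_
        unfold sqCoord
        by_cases hi : i = Fin.last N
        · subst hi
          simp only [if_true, Function.update_self, ← pow_mul, hk]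
          congr 1; ring
        · simp [hi]
      simp only [h2] at h1
      rw [hk, ← two_mul, pow_mul]
      simp only [even_two, Even.neg_pow, one_pow, one_mul]
      have h3 : ∀ X : Space N, g X * (r * ∏ i, X i ^ α i + r * ∏ i, X i ^ α i)
          = 2 * r * (g X * ∏ i, X i ^ α i) := fun X => by ring
      simp only [h3]
      rw [integral_const_mul, h1, mul_zero]
    · simp [ho.neg_one_pow]

/-- The eigenfunctions are complete. -/
lemma ae_eq_zero_of_integral_mul_eig (ha : -1 < a) (ha' : a < 1) (hκ : κ = 0 ∨ κ = 1 - a)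
    {f : Space N → ℝ} (hfm : Measurable f) (hf : MemLp f 2 (muHalf N a))
    (h : ∀ n, ∫ X, f X * eig N a κ n X ∂(muHalf N a) = 0) : f =ᵐ[muHalf N a] 0 := by
  have hc : 0 < 2 + 4 * κ + 2 * a := by rcases hκ with h | h <;> linarith
  set μ := muHalf N a
  -- Moving the factor `y^κ` onto `f` leaves pure polynomials to test against.
  set g : Space N → ℝ := fun X => f X * yCoord X ^ κ with hgdef
  have hgm : Measurable g := hfm.mul (measurable_yCoord.pow_const κ)
  have hg : ∀ {k : Space N → ℝ}, Growth 0 k → Measurable k →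
      Integrable (fun X => g X * k X) μ := fun {k} hk hkm => by
    have h1 : MemLp (fun X : Space N => yCoord X ^ κ * k X) 2 μ :=
      ((Growth.rpow κ).mul hk).memLp ha (by rcases hκ with h | h <;> linarith)
        ((measurable_yCoord.pow_const κ).mul hkm).aestronglyMeasurable
    refine (hf.integrable_mul h1).congr (ae_of_all _ fun X => ?_)
    simp only [hgdef, Pi.mul_apply]; ring
  have hmom := integral_mul_mvPoly_even_eq_zero (N := N) hc hg
    (fun n => by
      rw [← h n]
      refine integral_congr_ae (ae_of_all _ fun X => ?_)
      simp only [hgdef, eig]; ring)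
  -- The even extension of `g`, integrated against the symmetrised measure `ν`: its full polynomial
  -- moments are the symmetrised moments of `g`, hence zero.
  set F : Space N → ℝ := fun X => if 0 < yCoord X then g X else g (reflY N X) with hFdef
  have hFm : Measurable F :=
    Measurable.ite measurableSet_upperHalf hgm (hgm.comp measurable_reflY)
  set ν : Measure (Space N) := μ + μ.map (reflY N)
  have hme : MeasurableEmbedding (reflY N) :=
    (reflY N).toHomeomorph.measurableEmbedding
  have hF1 : ∀ X, 0 < yCoord X → F X = g X := fun X hX => by simp [hFdef, hX]
  have hF2 : ∀ X, 0 < yCoord X → F (reflY N X) = g X := fun X hX => by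
    simp [hFdef, yCoord_reflY, hX.le, reflY_reflY]
  have hint : ∀ k : Space N → ℝ, Integrable (fun X => g X * k X) μ →
      Integrable (fun X => g X * k (reflY N X)) μ →
      Integrable (fun X => F X * k X) μ ∧ Integrable (fun X => F X * k X) (μ.map (reflY N)) ∧
      ∫ X, F X * k X ∂ν = ∫ X, g X * (k X + k (reflY N X)) ∂μ := fun k h1 h2 => by
    have e1 : (fun X => g X * k X) =ᵐ[μ] fun X => F X * k X := by
      filter_upwards [ae_yCoord_pos] with X hX
      rw [hF1 X hX]
    have e2 : (fun X => g X * k (reflY N X)) =ᵐ[μ] fun X => F (reflY N X) * k (reflY N X) := by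
      filter_upwards [ae_yCoord_pos] with X hX
      rw [hF2 X hX]
    have i1 := h1.congr e1
    have i2 : Integrable (fun X => F X * k X) (μ.map (reflY N)) :=
      hme.integrable_map_iff.2 (h2.congr e2)
    refine ⟨i1, i2, ?_⟩
    rw [integral_add_measure i1 i2, hme.integral_map, ← integral_congr_ae e1,
      ← integral_congr_ae e2, ← integral_add h1 h2]
    congr 1; ext X; ring
  have hzero : F =ᵐ[ν] 0 := by
    refine ae_eq_zero_of_moments hFm (fun c => ?_) fun t n => ?_
    · have hE : Growth (N := N) 0 fun X => Real.exp (c * ‖X‖) := by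
        refine ⟨1, |c|, zero_le_one, abs_nonneg c, fun X _ => ?_⟩
        rw [Real.abs_exp, Real.rpow_zero, one_mul, one_mul]
        exact Real.exp_le_exp.2 (by gcongr; exact le_abs_self c)
      have hEm : Measurable fun X : Space N => Real.exp (c * ‖X‖) :=
        (by fun_prop : Continuous fun X : Space N => Real.exp (c * ‖X‖)).measurable
      obtain ⟨i1, i2, -⟩ := hint (fun X => Real.exp (c * ‖X‖)) (hg hE hEm) (by
        simpa using hg hE hEm)
      exact i1.add_measure i2
    · let P : MvPolynomial (Fin (N + 1)) ℝ :=
        (∑ i, MvPolynomial.C (t i) * MvPolynomial.X i) ^ n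
      have hP : ∀ X : Space N, MvPolynomial.eval (⇑X) P = inner ℝ X t ^ n := fun X => by
        simp [P, PiLp.inner_apply]
      have hm1 : ∀ Q : MvPolynomial (Fin (N + 1)) ℝ,
          Growth 0 fun X : Space N => MvPolynomial.eval (⇑X) Q :=
        growth_mvPoly (ξ := fun X => ⇑X) Growth.coord
      have hgr : Growth (N := N) 0 fun X => inner ℝ X t ^ n := (hm1 P).congr fun X _ => (hP X).symm
      have hgr2 : Growth (N := N) 0 fun X => inner ℝ (reflY N X) t ^ n := by
        obtain ⟨C, c, hC, hc, hb⟩ := Growth.norm (N := N)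
        have : Growth (N := N) 0 fun X => inner ℝ (reflY N X) t := by
          refine ⟨C * ‖t‖, c, by positivity, hc, fun X hX => ?_⟩
          refine (abs_real_inner_le_norm _ _).trans ?_
          rw [LinearIsometryEquiv.norm_map]
          have := hb X hX
          rw [abs_norm] at this
          calc ‖X‖ * ‖t‖ ≤ C * (yCoord X ^ (0 : ℝ) * Real.exp (c * ‖X‖)) * ‖t‖ := by gcongr
            _ = _ := by ring
        exact this.pow n
      have c1 : Continuous fun X : Space N => inner ℝ X t ^ n := by fun_prop
      have c2 : Continuous fun X : Space N => inner ℝ (reflY N X) t ^ n :=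
        c1.comp (reflY N).continuous
      rw [(hint (fun X => inner ℝ X t ^ n) (hg hgr c1.measurable) (hg hgr2 c2.measurable)).2.2,
        ← hmom P]
      simp only [hP]
      rfl
  have hzero' : F =ᵐ[μ] 0 := (ae_add_measure_iff.1 hzero).1
  filter_upwards [hzero', ae_yCoord_pos] with X h1 h2
  rw [hF1 X h2, hgdef] at h1
  have : yCoord X ^ κ ≠ 0 := (Real.rpow_pos_of_pos h2 κ).ne'
  exact (mul_eq_zero.1 h1).resolve_right this

end Completeness

/-! ### Inner products and norms of `L²` classes as integrals. -/

section LTwo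

variable {α E : Type*} [MeasurableSpace α] {μ : Measure α} [NormedAddCommGroup E]
  [InnerProductSpace ℝ E]

lemma inner_toLp {f g : α → E} (hf : MemLp f 2 μ) (hg : MemLp g 2 μ) :
    inner ℝ (hf.toLp f) (hg.toLp g) = ∫ x, inner ℝ (f x) (g x) ∂μ := by
  rw [L2.inner_def]
  refine integral_congr_ae ?_
  filter_upwards [hf.coeFn_toLp, hg.coeFn_toLp] with x h1 h2
  rw [h1, h2]

lemma norm_toLp_sq {f : α → E} (hf : MemLp f 2 μ) :
    ‖hf.toLp f‖ ^ 2 = ∫ x, ‖f x‖ ^ 2 ∂μ := by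
  rw [← real_inner_self_eq_norm_sq, inner_toLp hf hf]
  simp only [real_inner_self_eq_norm_sq]

lemma inner_toLp_real {f g : α → ℝ} (hf : MemLp f 2 μ) (hg : MemLp g 2 μ) :
    inner ℝ (hf.toLp f) (hg.toLp g) = ∫ x, f x * g x ∂μ := by
  rw [inner_toLp hf hg]
  simp [mul_comm]

lemma norm_toLp_sq_real {f : α → ℝ} (hf : MemLp f 2 μ) :
    ‖hf.toLp f‖ ^ 2 = ∫ x, f x ^ 2 ∂μ := by
  rw [norm_toLp_sq hf]; simp

end LTwo

/-! ### Test functions: gradients, bounds and admissibility. -/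

section TestFunctions

variable {N : ℕ} {a κ : ℝ} {φ : Space N → ℝ}

lemma gradient_apply_coord (X : Space N) (i : Fin (N + 1)) :
    gradient φ X i = fderiv ℝ φ X (basisVec i) := by
  rw [← inner_gradient_left, EuclideanSpace.inner_single_right]
  simp

lemma gradient_eq_toDual_symm (X : Space N) :
    gradient φ X = (InnerProductSpace.toDual ℝ (Space N)).symm (fderiv ℝ φ X) := rfl

lemma norm_gradient (X : Space N) : ‖gradient φ X‖ = ‖fderiv ℝ φ X‖ := by
  rw [gradient_eq_toDual_symm, LinearIsometryEquiv.norm_map]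

lemma ContDiff.continuous_gradient (h : ContDiff ℝ ∞ φ) : Continuous (gradient φ) :=
  (InnerProductSpace.toDual ℝ (Space N)).symm.continuous.comp
    (h.continuous_fderiv (by simp))

lemma exists_bound_of_mem_testFunctions (h : φ ∈ testFunctions N) :
    ∃ C, ∀ X, |φ X| ≤ C ∧ ‖gradient φ X‖ ≤ C := by
  obtain ⟨C, hC⟩ := h.2.exists_bound_of_continuous h.1.continuous
  obtain ⟨D, hD⟩ := (h.2.fderiv ℝ).exists_bound_of_continuous
    (h.1.continuous_fderiv (by simp))
  exact ⟨max C D, fun X => ⟨(hC X).trans (le_max_left _ _), by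
    rw [norm_gradient]; exact (hD X).trans (le_max_right _ _)⟩⟩

lemma memLp_of_mem_testFunctions (h : φ ∈ testFunctions N) (μ : Measure (Space N))
    [IsFiniteMeasure μ] : MemLp φ 2 μ ∧ MemLp (gradient φ) 2 μ := by
  obtain ⟨C, hC⟩ := exists_bound_of_mem_testFunctions h
  exact ⟨MemLp.of_bound h.1.continuous.aestronglyMeasurable C (ae_of_all _ fun X => (hC X).1),
    MemLp.of_bound h.1.continuous_gradient.aestronglyMeasurable C (ae_of_all _ fun X => (hC X).2)⟩

/-- Test functions vanishing on `{y = 0}`. -/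
def testFunctionsVanishing (N : ℕ) : Set (Space N → ℝ) :=
  {φ | φ ∈ testFunctions N ∧ ∀ X, yCoord X = 0 → φ X = 0}

/-- The larger class is the convenient one: odd parts of test functions vanish on `y = 0` without
being supported away from it. One Dirichlet inequality for this class serves both (i) and (ii). -/
lemma testFunctionsHalf_subset : testFunctionsHalf N ⊆ testFunctionsVanishing N := by
  intro φ h
  refine ⟨⟨h.1, h.2.1⟩, fun X hX => ?_⟩
  by_contra h0
  have : 0 < yCoord X := h.2.2 (subset_tsupport φ h0)
  linarith

lemma hasLineDerivAt_of_contDiff (h : ContDiff ℝ ∞ φ) (i : Fin (N + 1)) (X : Space N) :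
    HasLineDerivAt ℝ φ (gradient φ X i) X (basisVec i) := by
  rw [gradient_apply_coord]
  exact (h.differentiable (by simp) X).hasFDerivAt.hasLineDerivAt _

lemma measurable_gradient_coord (h : ContDiff ℝ ∞ φ) (i : Fin (N + 1)) :
    Measurable fun X => gradient φ X i :=
  (measurable_coord i).comp h.continuous_gradient.measurable

lemma growth_gradient_coord (h : φ ∈ testFunctions N) (i : Fin (N + 1)) :
    Growth 0 fun X => gradient φ X i := by
  obtain ⟨C, hC⟩ := exists_bound_of_mem_testFunctions h
  exact Growth.of_bounded fun X _ => (PiLp.norm_apply_le _ i).trans (hC X).2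

lemma growth_of_mem_testFunctions (h : φ ∈ testFunctions N) : Growth 0 φ := by
  obtain ⟨C, hC⟩ := exists_bound_of_mem_testFunctions h
  exact Growth.of_bounded fun X _ => (hC X).1

lemma admissible_of_mem_testFunctions (h : φ ∈ testFunctions N) (i : Fin (N + 1)) :
    Admissible N a 0 i φ fun X => gradient φ X i where
  deriv X _ := hasLineDerivAt_of_contDiff h.1 i X
  meas := h.1.continuous.measurable
  meas' := measurable_gradient_coord h.1 i
  growth := Or.inl ⟨rfl, growth_of_mem_testFunctions h, growth_gradient_coord h i⟩

/-- Mean value inequality between `X` and its foot on `y = 0`, where the function vanishes. -/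
lemma growth_of_mem_testFunctionsVanishing (h : φ ∈ testFunctionsVanishing N) : Growth 1 φ := by
  obtain ⟨C, hC⟩ := exists_bound_of_mem_testFunctions h.1
  refine ⟨max C 0, 0, le_max_right _ _, le_rfl, fun X hX => ?_⟩
  have h1 := convex_univ.norm_image_sub_le_of_norm_fderiv_le (𝕜 := ℝ) (f := φ) (C := C)
    (fun Y _ => h.1.1.differentiable (by simp) Y)
    (fun Y _ => by rw [← norm_gradient]; exact (hC Y).2)
    (mem_univ (X + (-yCoord X) • basisVec (Fin.last N))) (mem_univ X)
  have h0 : φ (X + (-yCoord X) • basisVec (Fin.last N)) = 0 :=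
    h.2 _ (by rw [yCoord_add_smul]; simp [lastInd])
  have h2 : ‖X - (X + (-yCoord X) • basisVec (Fin.last N))‖ = yCoord X := by
    simp [norm_smul, abs_of_pos hX]
  rw [h0, h2, sub_zero] at h1
  simp only [zero_mul, Real.exp_zero, mul_one, Real.rpow_one]
  refine h1.trans ?_
  gcongr
  exact le_max_left _ _

lemma admissible_of_mem_testFunctionsVanishing (h : φ ∈ testFunctionsVanishing N)
    (i : Fin (N + 1)) : Admissible N a (1 - a) i φ fun X => gradient φ X i where
  deriv X _ := hasLineDerivAt_of_contDiff h.1.1 i X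
  meas := h.1.1.continuous.measurable
  meas' := measurable_gradient_coord h.1.1 i
  growth := Or.inr ⟨rfl, 1, one_pos, growth_of_mem_testFunctionsVanishing h,
    by simpa using growth_gradient_coord h.1 i⟩

end TestFunctions

/-! ### Passage to the Sobolev closure and uniqueness of the weak gradient. -/

section Sobolev

variable {N : ℕ} {a κ : ℝ} {D : Set (Space N → ℝ)} {μ : Measure (Space N)}
  {V : Space N → ℝ} {G : Space N → Space N}

/-- Integral identities pass from the test functions to the Sobolev space. -/
lemma IsSobolev.integral_inner_eq [IsFiniteMeasure μ] (h : IsSobolev D μ V G) (hD : D ⊆ testFunctions N)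
    {k : Space N → Space N} {w : Space N → ℝ} (hk : MemLp k 2 μ) (hw : MemLp w 2 μ)
    (hid : ∀ φ ∈ D, ∫ X, inner ℝ (gradient φ X) (k X) ∂μ = ∫ X, φ X * w X ∂μ) :
    ∫ X, inner ℝ (G X) (k X) ∂μ = ∫ X, V X * w X ∂μ := by
  rw [← inner_toLp h.grad_memLp hk, ← inner_toLp_real h.memLp hw]
  set γ := h.grad_memLp.toLp G
  set v := h.memLp.toLp V
  set k' := hk.toLp k
  set w' := hw.toLp w
  have key : ∀ ε : ℝ, 0 < ε → |inner ℝ γ k' - inner ℝ v w'| ≤ ε * (‖k'‖ + ‖w'‖) := by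
    intro ε hε
    obtain ⟨φ, hφ, hlt⟩ := h.approx (ε ^ 2) (by positivity)
    obtain ⟨m1, m2⟩ := memLp_of_mem_testFunctions (hD hφ) μ
    have e1 := norm_toLp_sq_real (h.memLp.sub m1)
    have e2 := norm_toLp_sq (h.grad_memLp.sub m2)
    rw [MemLp.toLp_sub h.memLp m1] at e1
    rw [MemLp.toLp_sub h.grad_memLp m2] at e2
    simp only [Pi.sub_apply] at e1 e2
    rw [← e1, ← e2] at hlt
    have l1 : ‖v - m1.toLp φ‖ ≤ ε :=
      abs_le_of_sq_le_sq' (by nlinarith [sq_nonneg ‖γ - m2.toLp (gradient φ)‖]) hε.le |>.2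
    have l2 : ‖γ - m2.toLp (gradient φ)‖ ≤ ε :=
      abs_le_of_sq_le_sq' (by nlinarith [sq_nonneg ‖v - m1.toLp φ‖]) hε.le |>.2
    have hid' : inner ℝ (m2.toLp (gradient φ)) k' = inner ℝ (m1.toLp φ) w' := by
      rw [inner_toLp m2 hk, inner_toLp_real m1 hw, hid φ hφ]
    have e3 : inner ℝ γ k' - inner ℝ v w'
        = inner ℝ (γ - m2.toLp (gradient φ)) k' - inner ℝ (v - m1.toLp φ) w' := by
      rw [inner_sub_left, inner_sub_left, hid']; ring
    rw [e3]
    calc _ ≤ |inner ℝ (γ - m2.toLp (gradient φ)) k'| + |inner ℝ (v - m1.toLp φ) w'| :=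
          abs_sub _ _
      _ ≤ ‖γ - m2.toLp (gradient φ)‖ * ‖k'‖ + ‖v - m1.toLp φ‖ * ‖w'‖ :=
          add_le_add (abs_real_inner_le_norm _ _) (abs_real_inner_le_norm _ _)
      _ ≤ ε * ‖k'‖ + ε * ‖w'‖ := by gcongr
      _ = _ := by ring
  by_contra hne
  have hpos : 0 < |inner ℝ γ k' - inner ℝ v w'| := abs_pos.2 (sub_ne_zero.2 hne)
  have hK : 0 ≤ ‖k'‖ + ‖w'‖ := by positivity
  -- With this `ε` the estimate bounds a positive number by less than half of itself; the `+ 1`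
  -- avoids a zero denominator.
  have h1 := key (|inner ℝ γ k' - inner ℝ v w'| / (2 * (‖k'‖ + ‖w'‖ + 1))) (by positivity)
  rw [div_mul_eq_mul_div, le_div_iff₀ (by positivity)] at h1
  nlinarith

lemma IsSobolev.mono {D' : Set (Space N → ℝ)} (h : IsSobolev D μ V G) (hD : D ⊆ D') :
    IsSobolev D' μ V G :=
  ⟨h.memLp, h.grad_memLp, fun ε hε => by
    obtain ⟨φ, hφ, hlt⟩ := h.approx ε hε
    exact ⟨φ, hD hφ, hlt⟩⟩

lemma IsSobolev.congr_left {W : Space N → ℝ} (h : IsSobolev D μ V G) (hVW : V =ᵐ[μ] W) :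
    IsSobolev D μ W G := by
  refine ⟨h.memLp.ae_eq hVW, h.grad_memLp, fun ε hε => ?_⟩
  obtain ⟨φ, hφ, hlt⟩ := h.approx ε hε
  refine ⟨φ, hφ, ?_⟩
  rwa [integral_congr_ae (g := fun X => (V X - φ X) ^ 2)]
  filter_upwards [hVW] with X hX
  rw [hX]

/-- The weak gradient with respect to `muHalf` is unique. -/
lemma IsSobolev.grad_unique (ha : -1 < a) {G' : Space N → Space N}
    (h : IsSobolev (testFunctions N) (muHalf N a) V G)
    (h' : IsSobolev (testFunctions N) (muHalf N a) V G') : G =ᵐ[muHalf N a] G' := by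
  have := isProbabilityMeasure_muHalf (N := N) ha
  have hi : ∀ i, (fun X => G X i) =ᵐ[muHalf N a] fun X => G' X i := by
    intro i
    have m1 := memLp_piLp_iff.1 h.grad_memLp i
    have m2 := memLp_piLp_iff.1 h'.grad_memLp i
    have hint : Integrable (fun X => G X i - G' X i) (muHalf N a) :=
      (m1.sub m2).integrable one_le_two
    -- The open half-space carries the measure, so it suffices to test against smooth functions
    -- compactly supported in it.
    refine (isOpen_upperHalf.ae_eq_zero_of_integral_contDiff_smul_eq_zero
      (f := fun X => G X i - G' X i) (hint.locallyIntegrable.locallyIntegrableOn _) ?_).mp ?_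
    · intro ψ hψ hψc hψs
      have hψt : ψ ∈ testFunctions N := ⟨hψ, hψc⟩
      have g1 : Growth 1 ψ :=
        growth_of_mem_testFunctionsVanishing (testFunctionsHalf_subset ⟨hψ, hψc, hψs⟩)
      have mψ : Measurable ψ := hψ.continuous.measurable
      have my : Measurable fun X : Space N => (yCoord X)⁻¹ := measurable_yCoord.inv
      have gy : Growth 0 fun X => ψ X * (lastInd i * (yCoord X)⁻¹) := by
        simpa using g1.mul (Growth.inv.const_mul (lastInd i))
      have hk : MemLp (fun X => ψ X • basisVec (N := N) i) 2 (muHalf N a) := by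
        obtain ⟨C, hC⟩ := exists_bound_of_mem_testFunctions hψt
        refine MemLp.of_bound (hψ.continuous.smul continuous_const).aestronglyMeasurable C
          (ae_of_all _ fun X => ?_)
        rw [norm_smul]; simpa using (hC X).1
      -- The formal adjoint of the `i`-th derivative, applied to `ψ`. Its term in `1/y` is harmless
      -- because `ψ` vanishes at the boundary to first order.
      set w : Space N → ℝ := fun X =>
        -(gradient ψ X i + (a * lastInd i / yCoord X - X i / 2) * ψ X) with hw
      have gw : Growth 0 w := by
        refine (((growth_gradient_coord hψt i).add ((gy.const_mul a).add
          (((Growth.coord i).mul (growth_of_mem_testFunctions hψt)).const_mul (-(1 / 2))|>.mono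
            (by simp)))).neg).congr fun X _ => ?_
        simp only [hw]; ring
      have mw : Measurable w :=
        ((measurable_gradient_coord hψ i).add
          (((measurable_const.div measurable_yCoord).sub
            ((measurable_coord i).div_const 2)).mul mψ)).neg
      have hwL : MemLp w 2 (muHalf N a) := gw.memLp ha (by linarith) mw.aestronglyMeasurable
      have hid : ∀ φ ∈ testFunctions N,
          ∫ X, inner ℝ (gradient φ X) (ψ X • basisVec i) ∂(muHalf N a)
            = ∫ X, φ X * w X ∂(muHalf N a) := by
        intro φ hφ
        have gφ := growth_of_mem_testFunctions hφ
        have mφ : Measurable φ := hφ.1.continuous.measurable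
        have gψ := growth_of_mem_testFunctions hψt
        have h1 := integral_lineDeriv_mul_muHalf ha i
          (fun X _ => hasLineDerivAt_of_contDiff hφ.1 i X)
          (fun X _ => hasLineDerivAt_of_contDiff hψ i X)
          (((growth_gradient_coord hφ i).mul gψ).integrable ha (by linarith)
            ((measurable_gradient_coord hφ.1 i).mul mψ).aestronglyMeasurable)
          ((gφ.mul (growth_gradient_coord hψt i)).integrable ha (by linarith)
            (mφ.mul (measurable_gradient_coord hψ i)).aestronglyMeasurable)
          ((gφ.mul gψ).integrable ha (by linarith) (mφ.mul mψ).aestronglyMeasurable)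
          (((gφ.mul gψ).mul (Growth.coord i)).integrable ha (by linarith)
            ((mφ.mul mψ).mul (measurable_coord i)).aestronglyMeasurable)
          (((gφ.mul gy).congr fun X _ => mul_assoc _ _ _).integrable ha (by linarith)
            ((mφ.mul mψ).mul (my.const_mul _)).aestronglyMeasurable)
        rw [← integral_neg] at h1
        calc _ = ∫ X, gradient φ X i * ψ X ∂(muHalf N a) := by
              congr 1; ext X
              rw [inner_smul_right, EuclideanSpace.inner_single_right]; simp [mul_comm]
          _ = _ := h1
          _ = _ := by congr 1; ext X; simp only [hw]; ring
      have e1 := h.integral_inner_eq le_rfl hk hwL hid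
      have e2 := h'.integral_inner_eq le_rfl hk hwL hid
      rw [← e2] at e1
      have e3 : ∀ X, inner ℝ (G X) (ψ X • basisVec i) = ψ X * G X i := fun X => by
        rw [inner_smul_right, EuclideanSpace.inner_single_right]; simp
      have e4 : ∀ X, inner ℝ (G' X) (ψ X • basisVec i) = ψ X * G' X i := fun X => by
        rw [inner_smul_right, EuclideanSpace.inner_single_right]; simp
      simp only [e3, e4] at e1
      have mψ2 : MemLp ψ 2 (muHalf N a) := (memLp_of_mem_testFunctions hψt _).1
      simp only [smul_eq_mul, mul_sub]
      refine (integral_sub (mψ2.integrable_mul m1) (mψ2.integrable_mul m2)).trans ?_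
      exact sub_eq_zero.2 e1
    · filter_upwards [ae_yCoord_pos] with X h1 h2
      exact sub_eq_zero.1 (h2 h1)
  filter_upwards [ae_all_iff.2 hi] with X hX
  ext i; exact hX i

end Sobolev

/-! ### Approximation in the Sobolev norm and cutoff at infinity. -/

section Approximation

variable {α E : Type*} [MeasurableSpace α] [NormedAddCommGroup E]

lemma tendsto_integral_norm_sq_zero {μ : Measure α} {f : ℕ → α → E} {g : α → ℝ}
    (hf : ∀ n, AEStronglyMeasurable (f n) μ) (hg : MemLp g 2 μ)
    (hb : ∀ n, ∀ᵐ x ∂μ, ‖f n x‖ ≤ g x)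
    (hl : ∀ᵐ x ∂μ, Tendsto (fun n => f n x) atTop (𝓝 0)) :
    Tendsto (fun n => ∫ x, ‖f n x‖ ^ 2 ∂μ) atTop (𝓝 0) := by
  have h := tendsto_integral_of_dominated_convergence (μ := μ) (F := fun n x => ‖f n x‖ ^ 2)
    (f := fun _ => (0 : ℝ)) (fun x => g x ^ 2) (fun n => (hf n).norm.pow 2) hg.integrable_sq
    (fun n => ?_) ?_
  · simpa using h
  · filter_upwards [hb n] with x hx
    rw [Real.norm_of_nonneg (by positivity)]
    gcongr
  · filter_upwards [hl] with x hx
    simpa using (hx.norm.pow 2)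

variable {N : ℕ} {a : ℝ} {D : Set (Space N → ℝ)} {μ : Measure (Space N)}
  {V : Space N → ℝ} {G : Space N → Space N}

lemma isSobolev_of_tendsto (hV : MemLp V 2 μ) (hG : MemLp G 2 μ) {φ : ℕ → Space N → ℝ}
    (hφ : ∀ n, φ n ∈ D)
    (h1 : Tendsto (fun n => ∫ X, ‖V X - φ n X‖ ^ 2 ∂μ) atTop (𝓝 0))
    (h2 : Tendsto (fun n => ∫ X, ‖G X - gradient (φ n) X‖ ^ 2 ∂μ) atTop (𝓝 0)) :
    IsSobolev D μ V G := by
  refine ⟨hV, hG, fun ε hε => ?_⟩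
  have h := h1.add h2
  rw [add_zero] at h
  obtain ⟨n, hn⟩ := (h.eventually (gt_mem_nhds hε)).exists
  refine ⟨φ n, hφ n, ?_⟩
  simpa using hn

lemma integral_norm_sub_sq_le {F : Type*} [NormedAddCommGroup F] {f g h : Space N → F}
    (hf : MemLp f 2 μ) (hg : MemLp g 2 μ) (hh : MemLp h 2 μ) :
    ∫ X, ‖f X - h X‖ ^ 2 ∂μ ≤ 2 * ∫ X, ‖f X - g X‖ ^ 2 ∂μ + 2 * ∫ X, ‖g X - h X‖ ^ 2 ∂μ := by
  have i : ∀ {u v : Space N → F}, MemLp u 2 μ → MemLp v 2 μ →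
      Integrable (fun X => ‖u X - v X‖ ^ 2) μ := fun hu hv =>
    (hu.sub hv).norm.integrable_sq
  rw [← integral_const_mul, ← integral_const_mul,
    ← integral_add ((i hf hg).const_mul 2) ((i hg hh).const_mul 2)]
  refine integral_mono (i hf hh) (((i hf hg).const_mul 2).add ((i hg hh).const_mul 2)) fun X => ?_
  have : ‖f X - h X‖ ≤ ‖f X - g X‖ + ‖g X - h X‖ := by
    simpa using norm_add_le (f X - g X) (g X - h X)
  simp only
  nlinarith [norm_nonneg (f X - h X), sq_nonneg (‖f X - g X‖ - ‖g X - h X‖),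
    norm_nonneg (f X - g X), norm_nonneg (g X - h X)]

lemma isSobolev_of_tendsto_isSobolev [IsFiniteMeasure μ] (hD : D ⊆ testFunctions N)
    (hV : MemLp V 2 μ) (hG : MemLp G 2 μ) {W : ℕ → Space N → ℝ} {H : ℕ → Space N → Space N}
    (hW : ∀ n, IsSobolev D μ (W n) (H n))
    (h1 : Tendsto (fun n => ∫ X, ‖V X - W n X‖ ^ 2 ∂μ) atTop (𝓝 0))
    (h2 : Tendsto (fun n => ∫ X, ‖G X - H n X‖ ^ 2 ∂μ) atTop (𝓝 0)) :
    IsSobolev D μ V G := by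
  refine ⟨hV, hG, fun ε hε => ?_⟩
  have h := h1.add h2
  rw [add_zero] at h
  -- Two errors below `ε/4`, each doubled by `integral_norm_sub_sq_le`.
  obtain ⟨n, hn⟩ := (h.eventually (gt_mem_nhds (by positivity : 0 < ε / 4))).exists
  obtain ⟨φ, hφ, hlt⟩ := (hW n).approx (ε / 4) (by positivity)
  refine ⟨φ, hφ, ?_⟩
  obtain ⟨m1, m2⟩ := memLp_of_mem_testFunctions (hD hφ) μ
  have e1 := integral_norm_sub_sq_le hV (hW n).memLp m1
  have e2 := integral_norm_sub_sq_le hG (hW n).grad_memLp m2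
  simp only [Real.norm_eq_abs, sq_abs] at e1 hn
  linarith

/-- Smooth cutoff at infinity. -/
def ballCut (N n : ℕ) (X : Space N) : ℝ :=
  Real.smoothTransition (2 - ‖X‖ ^ 2 / ((n : ℝ) + 1) ^ 2)

lemma contDiff_ballCut (n : ℕ) : ContDiff ℝ ∞ (ballCut N n) :=
  Real.smoothTransition.contDiff.comp
    (contDiff_const.sub ((contDiff_norm_sq ℝ).div_const _))

lemma ballCut_eq_zero {n : ℕ} {X : Space N} (h : 2 * ((n : ℝ) + 1) < ‖X‖) :
    ballCut N n X = 0 := by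
  refine Real.smoothTransition.zero_of_nonpos ?_
  have h0 : (0 : ℝ) < n + 1 := by positivity
  rw [sub_nonpos, le_div_iff₀ (by positivity)]
  nlinarith

lemma hasCompactSupport_ballCut (n : ℕ) : HasCompactSupport (ballCut N n) := by
  refine HasCompactSupport.intro (isCompact_closedBall (0 : Space N) (2 * ((n : ℝ) + 1)))
    fun X hX => ballCut_eq_zero ?_
  simpa using hX

lemma hasGradientAt_ballCut (n : ℕ) (X : Space N) :
    HasGradientAt (ballCut N n)
      ((-2 / ((n : ℝ) + 1) ^ 2
        * deriv Real.smoothTransition (2 - ‖X‖ ^ 2 / ((n : ℝ) + 1) ^ 2)) • X) X := by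
  rw [hasGradientAt_iff_hasFDerivAt]
  have h1 := (((hasStrictFDerivAt_norm_sq X).hasFDerivAt.mul_const
    ((((n : ℝ) + 1) ^ 2)⁻¹)).const_sub 2)
  have h := (hasDerivAt_smoothTransition (2 - ‖X‖ ^ 2 / ((n : ℝ) + 1) ^ 2)).comp_hasFDerivAt X h1
  convert! h using 1
  ext Y
  simp
  ring

/-- The gradient is at most `2M|X|/(n+1)²`, where `M` bounds the derivative of the transition, and
it vanishes for `|X| > 2(n+1)`. Uniformity in `n` is what dominated convergence requires. -/
lemma ballCut_facts : ∃ K : ℝ, ∀ (n : ℕ) (X : Space N), ‖gradient (ballCut N n) X‖ ≤ K := by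
  obtain ⟨M, hM0, hM⟩ := exists_bound_deriv_smoothTransition
  refine ⟨4 * M, fun n X => ?_⟩
  have h0 : (0 : ℝ) < n + 1 := by positivity
  by_cases hX : 2 * ((n : ℝ) + 1) < ‖X‖
  · have : ballCut N n =ᶠ[𝓝 X] fun _ => 0 := by
      filter_upwards [(isOpen_lt continuous_const continuous_norm).mem_nhds hX] with Y hY
      exact ballCut_eq_zero hY
    rw [norm_gradient, this.fderiv_eq]
    simpa using hM0
  · rw [(hasGradientAt_ballCut n X).gradient, norm_smul, norm_mul, norm_div, norm_pow,
      Real.norm_of_nonneg h0.le, Real.norm_eq_abs, Real.norm_eq_abs]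
    have h1 := hM (2 - ‖X‖ ^ 2 / ((n : ℝ) + 1) ^ 2)
    have h2 : |(-2 : ℝ)| / ((n : ℝ) + 1) ^ 2 * ‖X‖ ≤ 4 := by
      rw [div_mul_eq_mul_div, div_le_iff₀ (by positivity)]
      norm_num
      have : (1 : ℝ) ≤ n + 1 := by linarith [(Nat.cast_nonneg n : (0 : ℝ) ≤ n)]
      nlinarith
    calc _ = |(-2 : ℝ)| / ((n : ℝ) + 1) ^ 2 * ‖X‖
          * |deriv Real.smoothTransition (2 - ‖X‖ ^ 2 / ((n : ℝ) + 1) ^ 2)| := by ring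
      _ ≤ 4 * M := by gcongr

lemma eventually_ballCut (X : Space N) :
    ∀ᶠ n : ℕ in atTop, ballCut N n X = 1 ∧ gradient (ballCut N n) X = 0 := by
  have ht : Tendsto (fun n : ℕ => ((n : ℝ) + 1) ^ 2) atTop atTop :=
    (tendsto_pow_atTop two_ne_zero).comp
      (tendsto_atTop_add_const_right _ _ tendsto_natCast_atTop_atTop)
  filter_upwards [ht.eventually_gt_atTop (‖X‖ ^ 2)] with n hn
  have h0 : (0 : ℝ) < ((n : ℝ) + 1) ^ 2 := by positivity
  have h1 : 1 < 2 - ‖X‖ ^ 2 / ((n : ℝ) + 1) ^ 2 := by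
    have := (div_lt_one h0).2 hn
    linarith
  refine ⟨Real.smoothTransition.one_of_one_le h1.le, ?_⟩
  rw [(hasGradientAt_ballCut n X).gradient, deriv_smoothTransition_of_one_lt h1]
  simp

lemma gradient_mul {f g : Space N → ℝ} {X : Space N} (hf : DifferentiableAt ℝ f X)
    (hg : DifferentiableAt ℝ g X) :
    gradient (fun Y => f Y * g Y) X = f X • gradient g X + g X • gradient f X := by
  simp only [gradient_eq_toDual_symm]
  rw [fderiv_fun_mul hf hg, map_add, map_smul, map_smul]

/-- A smooth function in the Sobolev space norm can be cut off at infinity. -/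
lemma isSobolev_of_contDiff {ψ : Space N → ℝ} (hψ : ContDiff ℝ ∞ ψ) (h1 : MemLp ψ 2 μ)
    (h2 : MemLp (gradient ψ) 2 μ) (hD : ∀ n, (fun X => ballCut N n X * ψ X) ∈ D) :
    IsSobolev D μ ψ (gradient ψ) := by
  obtain ⟨K, hK⟩ := ballCut_facts (N := N)
  have hK0 : 0 ≤ K := (norm_nonneg _).trans (hK 0 0)
  have hb0 : ∀ n X, ‖1 - ballCut N n X‖ ≤ 1 := fun n X => by
    rw [Real.norm_eq_abs, abs_le]
    have h3 := Real.smoothTransition.nonneg (2 - ‖X‖ ^ 2 / ((n : ℝ) + 1) ^ 2)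
    have h4 := Real.smoothTransition.le_one (2 - ‖X‖ ^ 2 / ((n : ℝ) + 1) ^ 2)
    unfold ballCut
    constructor <;> linarith
  have hgrad : ∀ n X, gradient (fun X => ballCut N n X * ψ X) X
      = ballCut N n X • gradient ψ X + ψ X • gradient (ballCut N n) X := fun n X =>
    gradient_mul ((contDiff_ballCut n).differentiable (by simp) X)
      (hψ.differentiable (by simp) X)
  refine isSobolev_of_tendsto h1 h2 hD ?_ ?_
  · refine tendsto_integral_norm_sq_zero (g := fun X => ‖ψ X‖)
      (fun n => ?_) h1.norm (fun n => ae_of_all _ fun X => ?_) (ae_of_all _ fun X => ?_)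
    · exact (hψ.continuous.sub
        ((contDiff_ballCut n).continuous.mul hψ.continuous)).aestronglyMeasurable
    · rw [show ψ X - ballCut N n X * ψ X = (1 - ballCut N n X) * ψ X by ring, norm_mul]
      exact mul_le_of_le_one_left (norm_nonneg _) (hb0 n X)
    · refine tendsto_const_nhds.congr' ?_
      filter_upwards [eventually_ballCut X] with n hn
      rw [hn.1]; simp
  · refine tendsto_integral_norm_sq_zero (g := fun X => ‖gradient ψ X‖ + K * ‖ψ X‖)
      (fun n => ?_) (h2.norm.add (h1.norm.const_mul K)) (fun n => ae_of_all _ fun X => ?_)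
      (ae_of_all _ fun X => ?_)
    · have hc : ContDiff ℝ ∞ fun X => ballCut N n X * ψ X := (contDiff_ballCut n).mul hψ
      exact (hψ.continuous_gradient.sub hc.continuous_gradient).aestronglyMeasurable
    · rw [hgrad, show gradient ψ X - (ballCut N n X • gradient ψ X + ψ X • gradient (ballCut N n) X)
        = (1 - ballCut N n X) • gradient ψ X - ψ X • gradient (ballCut N n) X by module]
      refine (norm_sub_le _ _).trans (add_le_add ?_ ?_)
      · rw [norm_smul]; exact mul_le_of_le_one_left (norm_nonneg _) (hb0 n X)
      · rw [norm_smul, mul_comm]; gcongr; exact hK n X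
    · refine tendsto_const_nhds.congr' ?_
      filter_upwards [eventually_ballCut X] with n hn
      rw [hgrad, hn.1, hn.2]; simp

lemma ballCut_mul_mem_testFunctions {ψ : Space N → ℝ} (hψ : ContDiff ℝ ∞ ψ) (n : ℕ) :
    (fun X => ballCut N n X * ψ X) ∈ testFunctions N :=
  ⟨(contDiff_ballCut n).mul hψ, (hasCompactSupport_ballCut n).mul_right⟩

end Approximation

/-! ### Membership of powers of `y` and of affine functions. -/

section Extremals

variable {N : ℕ} {a : ℝ}

lemma memLp_smul_basisVec {μ : Measure (Space N)} {c : Space N → ℝ} (hc : MemLp c 2 μ)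
    (i : Fin (N + 1)) : MemLp (fun X => c X • basisVec (N := N) i) 2 μ := by
  rw [memLp_piLp_iff]
  intro j
  by_cases h : j = i
  · subst h; simpa using hc
  · simp [h]

/-- The truncations of `A y^{1-a}` near the boundary. -/
def powCut (N : ℕ) (a A : ℝ) (n : ℕ) (X : Space N) : ℝ :=
  zeroCut n (yCoord X) * (A * yCoord X ^ (1 - a))

lemma contDiff_yCoord : ContDiff ℝ ∞ (yCoord : Space N → ℝ) := by
  unfold yCoord; fun_prop

lemma hasGradientAt_comp_yCoord {g : ℝ → ℝ} {g' : ℝ} {X : Space N}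
    (hg : HasDerivAt g g' (yCoord X)) :
    HasGradientAt (fun Y : Space N => g (yCoord Y)) (g' • basisVec (Fin.last N)) X := by
  rw [hasGradientAt_iff_hasFDerivAt]
  have h := hg.comp_hasFDerivAt X (f := (yCoord : Space N → ℝ))
    (EuclideanSpace.proj (Fin.last N) : Space N →L[ℝ] ℝ).hasFDerivAt
  convert! h using 1
  ext Y
  simp [EuclideanSpace.inner_single_left]

lemma powCut_eq_zero {A : ℝ} {n : ℕ} {X : Space N} (h : n * yCoord X ≤ 1) :
    powCut N a A n X = 0 := by
  rw [powCut, zeroCut_eq_zero h, zero_mul]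

lemma contDiff_powCut (A : ℝ) (n : ℕ) : ContDiff ℝ ∞ (powCut N a A n) := by
  rw [contDiff_iff_contDiffAt]
  intro X
  by_cases hX : 0 < yCoord X
  · exact ((contDiff_zeroCut n).comp contDiff_yCoord).contDiffAt.mul
      (contDiffAt_const.mul (contDiff_yCoord.contDiffAt.rpow_const_of_ne hX.ne'))
  · have : powCut N a A n =ᶠ[𝓝 X] fun _ => 0 := by
      have h1 : ∀ᶠ Y in 𝓝 X, n * yCoord Y < 1 := by
        refine (continuous_const.mul continuous_yCoord).continuousAt.eventually_lt
          continuousAt_const ?_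
        have : (n : ℝ) * yCoord X ≤ 0 := mul_nonpos_of_nonneg_of_nonpos (by positivity) (not_lt.1 hX)
        simp only [Pi.mul_apply]
        linarith
      filter_upwards [h1] with Y hY
      exact powCut_eq_zero hY.le
    exact contDiffAt_const.congr_of_eventuallyEq this

lemma gradient_powCut (A : ℝ) (n : ℕ) {X : Space N} (hX : 0 < yCoord X) :
    gradient (powCut N a A n) X = ((A * (yCoord X * zeroCutDeriv n (yCoord X)
      + (1 - a) * zeroCut n (yCoord X))) * yCoord X ^ (-a)) • basisVec (Fin.last N) := by
  have h := hasGradientAt_comp_yCoord (X := X) ((hasDerivAt_zeroCut n (yCoord X)).mul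
    ((Real.hasDerivAt_rpow_const (p := 1 - a) (Or.inl hX.ne')).const_mul A))
  refine h.gradient.trans ?_
  congr 1
  rw [show 1 - a - 1 = -a by ring, show 1 - a = -a + 1 by ring, Real.rpow_add_one hX.ne']
  ring

lemma ballCut_mul_powCut_mem (A : ℝ) {n : ℕ} (hn : 1 ≤ n) (m : ℕ) :
    (fun X => ballCut N m X * powCut N a A n X) ∈ testFunctionsHalf N := by
  obtain ⟨h1, h2⟩ := ballCut_mul_mem_testFunctions (contDiff_powCut (N := N) (a := a) A n) m
  refine ⟨h1, h2, ?_⟩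
  have hn' : (0 : ℝ) < n := by exact_mod_cast hn
  have hs : tsupport (fun X => ballCut N m X * powCut N a A n X) ⊆ {X | 1 ≤ n * yCoord X} := by
    refine closure_minimal (fun X hX => ?_)
      (isClosed_le continuous_const (continuous_const.mul continuous_yCoord))
    by_contra h
    simp only [mem_ofPred_eq, not_le] at h
    exact hX (by simp only [powCut_eq_zero h.le, mul_zero])
  intro X hX
  have h := hs hX
  simp only [mem_ofPred_eq] at h
  exact pos_of_mul_pos_right (by linarith) hn'.le

/-- `A y^{1-a}` belongs to `H^1_0` of the half-space. -/
lemma isH1ZeroHalf_rpow (ha : -1 < a) (ha' : a < 1) (A : ℝ) :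
    IsH1ZeroHalf N a (fun X => A * yCoord X ^ (1 - a))
      (fun X => ((A * (1 - a)) * yCoord X ^ (-a)) • basisVec (Fin.last N)) := by
  have := isProbabilityMeasure_muHalf (N := N) ha
  obtain ⟨K, hK0, hK⟩ := exists_bound_zeroCutDeriv
  have hp : ∀ k : ℝ, MemLp (fun X : Space N => k * yCoord X ^ (1 - a)) 2 (muHalf N a) := fun k =>
    ((Growth.rpow (1 - a)).const_mul k).memLp ha (by linarith)
      ((measurable_yCoord.pow_const _).const_mul k).aestronglyMeasurable
  have hq : ∀ k : ℝ, MemLp (fun X : Space N => k * yCoord X ^ (-a)) 2 (muHalf N a) := fun k =>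
    ((Growth.rpow (-a)).const_mul k).memLp ha (by linarith)
      ((measurable_yCoord.pow_const _).const_mul k).aestronglyMeasurable
  have hbasis : ‖basisVec (Fin.last N)‖ = 1 := by simp
  have hb1 : ∀ n (X : Space N), |1 - zeroCut n (yCoord X)| ≤ 2 := fun n X => by
    have := abs_le.1 (abs_zeroCut_le n (yCoord X))
    rw [abs_le]; constructor <;> linarith
  -- Two limits are taken separately: here the cutoff at infinity for a fixed boundary cutoff, below
  -- the boundary cutoff itself. The shift `n + 1` keeps the support off `y = 0`, since `n = 0`
  -- gives the zero function without a usable support bound.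
  have hS : ∀ n : ℕ, IsSobolev (testFunctionsHalf N) (muHalf N a) (powCut N a A (n + 1))
      (gradient (powCut N a A (n + 1))) := fun n => by
    have hc := contDiff_powCut (N := N) (a := a) A (n + 1)
    refine isSobolev_of_contDiff hc ?_ ?_ (ballCut_mul_powCut_mem A (by omega))
    · refine (hp A).mono hc.continuous.aestronglyMeasurable (ae_of_all _ fun X => ?_)
      rw [powCut, norm_mul]
      exact mul_le_of_le_one_left (norm_nonneg _) (abs_zeroCut_le _ _)
    · refine (hq (|A| * (K + (1 - a)))).mono hc.continuous_gradient.aestronglyMeasurable ?_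
      filter_upwards [ae_yCoord_pos] with X hX
      rw [gradient_powCut A _ hX, norm_smul, hbasis, mul_one, norm_mul, norm_mul,
        norm_mul (_ * _) (yCoord X ^ (-a)), norm_mul |A|, norm_abs_eq_norm]
      have h1 : ‖K + (1 - a)‖ = K + (1 - a) := Real.norm_of_nonneg (by linarith)
      rw [h1]
      gcongr
      · refine (norm_add_le _ _).trans (add_le_add (hK _ _ hX) ?_)
        rw [norm_mul, Real.norm_of_nonneg (by linarith)]
        exact mul_le_of_le_one_right (by linarith) (abs_zeroCut_le _ _)
  refine isSobolev_of_tendsto_isSobolev (fun φ h => ⟨h.1, h.2.1⟩) (hp A)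
    (memLp_smul_basisVec (hq _) _) hS ?_ ?_
  · refine tendsto_integral_norm_sq_zero (g := fun X => 2 * ‖A * yCoord X ^ (1 - a)‖)
      (fun n => ?_) ((hp A).norm.const_mul 2) (fun n => ae_of_all _ fun X => ?_) ?_
    · exact (((measurable_yCoord.pow_const _).const_mul A).sub
        (contDiff_powCut A _).continuous.measurable).aestronglyMeasurable
    · rw [powCut, show A * yCoord X ^ (1 - a) - zeroCut (n + 1) (yCoord X)
        * (A * yCoord X ^ (1 - a)) = (1 - zeroCut (n + 1) (yCoord X))
        * (A * yCoord X ^ (1 - a)) by ring, norm_mul]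
      gcongr
      exact hb1 _ X
    · filter_upwards [ae_yCoord_pos] with X hX
      have h := ((tendsto_zeroCut hX).comp (tendsto_add_atTop_nat 1)).mul_const
        (A * yCoord X ^ (1 - a))
      have h' := h.const_sub (A * yCoord X ^ (1 - a))
      simpa [powCut] using h'
  · refine tendsto_integral_norm_sq_zero
      (g := fun X => (|A| * (K + 2 * (1 - a))) * yCoord X ^ (-a)) (fun n => ?_)
      (hq _) (fun n => ?_) ?_
    · exact (memLp_smul_basisVec (hq _) _).aestronglyMeasurable.sub
        (contDiff_powCut A _).continuous_gradient.aestronglyMeasurable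
    · filter_upwards [ae_yCoord_pos] with X hX
      rw [gradient_powCut A _ hX, ← sub_smul, norm_smul, hbasis, mul_one]
      rw [show A * (1 - a) * yCoord X ^ (-a) - A * (yCoord X * zeroCutDeriv (n + 1) (yCoord X)
          + (1 - a) * zeroCut (n + 1) (yCoord X)) * yCoord X ^ (-a)
        = A * (-(yCoord X * zeroCutDeriv (n + 1) (yCoord X))
          + (1 - a) * (1 - zeroCut (n + 1) (yCoord X))) * yCoord X ^ (-a) by ring]
      rw [norm_mul, norm_mul, Real.norm_of_nonneg (by positivity : 0 ≤ yCoord X ^ (-a))]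
      gcongr
      · rw [Real.norm_eq_abs]
      · refine (norm_add_le _ _).trans (add_le_add ?_ ?_)
        · rw [norm_neg]; exact hK _ _ hX
        · rw [norm_mul, Real.norm_of_nonneg (by linarith), mul_comm 2]
          exact mul_le_mul_of_nonneg_left (hb1 _ X) (by linarith)
    · filter_upwards [ae_yCoord_pos] with X hX
      have h1 := ((tendsto_zeroCut hX).comp (tendsto_add_atTop_nat 1)).const_mul (1 - a)
      have h2 := ((tendsto_zeroCutDeriv hX).comp (tendsto_add_atTop_nat 1)).const_mul (yCoord X)
      have h3 := ((((h2.add h1).const_mul A).mul_const (yCoord X ^ (-a))).const_sub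
        (A * (1 - a) * yCoord X ^ (-a))).smul_const (basisVec (Fin.last N))
      simp only [mul_zero, zero_add, mul_one, sub_self, zero_smul] at h3
      refine h3.congr fun n => ?_
      rw [gradient_powCut A _ hX, ← sub_smul]
      rfl

/-- Affine functions belong to `H^1`. -/
lemma isSobolev_affine {μ : Measure (Space N)} [IsFiniteMeasure μ]
    (hμ : ∀ i, MemLp (fun X : Space N => X i) 2 μ) (A : ℝ) (b : Space N) :
    IsSobolev (testFunctions N) μ (fun X => A + inner ℝ b X) (fun _ => b) := by
  have hc : ContDiff ℝ ∞ fun X : Space N => A + inner ℝ b X :=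
    contDiff_const.add (contDiff_const.inner ℝ contDiff_id)
  have hg : gradient (fun X : Space N => A + inner ℝ b X) = fun _ => b := by
    refine gradient_eq fun X => ?_
    rw [hasGradientAt_iff_hasFDerivAt]
    exact (InnerProductSpace.toDual ℝ (Space N) b).hasFDerivAt.const_add A
  have h := isSobolev_of_contDiff (D := testFunctions N) (μ := μ) hc ?_ ?_
    (ballCut_mul_mem_testFunctions hc)
  · rwa [hg] at h
  · refine (memLp_const A).add ?_
    have : MemLp (fun X : Space N => X) 2 μ := memLp_piLp_iff.2 hμ
    exact this.const_inner b
  · rw [hg]; exact memLp_const b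

end Extremals

/-! ### The sharp inequalities on the half-space. -/

section HalfSpace

variable {N : ℕ} {a κ : ℝ} {V : Space N → ℝ} {G : Space N → Space N}

lemma IsSobolev.integral_inner_eigGrad {D : Set (Space N → ℝ)} (ha : -1 < a) (ha' : a < 1)
    (hκ : κ = 0 ∨ κ = 1 - a) (hD : D ⊆ testFunctions N)
    (hadm : ∀ φ ∈ D, ∀ i, Admissible N a κ i φ fun X => gradient φ X i)
    (h : IsSobolev D (muHalf N a) V G) (n : Fin (N + 1) → ℕ) :
    ∫ X, inner ℝ (G X) (eigGrad N a κ n X) ∂(muHalf N a)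
      = eigSum N κ n * ∫ X, V X * eig N a κ n X ∂(muHalf N a) := by
  have := isProbabilityMeasure_muHalf (N := N) ha
  rw [h.integral_inner_eq hD (memLp_eigGrad ha ha' hκ n)
    ((memLp_eig ha ha' hκ n).const_mul (eigSum N κ n)) fun φ hφ => ?_, ← integral_const_mul]
  · congr 1; ext X; ring
  · rw [_root_.integral_inner_eigGrad ha ha' hκ
      (memLp_of_mem_testFunctions (hD hφ) (muHalf N a)).2 (hadm φ hφ) n, ← integral_const_mul]
    congr 1; ext X; ring

/-- The abstract Poincaré inequality for `muHalf`, with the equality case. -/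
lemma poincare_of_integral_inner_eigGrad (ha : -1 < a) (ha' : a < 1) (hκ : κ = 0 ∨ κ = 1 - a)
    (hV : MemLp V 2 (muHalf N a)) (hG : MemLp G 2 (muHalf N a)) {Λ : ℝ}
    (hid : ∀ n, ∫ X, inner ℝ (G X) (eigGrad N a κ n X) ∂(muHalf N a)
      = eigSum N κ n * ∫ X, V X * eig N a κ n X ∂(muHalf N a))
    (hlow : ∀ n, eigSum N κ n < Λ → ∫ X, V X * eig N a κ n X ∂(muHalf N a) = 0) :
    Λ * ∫ X, V X ^ 2 ∂(muHalf N a) ≤ ∫ X, ‖G X‖ ^ 2 ∂(muHalf N a) ∧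
    (Λ * ∫ X, V X ^ 2 ∂(muHalf N a) = ∫ X, ‖G X‖ ^ 2 ∂(muHalf N a) →
      ∀ F : Finset (Fin (N + 1) → ℕ), (∀ n, n ∉ F → eigSum N κ n ≠ Λ) →
        ∃ c : (Fin (N + 1) → ℕ) → ℝ, V =ᵐ[muHalf N a] fun X => ∑ n ∈ F, c n * eig N a κ n X) := by
  set μ := muHalf N a
  let me := fun n => memLp_eig (N := N) ha ha' hκ n
  let mg := fun n => memLp_eigGrad (N := N) ha ha' hκ n
  let e : (Fin (N + 1) → ℕ) → Lp ℝ 2 μ := fun n => (me n).toLp _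
  let g : (Fin (N + 1) → ℕ) → Lp (Space N) 2 μ := fun n => (mg n).toLp _
  have ho : ∀ m n, m ≠ n → inner ℝ (e m) (e n) = 0 := fun m n hmn => by
    rw [inner_toLp_real (me m) (me n)]
    exact integral_eig_mul_eig_of_ne ha ha' hκ hmn
  have hc : ∀ v : Lp ℝ 2 μ, (∀ n, inner ℝ v (e n) = 0) → v = 0 := fun v hv => by
    rw [Lp.eq_zero_iff_ae_eq_zero]
    refine ae_eq_zero_of_integral_mul_eig ha ha' hκ (Lp.stronglyMeasurable v).measurable
      (Lp.memLp v) fun n => ?_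
    rw [← hv n]
    conv_rhs => rw [← Lp.toLp_coeFn v (Lp.memLp v)]
    exact (inner_toLp_real (Lp.memLp v) (me n)).symm
  have hg : ∀ m n, inner ℝ (g m) (g n) = eigSum N κ n * inner ℝ (e m) (e n) := fun m n => by
    rw [inner_toLp_real (me m) (me n), inner_toLp (mg m) (mg n)]
    exact integral_inner_eigGrad ha ha' hκ (mg m) (admissible_eig ha' hκ m) n
  have hv : ∀ n, inner ℝ (hV.toLp V) (e n) = ∫ X, V X * eig N a κ n X ∂μ :=
    fun n => inner_toLp_real hV (me n)
  have h := mul_norm_sq_le_of_eigen (Λ := Λ) (v := hV.toLp V) (γ := hG.toLp G) ho hc hg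
    (fun n => by rw [hv, inner_toLp hG (mg n)]; exact hid n)
    (fun n hn => by rw [hv]; exact hlow n hn)
  rw [norm_toLp_sq hG, norm_toLp_sq_real hV] at h
  refine ⟨h.1, fun heq F hF => ?_⟩
  have h2 := eq_sum_of_inner_eq_zero ho hc F fun n hn => h.2 heq n (hF n hn)
  refine ⟨fun n => inner ℝ (hV.toLp V) (e n) / ‖e n‖ ^ 2, ?_⟩
  have h3 : ∀ c : (Fin (N + 1) → ℕ) → ℝ, (∑ n ∈ F, c n • e n : Lp ℝ 2 μ)
      =ᵐ[μ] fun X => ∑ n ∈ F, c n * eig N a κ n X := by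
    intro c
    refine (Lp.coeFn_finsetSum F fun n => c n • e n).trans ?_
    have h4 : ∀ n, (c n • e n : Lp ℝ 2 μ) =ᵐ[μ] fun X => c n * eig N a κ n X := fun n => by
      filter_upwards [Lp.coeFn_smul (c n) (e n), (me n).coeFn_toLp] with X h5 h6
      rw [h5, Pi.smul_apply, h6, smul_eq_mul]
    filter_upwards [ae_all_iff.2 h4] with X hX
    simp [hX]
  have h5 := hV.coeFn_toLp
  rw [h2] at h5
  exact h5.symm.trans (h3 _)

lemma eig_zero (X : Space N) : eig N a κ 0 X = yCoord X ^ κ := by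
  simp only [eig, eigPoly, Pi.zero_apply]
  rw [Finset.prod_eq_one, mul_one]
  intro i _
  split_ifs <;> simp [lag_zero, herm]

lemma eigSum_eq (n : Fin (N + 1) → ℕ) :
    eigSum N κ n = κ / 2 + n (Fin.last N) + ∑ j : Fin N, (n j.castSucc : ℝ) / 2 := by
  rw [eigSum, Fin.sum_univ_castSucc, add_comm]
  congr 1
  · simp [eigVal]
  · simp [eigVal, (Fin.castSucc_lt_last _).ne]

/-- The spectral gap above the ground state: a nonzero entry costs at least `1/2` in a horizontal
direction and `1` in the last one. -/
lemma eq_zero_of_eigSum_le {n : Fin (N + 1) → ℕ} (h : eigSum N κ n < κ / 2 + 1 / 2) : n = 0 := by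
  rw [eigSum_eq] at h
  have h0 : ∀ j : Fin N, (0 : ℝ) ≤ (n j.castSucc : ℝ) / 2 := fun j => by positivity
  have h1 : (0 : ℝ) ≤ ∑ j : Fin N, (n j.castSucc : ℝ) / 2 := Finset.sum_nonneg fun j _ => h0 j
  have h2 : (0 : ℝ) ≤ n (Fin.last N) := by positivity
  ext i
  refine Fin.lastCases ?_ (fun j => ?_) i
  · have : (n (Fin.last N) : ℝ) < 1 := by linarith
    simpa using (show n (Fin.last N) < 1 by exact_mod_cast this)
  · have := Finset.single_le_sum (fun j _ => h0 j) (Finset.mem_univ j)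
    have : (n j.castSucc : ℝ) < 1 := by linarith
    simpa using (show n j.castSucc < 1 by exact_mod_cast this)

lemma eigRest_eq_one {n : Fin (N + 1) → ℕ} {i : Fin (N + 1)} (h : ∀ j, j ≠ i → n j = 0)
    (X : Space N) : eigRest N a κ n i X = 1 := by
  refine Finset.prod_eq_one fun j hj => ?_
  rw [h j (Finset.ne_of_mem_erase hj), eigPoly]
  split_ifs <;> simp [lag_zero, herm]

/-- The inequality for functions vanishing on the boundary. -/
lemma poincare_vanishing (ha : -1 < a) (ha' : a < 1)
    (h : IsSobolev (testFunctionsVanishing N) (muHalf N a) V G) :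
    ∫ X, V X ^ 2 ∂(muHalf N a) ≤ 2 / (1 - a) * ∫ X, ‖G X‖ ^ 2 ∂(muHalf N a) ∧
      (∫ X, V X ^ 2 ∂(muHalf N a) = 2 / (1 - a) * ∫ X, ‖G X‖ ^ 2 ∂(muHalf N a) ↔
        ∃ A : ℝ, V =ᵐ[muHalf N a] fun X => A * yCoord X ^ (1 - a)) := by
  have := isProbabilityMeasure_muHalf (N := N) ha
  have ha1 : 0 < 1 - a := by linarith
  have hid := h.integral_inner_eigGrad ha ha' (Or.inr rfl) (fun φ hφ => hφ.1)
    fun φ hφ i => admissible_of_mem_testFunctionsVanishing hφ i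
  have hge : ∀ n, eigSum N (1 - a) n < (1 - a) / 2 + 1 / 2 → n = 0 := fun n => eq_zero_of_eigSum_le
  have h0 : eigSum N (1 - a) 0 = (1 - a) / 2 := by rw [eigSum_eq]; simp
  -- `Λ` is the lowest Dirichlet level, so there is nothing below it and no orthogonality has to be
  -- imposed.
  obtain ⟨hle, heq⟩ := poincare_of_integral_inner_eigGrad ha ha' (Or.inr rfl) h.memLp h.grad_memLp
    (Λ := (1 - a) / 2) hid fun n hn => by
      have := hge n (by linarith)
      subst this; linarith
  have hconst : ∀ {x y : ℝ}, x = 2 / (1 - a) * y ↔ (1 - a) / 2 * x = y := fun {x y} => by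
    constructor
    · rintro rfl; field_simp
    · rintro rfl; field_simp
  refine ⟨?_, ?_⟩
  · rw [div_mul_eq_mul_div, le_div_iff₀ ha1]; linarith
  · rw [hconst]
    constructor
    · intro he
      obtain ⟨c, hc⟩ := heq he {0} fun n hn hn' =>
        hn (Finset.mem_singleton.2 (hge n (by linarith)))
      exact ⟨c 0, hc.trans (ae_of_all _ fun X => by simp [eig_zero])⟩
    · rintro ⟨A, hA⟩
      -- A priori `G` is only a limit of gradients; uniqueness identifies it with the explicit
      -- gradient. Testing the eigenvalue identity with the ground state then gives equality without
      -- computing any integral.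
      have hG : G =ᵐ[muHalf N a] fun X => ((A * (1 - a)) * yCoord X ^ (-a)) •
          basisVec (Fin.last N) :=
        ((h.mono fun φ hφ => hφ.1).congr_left hA).grad_unique ha
          ((isH1ZeroHalf_rpow ha ha' A).mono fun φ hφ => ⟨hφ.1, hφ.2.1⟩)
      have hgrad : ∀ X : Space N, 0 < yCoord X → eigGrad N a (1 - a) 0 X
          = ((1 - a) * yCoord X ^ (-a)) • basisVec (Fin.last N) := fun X _ => by
        ext i
        have hrest : eigRest N a (1 - a) 0 i X = 1 := eigRest_eq_one (fun _ _ => rfl) X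
        by_cases hi : i = Fin.last N
        · subst hi
          simp [eigGrad, eigD, hrest, eigPoly, lag_zero, lastInd]
        · simp [eigGrad, eigD, hrest, eigPoly, herm, lastInd, hi]
      have h1 : ∫ X, ‖G X‖ ^ 2 ∂(muHalf N a)
          = A * ∫ X, inner ℝ (G X) (eigGrad N a (1 - a) 0 X) ∂(muHalf N a) := by
        rw [← integral_const_mul]
        refine integral_congr_ae ?_
        filter_upwards [hG, ae_yCoord_pos] with X hX hy
        rw [← real_inner_self_eq_norm_sq, hgrad X hy]
        conv_lhs => rw [hX]
        conv_rhs => rw [hX]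
        simp only [inner_smul_left, inner_smul_right]
        simp
        ring
      have h2 : ∫ X, V X ^ 2 ∂(muHalf N a)
          = A * ∫ X, V X * eig N a (1 - a) 0 X ∂(muHalf N a) := by
        rw [← integral_const_mul]
        refine integral_congr_ae ?_
        filter_upwards [hA] with X hX
        rw [eig_zero, hX]; ring
      rw [h1, h2, hid 0, h0]; ring

/-- The multi-index with a single entry `1` at `j`. -/
def unitIndex (j : Fin N) : Fin (N + 1) → ℕ := Pi.single j.castSucc 1

lemma unitIndex_self (j : Fin N) : unitIndex j j.castSucc = 1 := by
  rw [unitIndex, Pi.single_eq_same]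

lemma unitIndex_of_ne {j : Fin N} {i : Fin (N + 1)} (h : i ≠ j.castSucc) : unitIndex j i = 0 := by
  rw [unitIndex, Pi.single_eq_of_ne h]

lemma eigPoly_castSucc_one (j : Fin N) : eigPoly N a κ j.castSucc 1 = Polynomial.X := by
  rw [eigPoly, if_neg (Fin.castSucc_lt_last j).ne, herm_one]

lemma eig_unitIndex (j : Fin N) (X : Space N) : eig N a 0 (unitIndex j) X = xCoord X j := by
  rw [eig_eq _ j.castSucc, eigRest_eq_one fun _ => unitIndex_of_ne, unitIndex_self,
    eigPoly_castSucc_one]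
  simp [xCoord]

lemma eigGrad_unitIndex (j : Fin N) (X : Space N) :
    eigGrad N a 0 (unitIndex j) X = basisVec j.castSucc := by
  ext i
  by_cases hi : i = j.castSucc
  · subst hi
    simp only [eigGrad, eigD]
    rw [eigRest_eq_one fun _ => unitIndex_of_ne, unitIndex_self, eigPoly_castSucc_one]
    simp
  · simp only [eigGrad, eigD, unitIndex_of_ne hi, eigPoly]
    split_ifs <;> simp [lag_zero, herm, hi]

lemma eigSum_unitIndex (j : Fin N) : eigSum N 0 (unitIndex j) = 1 / 2 := by
  rw [eigSum_eq, Finset.sum_eq_single j]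
  · simp [unitIndex, (Fin.castSucc_lt_last j).ne]
  · intro i _ hi
    simp [unitIndex, hi]
  · simp

/-- An excitation in `y` already costs `1`, so the last entry is zero and the horizontal entries sum
to `1`. -/
lemma eq_unitIndex_of_eigSum {n : Fin (N + 1) → ℕ} (h : eigSum N 0 n = 1 / 2) :
    ∃ j, n = unitIndex j := by
  rw [eigSum_eq] at h
  have h0 : ∀ j : Fin N, (0 : ℝ) ≤ (n j.castSucc : ℝ) / 2 := fun j => by positivity
  have h1 : (0 : ℝ) ≤ ∑ j : Fin N, (n j.castSucc : ℝ) / 2 := Finset.sum_nonneg fun j _ => h0 j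
  have h2 : n (Fin.last N) = 0 := by
    have : (n (Fin.last N) : ℝ) < 1 := by linarith
    have : n (Fin.last N) < 1 := by exact_mod_cast this
    omega
  rw [h2, ← Finset.sum_div] at h
  have h3 : ∑ j : Fin N, n j.castSucc = 1 := by
    have : (∑ j : Fin N, (n j.castSucc : ℝ)) = 1 := by push_cast at h; linarith
    exact_mod_cast this
  obtain ⟨j, hj⟩ : ∃ j : Fin N, n j.castSucc ≠ 0 := by
    by_contra! hc
    simp [hc] at h3
  have h4 := Finset.add_sum_erase Finset.univ (fun j : Fin N => n j.castSucc) (Finset.mem_univ j)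
  have h5 : ∑ i ∈ Finset.univ.erase j, n (i : Fin N).castSucc = 0 := by
    omega
  refine ⟨j, funext fun i => ?_⟩
  refine Fin.lastCases ?_ (fun k => ?_) i
  · simp [h2, unitIndex, (Fin.castSucc_lt_last j).ne]
  · by_cases hk : k = j
    · subst hk
      simp only [unitIndex, Pi.single_eq_same]
      omega
    · have := Finset.sum_eq_zero_iff.1 h5 k (by simp [hk])
      simp [unitIndex, hk, this]

/-- The vector `(b, 0)`. -/
def horizontal (b : Fin N → ℝ) : Space N := WithLp.toLp 2 (Fin.snoc b 0)

lemma inner_horizontal (b : Fin N → ℝ) (X : Space N) :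
    inner ℝ (horizontal b) X = ∑ j, b j * xCoord X j := by
  simp [horizontal, PiLp.inner_apply, Fin.sum_univ_castSucc, xCoord, mul_comm]

lemma norm_horizontal_sq (b : Fin N → ℝ) : ‖horizontal b‖ ^ 2 = ∑ j, b j ^ 2 := by
  simp [horizontal, EuclideanSpace.real_norm_sq_eq, Fin.sum_univ_castSucc]

lemma memLp_coord (ha : -1 < a) (i : Fin (N + 1)) :
    MemLp (fun X : Space N => X i) 2 (muHalf N a) :=
  (Growth.coord i).memLp ha (by linarith) (measurable_coord i).aestronglyMeasurable

lemma isH1Half_affine (ha : -1 < a) (A : ℝ) (b : Fin N → ℝ) :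
    IsH1Half N a (fun X => A + ∑ j, b j * xCoord X j) fun _ => horizontal b := by
  have := isProbabilityMeasure_muHalf (N := N) ha
  have h := isSobolev_affine (memLp_coord ha) A (horizontal b)
  simp only [inner_horizontal] at h
  exact h

lemma integral_sub_mean_sq {α : Type*} [MeasurableSpace α] {μ : Measure α}
    [IsProbabilityMeasure μ] {f : α → ℝ} (hf : MemLp f 2 μ) :
    ∫ x, (f x - ∫ z, f z ∂μ) ^ 2 ∂μ = ∫ x, f x ^ 2 ∂μ - (∫ x, f x ∂μ) ^ 2 := by
  set m := ∫ x, f x ∂μ with hm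
  have hf1 : Integrable f μ := hf.integrable one_le_two
  have e : ∀ x, (f x - m) ^ 2 = f x ^ 2 - 2 * m * f x + m ^ 2 := fun x => by ring
  have i1 : Integrable (fun x => f x ^ 2 - 2 * m * f x) μ :=
    hf.integrable_sq.sub (hf1.const_mul _)
  simp only [e]
  rw [integral_add i1 (integrable_const _), integral_sub hf.integrable_sq (hf1.const_mul _),
    integral_const_mul, integral_const, ← hm]
  simp; ring

/-- The inequality without boundary condition. -/
lemma poincare_half (ha : -1 < a) (ha' : a < 1) (h : IsH1Half N a V G) :
    (∫ X, V X ^ 2 ∂(muHalf N a)) - (∫ X, V X ∂(muHalf N a)) ^ 2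
        ≤ 2 * ∫ X, ‖G X‖ ^ 2 ∂(muHalf N a) ∧
      ((∫ X, V X ^ 2 ∂(muHalf N a)) - (∫ X, V X ∂(muHalf N a)) ^ 2
          = 2 * ∫ X, ‖G X‖ ^ 2 ∂(muHalf N a) ↔
        ∃ (A : ℝ) (b : Fin N → ℝ), V =ᵐ[muHalf N a] fun X => A + ∑ j, b j * xCoord X j) := by
  have := isProbabilityMeasure_muHalf (N := N) ha
  set μ := muHalf N a
  have hid := IsSobolev.integral_inner_eigGrad ha ha' (Or.inl rfl) le_rfl
    (fun φ hφ i => admissible_of_mem_testFunctions hφ i) h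
  have hV1 : Integrable V μ := h.memLp.integrable one_le_two
  set m := ∫ X, V X ∂μ with hm
  have e0 : ∀ X : Space N, eig N a 0 0 X = 1 := fun X => by rw [eig_zero, Real.rpow_zero]
  have s0 : eigSum N 0 0 = 0 := by rw [eigSum_eq]; simp
  have me := fun n => memLp_eig (N := N) ha ha' (Or.inl rfl) n
  have hmean : ∀ n, n ≠ 0 → ∫ X, eig N a 0 n X ∂μ = 0 := fun n hn => by
    have := integral_eig_mul_eig_of_ne (N := N) ha ha' (Or.inl rfl) hn
    simpa only [e0, mul_one] using this
  have hV' : MemLp (fun X => V X - m) 2 μ := h.memLp.sub (memLp_const m)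
  have hsub : ∀ n, ∫ X, (V X - m) * eig N a 0 n X ∂μ
      = ∫ X, V X * eig N a 0 n X ∂μ - m * ∫ X, eig N a 0 n X ∂μ := fun n => by
    have i1 : Integrable (fun X => V X * eig N a 0 n X) μ := h.memLp.integrable_mul (me n)
    rw [← integral_const_mul, ← integral_sub i1 (((me n).integrable one_le_two).const_mul m)]
    congr 1; ext X; ring
  have hvar := integral_sub_mean_sq h.memLp
  rw [← hm] at hvar
  -- Applied to `V - m`. Subtracting the mean removes the coefficient on the constant mode and
  -- alters no other, so `Λ` can be the first positive Neumann level.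
  obtain ⟨hle, heq⟩ := poincare_of_integral_inner_eigGrad (N := N) ha ha' (Or.inl rfl) hV'
    h.grad_memLp (Λ := 1 / 2) (fun n => by
      rw [hid n, hsub n]
      by_cases hn : n = 0
      · rw [hn, s0]; ring
      · rw [hmean n hn]; ring) fun n hn => by
      have hn0 := eq_zero_of_eigSum_le (κ := 0) (n := n) (by linarith)
      rw [hsub, hn0]
      simp only [e0, mul_one]
      rw [← hm, integral_one_muHalf ha]; ring
  rw [hvar] at hle heq
  refine ⟨by linarith, fun he => ?_, ?_⟩
  · obtain ⟨c, hc⟩ := heq (by linarith) (Finset.univ.image unitIndex) fun n hn hn' => by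
      obtain ⟨j, hj⟩ := eq_unitIndex_of_eigSum hn'
      exact hn (by simp [hj])
    refine ⟨m, fun j => c (unitIndex j), ?_⟩
    filter_upwards [hc] with X hX
    rw [Finset.sum_image] at hX
    · simp only [eig_unitIndex] at hX
      linarith
    · intro i _ j _ hij
      have := congrFun hij i.castSucc
      by_contra hne
      simp [unitIndex, hne] at this
  · rintro ⟨A, b, hAb⟩
    have hG : G =ᵐ[μ] fun _ => horizontal b :=
      (IsSobolev.congr_left h hAb).grad_unique ha (isH1Half_affine ha A b)
    -- The eigenvalue identity tested with `x_j` relates the slope to the first moment, replacing a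
    -- computation of the second moments of the Gaussian.
    have hb : ∀ j, b j = 1 / 2 * ∫ X, V X * xCoord X j ∂μ := fun j => by
      have h1 := hid (unitIndex j)
      simp only [eig_unitIndex, eigGrad_unitIndex, eigSum_unitIndex] at h1
      rw [← h1, integral_congr_ae (g := fun _ => b j)]
      · rw [integral_const]; simp
      · filter_upwards [hG] with X hX
        rw [hX, EuclideanSpace.inner_single_right]
        simp [horizontal]
    have hx : ∀ j, MemLp (fun X : Space N => xCoord X j) 2 μ := fun j => memLp_coord ha _
    have hx0 : ∀ j, ∫ X, xCoord X j ∂μ = 0 := fun j => by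
      have := hmean (unitIndex j) fun h0 => by
        have := congrFun h0 j.castSucc
        simp [unitIndex] at this
      simpa only [eig_unitIndex] using this
    have hmA : m = A := by
      rw [hm, integral_congr_ae hAb, integral_add (integrable_const _)
        (integrable_finsetSum _ fun j _ => ((hx j).integrable one_le_two).const_mul _),
        integral_finsetSum _ fun j _ => ((hx j).integrable one_le_two).const_mul _]
      simp [integral_const_mul, hx0]
    have hsq : ∫ X, V X ^ 2 ∂μ = A * m + ∑ j, b j * ∫ X, V X * xCoord X j ∂μ := by
      have e : (fun X => V X ^ 2) =ᵐ[μ] fun X => A * V X + ∑ j, b j * (V X * xCoord X j) := by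
        filter_upwards [hAb] with X hX
        have : ∑ j, b j * (V X * xCoord X j) = V X * ∑ j, b j * xCoord X j := by
          rw [Finset.mul_sum]
          exact Finset.sum_congr rfl fun j _ => by ring
        rw [this, sq]
        nth_rewrite 1 [hX]
        ring
      have hi : ∀ j, Integrable (fun X => b j * (V X * xCoord X j)) μ := fun j =>
        (h.memLp.integrable_mul (hx j)).const_mul _
      rw [integral_congr_ae e, integral_add (hV1.const_mul A) (integrable_finsetSum _ fun j _ => hi j),
        integral_finsetSum _ fun j _ => hi j, integral_const_mul]
      simp only [integral_const_mul, ← hm]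
    have hE : ∫ X, ‖G X‖ ^ 2 ∂μ = ∑ j, b j ^ 2 := by
      rw [integral_congr_ae (g := fun _ => ∑ j, b j ^ 2)]
      · rw [integral_const]; simp
      · filter_upwards [hG] with X hX
        rw [hX, norm_horizontal_sq]
    rw [hsq, hE, hmA, Finset.mul_sum]
    have : ∀ j, ∫ X, V X * xCoord X j ∂μ = 2 * b j := fun j => by rw [hb j]; ring
    simp only [this]
    rw [sq, add_sub_cancel_left]
    exact Finset.sum_congr rfl fun j _ => by ring

end HalfSpace

/-! ### The whole-space measure as a symmetrisation, and transfer of integrals. -/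

section Reflection

variable {N : ℕ} {a : ℝ}

lemma volume_yCoord_eq_zero : (volume : Measure (Space N)) {X | yCoord X = 0} = 0 := by
  have h := Measure.addHaar_submodule (volume : Measure (Space N))
    (LinearMap.ker (EuclideanSpace.proj (Fin.last N) : Space N →L[ℝ] ℝ).toLinearMap) fun h => by
      have h1 : basisVec (Fin.last N) ∈ (⊤ : Submodule ℝ (Space N)) := trivial
      rw [← h, LinearMap.mem_ker] at h1
      simp at h1
  exact h

lemma map_reflY_volume_restrict :
    ((volume : Measure (Space N)).restrict (upperHalf N)).map (reflY N)
      = volume.restrict (upperHalf N)ᶜ := by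
  have h : MeasurableSet (reflY N ⁻¹' upperHalf N) := measurable_reflY measurableSet_upperHalf
  have h1 := ((reflY N).measurePreserving.restrict_preimage h).map_eq
  have h2 : reflY N ⁻¹' (reflY N ⁻¹' upperHalf N) = upperHalf N := by
    ext X; simp [reflY_reflY]
  rw [h2] at h1
  rw [h1]
  refine Measure.restrict_congr_set ?_
  have h3 : ∀ᵐ X : Space N, yCoord X ≠ 0 := measure_eq_zero_iff_ae_notMem.1 volume_yCoord_eq_zero
  filter_upwards [h3] with X hX
  refine propext ⟨fun h4 => ?_, fun h4 => ?_⟩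
  · have h4 : 0 < yCoord (reflY N X) := h4
    rw [yCoord_reflY] at h4
    exact fun h5 : 0 < yCoord X => by linarith
  · have h4 : ¬ 0 < yCoord X := h4
    show 0 < yCoord (reflY N X)
    rw [yCoord_reflY]
    have := lt_of_le_of_ne (not_lt.1 h4) hX
    linarith

lemma kernelWhole_eq (X : Space N) : kernelWhole N a X = 1 / 2 * kernelHalf N a X := by
  rw [kernelWhole, kernelHalf, Real.rpow_add two_pos, Real.rpow_one]
  ring

/-- The measure on the whole space is the symmetrisation of the measure on the half-space. -/
lemma muWhole_eq :
    muWhole N a = (2 : ENNReal)⁻¹ • (muHalf N a + (muHalf N a).map (reflY N)) := by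
  set w : Space N → ENNReal := fun X => ENNReal.ofReal (|yCoord X| ^ a * kernelHalf N a X) with hw
  have hwm : Measurable w := by
    refine ENNReal.measurable_ofReal.comp ?_
    unfold kernelHalf
    exact ((measurable_yCoord.norm.pow_const a)).mul (by fun_prop)
  have hwR : ∀ X, w (reflY N X) = w X := fun X => by
    simp only [hw, yCoord_reflY, abs_neg, kernelHalf, LinearIsometryEquiv.norm_map]
  have h1 : muHalf N a = (volume.restrict (upperHalf N)).withDensity w := by
    refine withDensity_congr_ae ?_
    filter_upwards [ae_restrict_mem measurableSet_upperHalf] with X hX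
    simp only [hw, abs_of_pos (show 0 < yCoord X from hX)]
  have h2 : (muHalf N a).map (reflY N) = (volume.restrict (upperHalf N)ᶜ).withDensity w := by
    ext s hs
    rw [Measure.map_apply measurable_reflY hs, h1, withDensity_apply _ (measurable_reflY hs),
      withDensity_apply _ hs, ← map_reflY_volume_restrict,
      setLIntegral_map hs hwm measurable_reflY]
    simp only [hwR]
  have h3 : muWhole N a = (2 : ENNReal)⁻¹ • volume.withDensity w := by
    rw [← withDensity_smul _ hwm, muWhole]
    congr 1
    ext X
    rw [kernelWhole_eq, Pi.smul_apply, smul_eq_mul, hw, mul_left_comm, ENNReal.ofReal_mul (by norm_num)]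
    congr 1
    rw [one_div, ENNReal.ofReal_inv_of_pos two_pos, ENNReal.ofReal_ofNat]
  rw [h3, h2, h1, ← withDensity_add_measure,
    Measure.restrict_add_restrict_compl measurableSet_upperHalf]

lemma isProbabilityMeasure_muWhole (ha : -1 < a) : IsProbabilityMeasure (muWhole N a) := by
  have := isProbabilityMeasure_muHalf (N := N) ha
  constructor
  rw [muWhole_eq, Measure.smul_apply, Measure.add_apply,
    Measure.map_apply measurable_reflY MeasurableSet.univ, preimage_univ, measure_univ,
    one_add_one_eq_two, smul_eq_mul, ENNReal.inv_mul_cancel two_ne_zero ENNReal.ofNat_ne_top]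

lemma measurableEmbedding_reflY : MeasurableEmbedding (reflY N) :=
  (reflY N).toHomeomorph.measurableEmbedding

lemma ae_muWhole_iff {p : Space N → Prop} :
    (∀ᵐ X ∂(muWhole N a), p X)
      ↔ (∀ᵐ X ∂(muHalf N a), p X) ∧ ∀ᵐ X ∂(muHalf N a), p (reflY N X) := by
  rw [muWhole_eq, Measure.ae_ennreal_smul_measure_iff (by simp), ae_add_measure_iff,
    measurableEmbedding_reflY.ae_map_iff]

variable {F : Type*} [NormedAddCommGroup F]

lemma aestronglyMeasurable_muWhole_iff {f : Space N → F} :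
    AEStronglyMeasurable f (muWhole N a)
      ↔ AEStronglyMeasurable f (muHalf N a) ∧ AEStronglyMeasurable (f ∘ reflY N) (muHalf N a) := by
  rw [← measurableEmbedding_reflY.aestronglyMeasurable_map_iff, muWhole_eq]
  have : AEStronglyMeasurable f ((2 : ENNReal)⁻¹ • (muHalf N a + (muHalf N a).map (reflY N)))
      ↔ AEStronglyMeasurable f (muHalf N a + (muHalf N a).map (reflY N)) :=
    ⟨fun h => h.mono_ac (Measure.absolutelyContinuous_smul (by simp)),
      fun h => h.mono_ac Measure.smul_absolutelyContinuous⟩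
  rw [this, aestronglyMeasurable_add_measure_iff]

lemma integrable_muWhole_iff {f : Space N → F} :
    Integrable f (muWhole N a)
      ↔ Integrable f (muHalf N a) ∧ Integrable (f ∘ reflY N) (muHalf N a) := by
  rw [muWhole_eq, integrable_smul_measure (by simp) (by simp), integrable_add_measure,
    measurableEmbedding_reflY.integrable_map_iff]

lemma memLp_muWhole_iff {f : Space N → F} :
    MemLp f 2 (muWhole N a) ↔ MemLp f 2 (muHalf N a) ∧ MemLp (f ∘ reflY N) 2 (muHalf N a) := by
  constructor
  · intro h
    have hm := aestronglyMeasurable_muWhole_iff.1 h.1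
    rw [memLp_two_iff_integrable_sq_norm hm.1, memLp_two_iff_integrable_sq_norm hm.2]
    rw [memLp_two_iff_integrable_sq_norm h.1] at h
    exact integrable_muWhole_iff.1 h
  · rintro ⟨h1, h2⟩
    have hm := aestronglyMeasurable_muWhole_iff.2 ⟨h1.1, h2.1⟩
    rw [memLp_two_iff_integrable_sq_norm hm]
    exact integrable_muWhole_iff.2 ⟨(memLp_two_iff_integrable_sq_norm h1.1).1 h1,
      (memLp_two_iff_integrable_sq_norm h2.1).1 h2⟩

lemma integral_muWhole {f : Space N → ℝ} (h : Integrable f (muWhole N a)) :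
    ∫ X, f X ∂(muWhole N a)
      = 1 / 2 * (∫ X, f X ∂(muHalf N a) + ∫ X, f (reflY N X) ∂(muHalf N a)) := by
  have h' := integrable_muWhole_iff.1 h
  rw [muWhole_eq, integral_smul_measure, integral_add_measure h'.1
    (measurableEmbedding_reflY.integrable_map_iff.2 h'.2), measurableEmbedding_reflY.integral_map]
  simp

end Reflection

/-! ### Even and odd parts. -/

section Parity

variable {N : ℕ} {a : ℝ} {V : Space N → ℝ} {G : Space N → Space N}
  {F : Type*} [NormedAddCommGroup F] [InnerProductSpace ℝ F]

/-- The even part (`ε = 1`) or the odd part (`ε = -1`) of `f` under the reflection of the last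
variable, acting on the values through `T`. -/
def parityPart (ε : ℝ) (T : F ≃ₗᵢ[ℝ] F) (f : Space N → F) (X : Space N) : F :=
  (1 / 2 : ℝ) • (f X + ε • T (f (reflY N X)))

variable {T : F ≃ₗᵢ[ℝ] F} {f g : Space N → F} {ε : ℝ}

lemma parityPart_sub (X : Space N) :
    parityPart ε T f X - parityPart ε T g X = parityPart ε T (fun Y => f Y - g Y) X := by
  simp only [parityPart, map_sub]; module

lemma norm_parityPart_sq (X : Space N) :
    ‖parityPart 1 T f X‖ ^ 2 + ‖parityPart (-1) T f X‖ ^ 2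
      = 1 / 2 * (‖f X‖ ^ 2 + ‖f (reflY N X)‖ ^ 2) := by
  have h := parallelogram_law_with_norm ℝ (f X) (T (f (reflY N X)))
  rw [LinearIsometryEquiv.norm_map] at h
  simp only [parityPart, one_smul, neg_smul, ← sub_eq_add_neg, norm_smul]
  norm_num
  nlinarith

lemma memLp_parityPart (h : MemLp f 2 (muWhole N a)) (ε : ℝ) (T : F ≃ₗᵢ[ℝ] F) :
    MemLp (parityPart ε T f) 2 (muHalf N a) := by
  obtain ⟨h1, h2⟩ := memLp_muWhole_iff.1 h
  have h3 : MemLp (fun X => T (f (reflY N X))) 2 (muHalf N a) :=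
    (T : F ≃L[ℝ] F).toContinuousLinearMap.comp_memLp' h2
  exact (h1.add (h3.const_smul ε)).const_smul (1 / 2 : ℝ)

/-- The parallelogram law, integrated; its factor `1/2` matches the one in `muWhole_eq`. Both the
`L²` norm and the energy decouple in this way, the latter with `T` the reflection. -/
lemma integral_norm_sq_eq_add (h : MemLp f 2 (muWhole N a)) (T : F ≃ₗᵢ[ℝ] F) :
    ∫ X, ‖f X‖ ^ 2 ∂(muWhole N a) = ∫ X, ‖parityPart 1 T f X‖ ^ 2 ∂(muHalf N a)
      + ∫ X, ‖parityPart (-1) T f X‖ ^ 2 ∂(muHalf N a) := by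
  have h' := memLp_muWhole_iff.1 h
  rw [integral_muWhole h.norm.integrable_sq,
    ← integral_add h'.1.norm.integrable_sq
      (show Integrable (fun X => ‖f (reflY N X)‖ ^ 2) _ from h'.2.norm.integrable_sq),
    ← integral_add (memLp_parityPart h 1 T).norm.integrable_sq
      (memLp_parityPart h (-1) T).norm.integrable_sq,
    ← integral_const_mul]
  simp only [norm_parityPart_sq]

lemma integral_parityPart_one (h : Integrable V (muWhole N a)) :
    ∫ X, V X ∂(muWhole N a)
      = ∫ X, parityPart 1 (LinearIsometryEquiv.refl ℝ ℝ) V X ∂(muHalf N a) := by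
  have h' := integrable_muWhole_iff.1 h
  rw [integral_muWhole h]
  simp only [parityPart, LinearIsometryEquiv.coe_refl, id, smul_eq_mul, one_mul]
  rw [integral_const_mul]
  congr 1
  exact (integral_add h'.1 h'.2).symm

lemma eq_parityPart_add (X : Space N) : f X = parityPart 1 T f X + parityPart (-1) T f X := by
  simp only [parityPart]; module

lemma map_reflY_eq_parityPart_sub (X : Space N) :
    T (f (reflY N X)) = parityPart 1 T f X - parityPart (-1) T f X := by
  simp only [parityPart]; module

lemma ae_eq_muWhole_iff (T : F ≃ₗᵢ[ℝ] F) :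
    f =ᵐ[muWhole N a] g ↔ parityPart 1 T f =ᵐ[muHalf N a] parityPart 1 T g ∧
      parityPart (-1) T f =ᵐ[muHalf N a] parityPart (-1) T g := by
  unfold Filter.EventuallyEq
  rw [ae_muWhole_iff]
  constructor
  · rintro ⟨h1, h2⟩
    constructor <;>
    · filter_upwards [h1, h2] with X h3 h4
      simp only [parityPart, h3, h4]
  · rintro ⟨h1, h2⟩
    constructor
    · filter_upwards [h1, h2] with X h3 h4
      rw [eq_parityPart_add (T := T) (f := f), h3, h4, ← eq_parityPart_add]
    · filter_upwards [h1, h2] with X h3 h4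
      apply T.injective
      rw [map_reflY_eq_parityPart_sub (f := f), h3, h4, ← map_reflY_eq_parityPart_sub]

/-- Chain rule, the reflection being its own adjoint. -/
lemma gradient_comp_reflY {φ : Space N → ℝ} (X : Space N) (h : Differentiable ℝ φ) :
    gradient (fun Y => φ (reflY N Y)) X = reflY N (gradient φ (reflY N X)) := by
  refine HasGradientAt.gradient ?_
  rw [hasGradientAt_iff_hasFDerivAt]
  have h1 := (h (reflY N X)).hasFDerivAt.comp X
    (reflY N : Space N ≃L[ℝ] Space N).toContinuousLinearMap.hasFDerivAt
  convert! h1 using 1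
  ext Y
  have h2 : inner ℝ (reflY N (gradient φ (reflY N X))) Y
      = inner ℝ (gradient φ (reflY N X)) (reflY N Y) := by
    rw [← (reflY N).inner_map_map, reflY_reflY]
  simp only [InnerProductSpace.toDual_apply_apply, h2]
  exact inner_gradient_left ..

lemma gradient_parityPart {φ : Space N → ℝ} (h : Differentiable ℝ φ) (X : Space N) :
    gradient (parityPart ε (LinearIsometryEquiv.refl ℝ ℝ) φ) X
      = parityPart ε (reflY N) (gradient φ) X := by
  have h2 : Differentiable ℝ fun Y => φ (reflY N Y) :=
    h.comp (reflY N : Space N ≃L[ℝ] Space N).differentiable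
  have h3 := gradient_comp_reflY X h
  simp only [gradient_eq_toDual_symm] at h3 ⊢
  have h4 : parityPart ε (LinearIsometryEquiv.refl ℝ ℝ) φ
      = fun Y => (1 / 2 : ℝ) • (φ Y + ε • φ (reflY N Y)) := rfl
  have h5 := (((h X).hasFDerivAt.add ((h2 X).hasFDerivAt.const_smul ε)).const_smul (1 / 2 : ℝ)).fderiv
  rw [h4]
  refine (congrArg _ h5).trans ?_
  simp only [map_smul, map_add, h3]
  rfl

lemma parityPart_mem_testFunctions {φ : Space N → ℝ} (h : φ ∈ testFunctions N) :
    parityPart ε (LinearIsometryEquiv.refl ℝ ℝ) φ ∈ testFunctions N := by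
  have h1 : ContDiff ℝ ∞ fun X => φ (reflY N X) := h.1.comp (reflY N).contDiff
  have h2 : HasCompactSupport fun X => φ (reflY N X) := h.2.comp_homeomorph (reflY N).toHomeomorph
  refine ⟨(h.1.add (h1.const_smul ε)).const_smul (1 / 2 : ℝ), ?_⟩
  exact (h.2.add (h2.smul_left (f := fun _ => ε))).smul_left (f := fun _ => (1 / 2 : ℝ))

lemma reflY_eq_self {X : Space N} (h : yCoord X = 0) : reflY N X = X := by
  ext i
  rw [reflY_apply]
  split_ifs with hi
  · subst hi
    have h : X (Fin.last N) = 0 := h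
    rw [h, neg_zero]
  · rfl

lemma parityPart_mem_testFunctionsVanishing {φ : Space N → ℝ} (h : φ ∈ testFunctions N) :
    parityPart (-1) (LinearIsometryEquiv.refl ℝ ℝ) φ ∈ testFunctionsVanishing N :=
  ⟨parityPart_mem_testFunctions h, fun X hX => by simp [parityPart, reflY_eq_self hX]⟩

/-- The parity parts of approximants approximate the parity parts: the error on the whole space is
the sum of the two nonnegative half-space errors. -/
lemma isSobolev_parityPart (ha : -1 < a) (h : IsH1Whole N a V G) {D : Set (Space N → ℝ)}
    (hε : ε = 1 ∨ ε = -1)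
    (hD : ∀ φ ∈ testFunctions N, parityPart ε (LinearIsometryEquiv.refl ℝ ℝ) φ ∈ D) :
    IsSobolev D (muHalf N a) (parityPart ε (LinearIsometryEquiv.refl ℝ ℝ) V)
      (parityPart ε (reflY N) G) := by
  have := isProbabilityMeasure_muWhole (N := N) ha
  refine ⟨memLp_parityPart h.memLp ε _, memLp_parityPart h.grad_memLp ε _, fun δ hδ => ?_⟩
  obtain ⟨φ, hφ, hlt⟩ := h.approx δ hδ
  obtain ⟨m1, m2⟩ := memLp_of_mem_testFunctions hφ (muWhole N a)
  refine ⟨_, hD φ hφ, lt_of_le_of_lt ?_ hlt⟩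
  simp only [gradient_parityPart (hφ.1.differentiable (by simp)), parityPart_sub]
  have i1 := integral_norm_sq_eq_add (h.memLp.sub m1) (LinearIsometryEquiv.refl ℝ ℝ)
  have i2 := integral_norm_sq_eq_add (h.grad_memLp.sub m2) (reflY N)
  simp only [Real.norm_eq_abs, sq_abs, Pi.sub_apply] at i1 i2
  have n1 : ∀ η : ℝ, 0 ≤ ∫ X, parityPart η (LinearIsometryEquiv.refl ℝ ℝ)
      (V - φ) X ^ 2 ∂(muHalf N a) := fun η => integral_nonneg fun X => sq_nonneg _
  have n2 : ∀ η : ℝ, 0 ≤ ∫ X, ‖parityPart η (reflY N)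
      (G - gradient φ) X‖ ^ 2 ∂(muHalf N a) := fun η => integral_nonneg fun X => sq_nonneg _
  rw [i1, i2]
  have a1 := n1 1
  have a2 := n1 (-1)
  have a3 := n2 1
  have a4 := n2 (-1)
  rcases hε with rfl | rfl
  · change (∫ X, parityPart 1 (LinearIsometryEquiv.refl ℝ ℝ) (V - φ) X ^ 2 ∂(muHalf N a))
      + (∫ X, ‖parityPart 1 (reflY N) (G - gradient φ) X‖ ^ 2 ∂(muHalf N a)) ≤ _
    linarith
  · change (∫ X, parityPart (-1) (LinearIsometryEquiv.refl ℝ ℝ) (V - φ) X ^ 2 ∂(muHalf N a))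
      + (∫ X, ‖parityPart (-1) (reflY N) (G - gradient φ) X‖ ^ 2 ∂(muHalf N a)) ≤ _
    linarith

end Parity

/-! ### The sharp inequality on the whole space. -/

section Whole

variable {N : ℕ} {a : ℝ} {V : Space N → ℝ} {G : Space N → Space N} {μ : Measure (Space N)}

lemma IsSobolev.congr_right {D : Set (Space N → ℝ)} {H : Space N → Space N}
    (h : IsSobolev D μ V G) (hGH : G =ᵐ[μ] H) : IsSobolev D μ V H := by
  refine ⟨h.memLp, h.grad_memLp.ae_eq hGH, fun ε hε => ?_⟩
  obtain ⟨φ, hφ, hlt⟩ := h.approx ε hε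
  refine ⟨φ, hφ, ?_⟩
  rwa [integral_congr_ae (f := fun X => ‖H X - gradient φ X‖ ^ 2)
    (g := fun X => ‖G X - gradient φ X‖ ^ 2)]
  filter_upwards [hGH] with X hX
  rw [hX]

lemma integral_norm_add_sq_le {F : Type*} [NormedAddCommGroup F] {f g : Space N → F}
    (hf : MemLp f 2 μ) (hg : MemLp g 2 μ) :
    ∫ X, ‖f X + g X‖ ^ 2 ∂μ ≤ 2 * ∫ X, ‖f X‖ ^ 2 ∂μ + 2 * ∫ X, ‖g X‖ ^ 2 ∂μ := by
  have := integral_norm_sub_sq_le hf (MemLp.zero (p := 2) (μ := μ) : MemLp (0 : Space N → F) 2 μ) hg.neg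
  simpa using this

lemma isSobolev_add [IsFiniteMeasure μ] {V' : Space N → ℝ} {G' : Space N → Space N}
    (h : IsSobolev (testFunctions N) μ V G) (h' : IsSobolev (testFunctions N) μ V' G') :
    IsSobolev (testFunctions N) μ (fun X => V X + V' X) (fun X => G X + G' X) := by
  refine ⟨h.memLp.add h'.memLp, h.grad_memLp.add h'.grad_memLp, fun ε hε => ?_⟩
  obtain ⟨φ, hφ, hlt⟩ := h.approx (ε / 4) (by positivity)
  obtain ⟨ψ, hψ, hlt'⟩ := h'.approx (ε / 4) (by positivity)
  obtain ⟨m1, m2⟩ := memLp_of_mem_testFunctions hφ μ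
  obtain ⟨n1, n2⟩ := memLp_of_mem_testFunctions hψ μ
  refine ⟨fun X => φ X + ψ X, ⟨hφ.1.add hψ.1, hφ.2.add hψ.2⟩, ?_⟩
  have hg : ∀ X, gradient (fun Y => φ Y + ψ Y) X = gradient φ X + gradient ψ X := fun X => by
    simp only [gradient_eq_toDual_symm]
    rw [fderiv_fun_add (hφ.1.differentiable (by simp) X) (hψ.1.differentiable (by simp) X), map_add]
  have e1 := integral_norm_add_sq_le (h.memLp.sub m1) (h'.memLp.sub n1)
  have e2 := integral_norm_add_sq_le (h.grad_memLp.sub m2) (h'.grad_memLp.sub n2)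
  simp only [Pi.sub_apply, Real.norm_eq_abs, sq_abs, sub_add_sub_comm] at e1 e2
  simp only [hg]
  linarith

lemma integral_norm_sq_muWhole_of_symm {F : Type*} [NormedAddCommGroup F] {f : Space N → F}
    (h : MemLp f 2 (muWhole N a)) (hf : ∀ X, ‖f (reflY N X)‖ = ‖f X‖) :
    ∫ X, ‖f X‖ ^ 2 ∂(muWhole N a) = ∫ X, ‖f X‖ ^ 2 ∂(muHalf N a) := by
  rw [integral_muWhole h.norm.integrable_sq]
  simp only [hf]; ring

lemma gradient_eq_zero_of_notMem_upperHalf {φ : Space N → ℝ} (hφ : φ ∈ testFunctionsHalf N)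
    {X : Space N} (hX : ¬ 0 < yCoord X) : φ X = 0 ∧ gradient φ X = 0 := by
  have h1 : X ∉ tsupport φ := fun h => hX (hφ.2.2 h)
  have h2 : φ =ᶠ[𝓝 X] fun _ => 0 := notMem_tsupport_iff_eventuallyEq.1 h1
  refine ⟨h2.eq_of_nhds, ?_⟩
  rw [h2.gradient.eq_of_nhds]; simp

/-- An odd function whose restriction to the half-space is in `H^1_0` is in `H^1`. -/
lemma isH1Whole_of_odd (ha : -1 < a) (h : IsH1ZeroHalf N a V G)
    (hV : ∀ X, V (reflY N X) = -V X) (hG : ∀ X, G (reflY N X) = -reflY N (G X)) :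
    IsH1Whole N a V G := by
  have := isProbabilityMeasure_muWhole (N := N) ha
  have mV : MemLp V 2 (muWhole N a) := by
    refine memLp_muWhole_iff.2 ⟨h.memLp, ?_⟩
    have : V ∘ reflY N = -V := funext hV
    rw [this]; exact h.memLp.neg
  have mG : MemLp G 2 (muWhole N a) := by
    refine memLp_muWhole_iff.2 ⟨h.grad_memLp, ?_⟩
    have : G ∘ reflY N = -fun X => reflY N (G X) := funext hG
    rw [this]
    exact ((reflY N : Space N ≃L[ℝ] Space N).toContinuousLinearMap.comp_memLp' h.grad_memLp).neg
  refine ⟨mV, mG, fun ε hε => ?_⟩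
  obtain ⟨φ, hφ, hlt⟩ := h.approx ε hε
  have hφt : φ ∈ testFunctions N := ⟨hφ.1, hφ.2.1⟩
  have hd : Differentiable ℝ φ := hφ.1.differentiable (by simp)
  -- The odd extension of the approximant; it is smooth because `φ` is supported inside the open
  -- half-space.
  have hψ : (fun X => φ X - φ (reflY N X)) ∈ testFunctions N :=
    ⟨hφ.1.sub (hφ.1.comp (reflY N).contDiff),
      hφ.2.1.sub (hφ.2.1.comp_homeomorph (reflY N).toHomeomorph)⟩
  have hg : ∀ X, gradient (fun Y => φ Y - φ (reflY N Y)) X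
      = gradient φ X - reflY N (gradient φ (reflY N X)) := fun X => by
    have h2 : Differentiable ℝ fun Y => φ (reflY N Y) :=
      hd.comp (reflY N : Space N ≃L[ℝ] Space N).differentiable
    rw [← gradient_comp_reflY X hd]
    simp only [gradient_eq_toDual_symm]
    rw [fderiv_fun_sub (hd X) (h2 X), map_sub]
  obtain ⟨m1, m2⟩ := memLp_of_mem_testFunctions hψ (muWhole N a)
  refine ⟨_, hψ, lt_of_eq_of_lt ?_ hlt⟩
  -- The norm of the error is symmetric, so its integral equals that on the half-space, where the
  -- reflected copy of `φ` is zero.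
  have e1 := integral_norm_sq_muWhole_of_symm (mV.sub m1) fun X => by
    simp only [Pi.sub_apply, hV, reflY_reflY]
    rw [← norm_neg]; congr 1; ring
  have e2 := integral_norm_sq_muWhole_of_symm (mG.sub m2) fun X => by
    simp only [Pi.sub_apply, hG, reflY_reflY, hg]
    rw [← (reflY N).norm_map (G X - _), ← norm_neg]
    simp only [map_sub, reflY_reflY]
    congr 1; abel
  simp only [Pi.sub_apply, Real.norm_eq_abs, sq_abs] at e1 e2
  rw [e1, e2]
  have hz : ∀ X : Space N, 0 < yCoord X →
      φ (reflY N X) = 0 ∧ gradient φ (reflY N X) = 0 := fun X hX =>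
    gradient_eq_zero_of_notMem_upperHalf hφ (by rw [yCoord_reflY]; linarith)
  congr 1 <;> refine integral_congr_ae ?_ <;> filter_upwards [ae_yCoord_pos] with X hX
  · rw [(hz X hX).1, sub_zero]
  · rw [hg, (hz X hX).2, map_zero, sub_zero]

/-- All the functions that occur as extremals on the whole space. -/
def extremal (N : ℕ) (a A : ℝ) (b : Fin N → ℝ) (B : ℝ) (X : Space N) : ℝ :=
  A + ∑ j, b j * xCoord X j + B * (yCoord X * |yCoord X| ^ (-a))

/-- The gradient of `extremal N a A b B`. -/
def extremalGrad (N : ℕ) (a : ℝ) (b : Fin N → ℝ) (B : ℝ) (X : Space N) : Space N :=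
  horizontal b + ((B * (1 - a)) * |yCoord X| ^ (-a)) • basisVec (Fin.last N)

lemma mul_abs_rpow_neg {y : ℝ} (hy : 0 < y) : y * |y| ^ (-a) = y ^ (1 - a) := by
  rw [abs_of_pos hy, sub_eq_add_neg, Real.rpow_add hy, Real.rpow_one]

lemma mem_extremalsWhole_iff {W : Space N → ℝ} : W ∈ extremalsWhole N a ↔
    ∃ A b B, (0 < a → b = 0) ∧ (a < 0 → B = 0) ∧ W = extremal N a A b B := by
  constructor
  · rintro (⟨ha, A, b, rfl⟩ | ⟨rfl, A, b, rfl⟩ | ⟨ha, A, B, rfl⟩)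
    · exact ⟨A, b, 0, fun h => absurd h ha.not_gt, fun _ => rfl, by ext X; simp [extremal]⟩
    · refine ⟨A, fun j => b j.castSucc, b (Fin.last N), fun h => absurd h (lt_irrefl _),
        fun h => absurd h (lt_irrefl _), ?_⟩
      ext X
      simp [extremal, Fin.sum_univ_castSucc, xCoord, yCoord, add_assoc]
    · exact ⟨A, 0, B, fun _ => rfl, fun h => absurd h ha.not_gt, by ext X; simp [extremal]⟩
  · rintro ⟨A, b, B, hb, hB, rfl⟩
    rcases lt_trichotomy a 0 with ha | rfl | ha
    · exact Or.inl ⟨ha, A, b, by ext X; simp [extremal, hB ha]⟩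
    · refine Or.inr (Or.inl ⟨rfl, A, Fin.snoc b B, ?_⟩)
      ext X
      simp [extremal, Fin.sum_univ_castSucc, xCoord, yCoord, add_assoc]
    · exact Or.inr (Or.inr ⟨ha, A, B, by ext X; simp [extremal, hb ha]⟩)

lemma reflY_basisVec_last : reflY N (basisVec (Fin.last N)) = -basisVec (Fin.last N) := by
  ext i
  rw [reflY_apply]
  by_cases h : i = Fin.last N <;> simp [h]

/-- The affine part is smooth with finite norm. The remaining part is odd and equals `B y^{1-a}` for
`y > 0`, so it is obtained by odd reflection from `H^1_0`. -/
lemma isH1Whole_extremal (ha : -1 < a) (ha' : a < 1) (A : ℝ) (b : Fin N → ℝ) (B : ℝ) :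
    IsH1Whole N a (extremal N a A b B) (extremalGrad N a b B) := by
  have := isProbabilityMeasure_muWhole (N := N) ha
  have h1 : IsSobolev (testFunctions N) (muWhole N a)
      (fun X => A + inner ℝ (horizontal b) X) fun _ => horizontal b := by
    refine isSobolev_affine (fun i => memLp_muWhole_iff.2 ⟨memLp_coord ha i, ?_⟩) A _
    by_cases hi : i = Fin.last N
    · refine (memLp_coord ha i).neg.congr_norm ?_ ?_
      · exact ((measurable_coord i).comp measurable_reflY).aestronglyMeasurable
      · exact ae_of_all _ fun X => by simp [reflY_apply, hi]
    · refine (memLp_coord ha i).congr_norm ?_ ?_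
      · exact ((measurable_coord i).comp measurable_reflY).aestronglyMeasurable
      · exact ae_of_all _ fun X => by simp [reflY_apply, hi]
  have h2 := isH1ZeroHalf_rpow (N := N) ha ha' B
  have h3 : IsH1ZeroHalf N a (fun X => B * (yCoord X * |yCoord X| ^ (-a)))
      fun X => ((B * (1 - a)) * |yCoord X| ^ (-a)) • basisVec (Fin.last N) := by
    refine (IsSobolev.congr_left h2 ?_).congr_right ?_
    · filter_upwards [ae_yCoord_pos] with X hX
      rw [mul_abs_rpow_neg hX]
    · filter_upwards [ae_yCoord_pos] with X hX
      rw [abs_of_pos hX]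
  have h4 := isH1Whole_of_odd ha h3 (fun X => by rw [yCoord_reflY, abs_neg]; ring)
    fun X => by rw [yCoord_reflY, abs_neg, map_smul, reflY_basisVec_last, smul_neg, neg_neg]
  have h5 := isSobolev_add h1 h4
  simp only [inner_horizontal] at h5
  exact h5

lemma ae_eq_extremal_iff {A : ℝ} {b : Fin N → ℝ} {B : ℝ} :
    V =ᵐ[muWhole N a] extremal N a A b B ↔
      (parityPart 1 (LinearIsometryEquiv.refl ℝ ℝ) V =ᵐ[muHalf N a]
        fun X => A + ∑ j, b j * xCoord X j) ∧
      parityPart (-1) (LinearIsometryEquiv.refl ℝ ℝ) V =ᵐ[muHalf N a]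
        fun X => B * yCoord X ^ (1 - a) := by
  have hx : ∀ (X : Space N) (j : Fin N), xCoord (reflY N X) j = xCoord X j := fun X j => by
    rw [xCoord, reflY_apply, if_neg (Fin.castSucc_lt_last j).ne, xCoord]
  have h1 : parityPart 1 (LinearIsometryEquiv.refl ℝ ℝ) (extremal N a A b B)
      = fun X => A + ∑ j, b j * xCoord X j := by
    ext X
    simp only [parityPart, extremal, hx, yCoord_reflY, abs_neg, LinearIsometryEquiv.coe_refl, id,
      smul_eq_mul]
    ring
  have h2 : parityPart (-1) (LinearIsometryEquiv.refl ℝ ℝ) (extremal N a A b B)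
      =ᵐ[muHalf N a] fun X => B * yCoord X ^ (1 - a) := by
    filter_upwards [ae_yCoord_pos] with X hX
    rw [← mul_abs_rpow_neg hX]
    simp only [parityPart, extremal, hx, yCoord_reflY, abs_neg, LinearIsometryEquiv.coe_refl, id,
      smul_eq_mul]
    ring
  rw [ae_eq_muWhole_iff (LinearIsometryEquiv.refl ℝ ℝ), h1]
  exact and_congr_right fun _ => ⟨fun h => h.trans h2, fun h => h.trans h2.symm⟩

lemma ae_eq_zero_of_integral_norm_sq {α F : Type*} [MeasurableSpace α] {ν : Measure α}
    [NormedAddCommGroup F] {f : α → F} (hf : MemLp f 2 ν) (h : ∫ x, ‖f x‖ ^ 2 ∂ν = 0) :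
    f =ᵐ[ν] 0 := by
  rw [integral_eq_zero_iff_of_nonneg (fun x => by positivity) hf.norm.integrable_sq] at h
  filter_upwards [h] with x hx
  simpa using hx

/-- The inequality on the whole space. -/
lemma poincare_whole (ha : -1 < a) (ha' : a < 1) (h : IsH1Whole N a V G) :
    (∫ X, V X ^ 2 ∂(muWhole N a)) - (∫ X, V X ∂(muWhole N a)) ^ 2
        ≤ 2 / min 1 (1 - a) * ∫ X, ‖G X‖ ^ 2 ∂(muWhole N a) ∧
      ((∫ X, V X ^ 2 ∂(muWhole N a)) - (∫ X, V X ∂(muWhole N a)) ^ 2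
          = 2 / min 1 (1 - a) * ∫ X, ‖G X‖ ^ 2 ∂(muWhole N a) ↔
        ∃ W ∈ extremalsWhole N a, V =ᵐ[muWhole N a] W) := by
  have := isProbabilityMeasure_muWhole (N := N) ha
  have := isProbabilityMeasure_muHalf (N := N) ha
  have ha1 : 0 < 1 - a := by linarith
  have he := isSobolev_parityPart ha h (Or.inl rfl) fun φ hφ => parityPart_mem_testFunctions hφ
  have ho := isSobolev_parityPart ha h (Or.inr rfl) fun φ hφ =>
    parityPart_mem_testFunctionsVanishing hφ
  have hV2 := integral_norm_sq_eq_add h.memLp (LinearIsometryEquiv.refl ℝ ℝ)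
  have hG2 := integral_norm_sq_eq_add h.grad_memLp (reflY N)
  simp only [Real.norm_eq_abs, sq_abs] at hV2
  have hex : (∃ W ∈ extremalsWhole N a, V =ᵐ[muWhole N a] W) ↔
      ∃ A b B, (0 < a → b = 0) ∧ (a < 0 → B = 0) ∧ V =ᵐ[muWhole N a] extremal N a A b B := by
    constructor
    · rintro ⟨W, hW, hVW⟩
      obtain ⟨A, b, B, hb, hB, rfl⟩ := mem_extremalsWhole_iff.1 hW
      exact ⟨A, b, B, hb, hB, hVW⟩
    · rintro ⟨A, b, B, hb, hB, hVW⟩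
      exact ⟨_, mem_extremalsWhole_iff.2 ⟨A, b, B, hb, hB, rfl⟩, hVW⟩
  rw [hex, hV2, hG2, integral_parityPart_one (h.memLp.integrable one_le_two)]
  simp only [ae_eq_extremal_iff]
  set Ve := parityPart 1 (LinearIsometryEquiv.refl ℝ ℝ) V
  set Vo := parityPart (-1) (LinearIsometryEquiv.refl ℝ ℝ) V
  set Ge := parityPart 1 (reflY N) G
  set Go := parityPart (-1) (reflY N) G
  obtain ⟨hle, heq⟩ := poincare_half ha ha' he
  obtain ⟨hlo, hoq⟩ := poincare_vanishing ha ha' ho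
  have hvar := integral_sub_mean_sq he.memLp
  have hE0 : 0 ≤ ∫ X, ‖Ge X‖ ^ 2 ∂(muHalf N a) := integral_nonneg fun X => sq_nonneg _
  have hO0 : 0 ≤ ∫ X, ‖Go X‖ ^ 2 ∂(muHalf N a) := integral_nonneg fun X => sq_nonneg _
  have hQ0 : 0 ≤ ∫ X, Vo X ^ 2 ∂(muHalf N a) := integral_nonneg fun X => sq_nonneg _
  have hP0 : 0 ≤ ∫ X, (Ve X - ∫ Z, Ve Z ∂(muHalf N a)) ^ 2 ∂(muHalf N a) :=
    integral_nonneg fun X => sq_nonneg _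
  have hVo : ∫ X, Vo X ^ 2 ∂(muHalf N a) = 0 → Vo =ᵐ[muHalf N a] 0 := fun h0 =>
    ae_eq_zero_of_integral_norm_sq ho.memLp (by simpa using h0)
  have hVe : ∫ X, (Ve X - ∫ Z, Ve Z ∂(muHalf N a)) ^ 2 ∂(muHalf N a) = 0 →
      Ve =ᵐ[muHalf N a] fun _ => ∫ Z, Ve Z ∂(muHalf N a) := fun h0 => by
    have := ae_eq_zero_of_integral_norm_sq (he.memLp.sub (memLp_const (∫ Z, Ve Z ∂(muHalf N a))))
      (by simpa using h0)
    filter_upwards [this] with X hX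
    simpa [sub_eq_zero] using hX
  have hVe' : ∀ A : ℝ, Ve =ᵐ[muHalf N a] (fun _ => A) →
      ∫ X, (Ve X - ∫ Z, Ve Z ∂(muHalf N a)) ^ 2 ∂(muHalf N a) = 0 := fun A hA => by
    have hm : ∫ Z, Ve Z ∂(muHalf N a) = A := by rw [integral_congr_ae hA]; simp
    rw [hm, integral_congr_ae (g := fun _ => (0 : ℝ))]
    · simp
    · filter_upwards [hA] with X hX
      rw [hX]; simp
  have hVo' : Vo =ᵐ[muHalf N a] (fun _ => (0 : ℝ)) → ∫ X, Vo X ^ 2 ∂(muHalf N a) = 0 := fun h0 => by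
    rw [integral_congr_ae (g := fun _ => (0 : ℝ))]
    · simp
    · filter_upwards [h0] with X hX
      rw [hX]; simp
  rw [hvar] at hVe hP0 hVe'
  set P := ∫ X, Ve X ^ 2 ∂(muHalf N a) - (∫ Z, Ve Z ∂(muHalf N a)) ^ 2 with hP
  set Q := ∫ X, Vo X ^ 2 ∂(muHalf N a)
  set Ee := ∫ X, ‖Ge X‖ ^ 2 ∂(muHalf N a)
  set Eo := ∫ X, ‖Go X‖ ^ 2 ∂(muHalf N a)
  have hPQ : ∫ X, Ve X ^ 2 ∂(muHalf N a) + Q - (∫ Z, Ve Z ∂(muHalf N a)) ^ 2 = P + Q := by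
    rw [hP]; ring
  rw [hPQ]
  -- The even part has constant `2` and the odd part `2/(1 - a)`. For `a ≠ 0` the smaller constant
  -- leaves slack, so in the equality case the corresponding part has zero energy; for `a = 0` both
  -- parts may be extremal.
  rcases lt_trichotomy a 0 with h0 | h0 | h0
  · rw [min_eq_left (by linarith), div_one]
    have hc : 2 / (1 - a) < 2 := by rw [div_lt_iff₀ ha1]; linarith
    have hcE : 2 / (1 - a) * Eo ≤ 2 * Eo := mul_le_mul_of_nonneg_right hc.le hO0
    refine ⟨by linarith, fun hEq => ?_, ?_⟩
    · have h1 : Eo = 0 := by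
        by_contra hne
        have : 2 / (1 - a) * Eo < 2 * Eo :=
          mul_lt_mul_of_pos_right hc (lt_of_le_of_ne hO0 (Ne.symm hne))
        linarith
      rw [h1] at hlo hEq
      obtain ⟨A, b, hAb⟩ := heq.1 (by linarith)
      refine ⟨A, b, 0, fun h2 => absurd h2 h0.not_gt, fun _ => rfl, hAb, ?_⟩
      filter_upwards [hVo (by linarith)] with X hX
      rw [hX]; simp
    · rintro ⟨A, b, B, -, hB, h1, h2⟩
      rw [hB h0] at h2
      have h3 := heq.2 ⟨A, b, h1⟩
      have h4 := hoq.2 ⟨0, h2⟩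
      have h5 := hVo' (h2.trans (ae_of_all _ fun X => by simp))
      have h6 : Eo = 0 := by
        rw [h5] at h4
        rcases mul_eq_zero.1 h4.symm with h7 | h7
        · exact absurd h7 (by positivity)
        · exact h7
      rw [h3, h5, h6]; ring
  · subst h0
    simp only [sub_zero, min_self, div_one] at hlo hoq ⊢
    refine ⟨by linarith, fun hEq => ?_, ?_⟩
    · obtain ⟨A, b, hAb⟩ := heq.1 (by linarith)
      obtain ⟨B, hB⟩ := hoq.1 (by linarith)
      exact ⟨A, b, B, fun h => absurd h (lt_irrefl _), fun h => absurd h (lt_irrefl _), hAb, hB⟩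
    · rintro ⟨A, b, B, -, -, h1, h2⟩
      rw [heq.2 ⟨A, b, h1⟩, hoq.2 ⟨B, h2⟩]; ring
  · rw [min_eq_right (by linarith)]
    have hc : 2 < 2 / (1 - a) := by rw [lt_div_iff₀ ha1]; linarith
    have hcE : 2 * Ee ≤ 2 / (1 - a) * Ee := mul_le_mul_of_nonneg_right hc.le hE0
    rw [mul_add]
    refine ⟨by linarith, fun hEq => ?_, ?_⟩
    · have h1 : Ee = 0 := by
        by_contra hne
        have : 2 * Ee < 2 / (1 - a) * Ee :=
          mul_lt_mul_of_pos_right hc (lt_of_le_of_ne hE0 (Ne.symm hne))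
        linarith
      rw [h1] at hle hEq
      obtain ⟨B, hB⟩ := hoq.1 (by linarith)
      refine ⟨∫ Z, Ve Z ∂(muHalf N a), 0, B, fun _ => rfl, fun h2 => absurd h2 h0.not_gt, ?_, hB⟩
      filter_upwards [hVe (by linarith)] with X hX
      rw [hX]; simp
    · rintro ⟨A, b, B, hb, -, h1, h2⟩
      rw [hb h0] at h1
      have h3 := heq.2 ⟨A, 0, h1⟩
      have h4 := hVe' A (h1.trans (ae_of_all _ fun X => by simp))
      have h5 : Ee = 0 := by linarith
      rw [h4, h5, hoq.2 ⟨B, h2⟩]; ring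

end Whole

/-! ### Extremals of positive energy. -/

section Optimality

variable {N : ℕ} {a : ℝ}

lemma integral_norm_sq_pos {α F : Type*} [MeasurableSpace α] {ν : Measure α}
    [IsProbabilityMeasure ν] [NormedAddCommGroup F] {f : α → F} (hf : MemLp f 2 ν)
    (h : ∀ᵐ x ∂ν, f x ≠ 0) : 0 < ∫ x, ‖f x‖ ^ 2 ∂ν := by
  refine lt_of_le_of_ne (integral_nonneg fun x => sq_nonneg _) fun h0 => ?_
  obtain ⟨x, hx, hx'⟩ := ((ae_eq_zero_of_integral_norm_sq hf h0.symm).and h).exists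
  exact hx' hx

lemma horizontal_single_ne_zero (j : Fin N) : horizontal (Pi.single j (1 : ℝ)) ≠ 0 := fun h => by
  have := norm_horizontal_sq (Pi.single j (1 : ℝ))
  rw [h, Finset.sum_eq_single j (fun i _ hi => by simp [hi]) (by simp)] at this
  simp at this

lemma smul_basisVec_ne_zero (ha' : a < 1) {y : ℝ} (hy : 0 < y) :
    ((1 * (1 - a)) * y ^ (-a)) • basisVec (Fin.last N) ≠ 0 := by
  have h1 : (1 * (1 - a)) * y ^ (-a) ≠ 0 :=
    mul_ne_zero (by linarith) (Real.rpow_pos_of_pos hy _).ne'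
  refine smul_ne_zero h1 fun h => ?_
  have := congrArg (fun X : Space N => X (Fin.last N)) h
  simp at this

/-- A nonconstant extremal is needed, since constants carry no information about the constant in the
inequality: `x_1` serves for `a ≤ 0`, and `y|y|^{-a}` for `a > 0`. -/
lemma exists_extremalsWhole (hN : 1 ≤ N) (ha : -1 < a) (ha' : a < 1) :
    ∃ W ∈ extremalsWhole N a, ∃ G, IsH1Whole N a W G ∧ 0 < ∫ X, ‖G X‖ ^ 2 ∂(muWhole N a) := by
  have := isProbabilityMeasure_muWhole (N := N) ha
  rcases le_or_gt a 0 with h0 | h0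
  · have h := isH1Whole_extremal (N := N) ha ha' 0 (Pi.single ⟨0, hN⟩ 1) 0
    refine ⟨_, mem_extremalsWhole_iff.2 ⟨0, _, 0, fun h => absurd h h0.not_gt, fun _ => rfl, rfl⟩,
      _, h, integral_norm_sq_pos h.grad_memLp (ae_of_all _ fun X => ?_)⟩
    simpa [extremalGrad] using horizontal_single_ne_zero (N := N) ⟨0, hN⟩
  · have h := isH1Whole_extremal (N := N) ha ha' 0 0 1
    refine ⟨_, mem_extremalsWhole_iff.2 ⟨0, 0, 1, fun _ => rfl, fun h => absurd h h0.not_gt, rfl⟩,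
      _, h, integral_norm_sq_pos h.grad_memLp ?_⟩
    have hz : horizontal (0 : Fin N → ℝ) = 0 := by
      rw [← norm_eq_zero, ← sq_eq_zero_iff, norm_horizontal_sq]; simp
    rw [ae_muWhole_iff]
    constructor <;>
    · filter_upwards [ae_yCoord_pos] with X hX
      simp only [extremalGrad, hz, zero_add, yCoord_reflY, abs_neg]
      rw [abs_of_pos hX]
      exact smul_basisVec_ne_zero ha' hX

end Optimality

end Auxiliary

end

/-- Gaussian-Poincaré inequalities with optimal constants for `|y|^a 𝒢_a dX`. In each of the three
parts: the inequality together with the description of the equality case, then the fact that all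
the listed extremal functions belong to the space, then the optimality of the constant. -/
theorem mainTheorem8 (N : ℕ) (hN : 1 ≤ N) (a : ℝ) (ha : -1 < a) (ha' : a < 1) :
    -- (i) the whole space
    ((∀ (V : Space N → ℝ) (G : Space N → Space N), IsH1Whole N a V G →
        (∫ X, V X ^ 2 ∂(muWhole N a)) - (∫ X, V X ∂(muWhole N a)) ^ 2
            ≤ 2 / min 1 (1 - a) * ∫ X, ‖G X‖ ^ 2 ∂(muWhole N a) ∧
        ((∫ X, V X ^ 2 ∂(muWhole N a)) - (∫ X, V X ∂(muWhole N a)) ^ 2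
            = 2 / min 1 (1 - a) * ∫ X, ‖G X‖ ^ 2 ∂(muWhole N a) ↔
          ∃ W ∈ extremalsWhole N a, V =ᵐ[muWhole N a] W)) ∧
      (∀ W ∈ extremalsWhole N a, ∃ G, IsH1Whole N a W G) ∧
      (∀ C : ℝ, (∀ V G, IsH1Whole N a V G →
          (∫ X, V X ^ 2 ∂(muWhole N a)) - (∫ X, V X ∂(muWhole N a)) ^ 2
            ≤ C * ∫ X, ‖G X‖ ^ 2 ∂(muWhole N a)) → 2 / min 1 (1 - a) ≤ C)) ∧
    -- (ii) the half-space, zero boundary values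
    ((∀ (V : Space N → ℝ) (G : Space N → Space N), IsH1ZeroHalf N a V G →
        ∫ X, V X ^ 2 ∂(muHalf N a) ≤ 2 / (1 - a) * ∫ X, ‖G X‖ ^ 2 ∂(muHalf N a) ∧
        (∫ X, V X ^ 2 ∂(muHalf N a) = 2 / (1 - a) * ∫ X, ‖G X‖ ^ 2 ∂(muHalf N a) ↔
          ∃ W ∈ extremalsZeroHalf N a, V =ᵐ[muHalf N a] W)) ∧
      (∀ W ∈ extremalsZeroHalf N a, ∃ G, IsH1ZeroHalf N a W G) ∧
      (∀ C : ℝ, (∀ V G, IsH1ZeroHalf N a V G →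
          ∫ X, V X ^ 2 ∂(muHalf N a) ≤ C * ∫ X, ‖G X‖ ^ 2 ∂(muHalf N a)) →
        2 / (1 - a) ≤ C)) ∧
    -- (iii) the half-space
    ((∀ (V : Space N → ℝ) (G : Space N → Space N), IsH1Half N a V G →
        (∫ X, V X ^ 2 ∂(muHalf N a)) - (∫ X, V X ∂(muHalf N a)) ^ 2
            ≤ 2 * ∫ X, ‖G X‖ ^ 2 ∂(muHalf N a) ∧
        ((∫ X, V X ^ 2 ∂(muHalf N a)) - (∫ X, V X ∂(muHalf N a)) ^ 2
            = 2 * ∫ X, ‖G X‖ ^ 2 ∂(muHalf N a) ↔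
          ∃ W ∈ extremalsHalf N, V =ᵐ[muHalf N a] W)) ∧
      (∀ W ∈ extremalsHalf N, ∃ G, IsH1Half N a W G) ∧
      (∀ C : ℝ, (∀ V G, IsH1Half N a V G →
          (∫ X, V X ^ 2 ∂(muHalf N a)) - (∫ X, V X ∂(muHalf N a)) ^ 2
            ≤ C * ∫ X, ‖G X‖ ^ 2 ∂(muHalf N a)) → 2 ≤ C)) := by
  have := isProbabilityMeasure_muWhole (N := N) ha
  have := isProbabilityMeasure_muHalf (N := N) ha
  have hzero : ∀ V G, IsH1ZeroHalf N a V G →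
      ∫ X, V X ^ 2 ∂(muHalf N a) ≤ 2 / (1 - a) * ∫ X, ‖G X‖ ^ 2 ∂(muHalf N a) ∧
      (∫ X, V X ^ 2 ∂(muHalf N a) = 2 / (1 - a) * ∫ X, ‖G X‖ ^ 2 ∂(muHalf N a) ↔
        ∃ W ∈ extremalsZeroHalf N a, V =ᵐ[muHalf N a] W) := fun V G h => by
    refine ⟨(poincare_vanishing ha ha' (h.mono testFunctionsHalf_subset)).1, ?_⟩
    rw [(poincare_vanishing ha ha' (h.mono testFunctionsHalf_subset)).2]
    exact ⟨fun ⟨A, hA⟩ => ⟨_, ⟨A, rfl⟩, hA⟩, fun ⟨_, ⟨A, hW⟩, hA⟩ => ⟨A, hW ▸ hA⟩⟩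
  have hhalf : ∀ V G, IsH1Half N a V G →
      (∫ X, V X ^ 2 ∂(muHalf N a)) - (∫ X, V X ∂(muHalf N a)) ^ 2
          ≤ 2 * ∫ X, ‖G X‖ ^ 2 ∂(muHalf N a) ∧
      ((∫ X, V X ^ 2 ∂(muHalf N a)) - (∫ X, V X ∂(muHalf N a)) ^ 2
          = 2 * ∫ X, ‖G X‖ ^ 2 ∂(muHalf N a) ↔
        ∃ W ∈ extremalsHalf N, V =ᵐ[muHalf N a] W) := fun V G h => by
    refine ⟨(poincare_half ha ha' h).1, ?_⟩
    rw [(poincare_half ha ha' h).2]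
    exact ⟨fun ⟨A, b, hA⟩ => ⟨_, ⟨A, b, rfl⟩, hA⟩, fun ⟨_, ⟨A, b, hW⟩, hA⟩ => ⟨A, b, hW ▸ hA⟩⟩
  refine ⟨⟨fun V G h => poincare_whole ha ha' h, fun W hW => ?_, fun C hC => ?_⟩,
    ⟨hzero, fun W ⟨A, hW⟩ => ⟨_, hW ▸ isH1ZeroHalf_rpow ha ha' A⟩, fun C hC => ?_⟩,
    ⟨hhalf, fun W ⟨A, b, hW⟩ => ⟨_, hW ▸ isH1Half_affine ha A b⟩, fun C hC => ?_⟩⟩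
  · obtain ⟨A, b, B, -, -, rfl⟩ := mem_extremalsWhole_iff.1 hW
    exact ⟨_, isH1Whole_extremal ha ha' A b B⟩
  · obtain ⟨W, hW, G, h, hpos⟩ := exists_extremalsWhole hN ha ha'
    have h1 := (poincare_whole ha ha' h).2.2 ⟨W, hW, Filter.EventuallyEq.rfl⟩
    -- Equality holds for `W`, so any admissible `C` can be compared after dividing by its positive
    -- energy.
    exact le_of_mul_le_mul_right (h1 ▸ hC W G h) hpos
  · have h := isH1ZeroHalf_rpow (N := N) ha ha' 1
    have h1 := (hzero _ _ h).2.2 ⟨_, ⟨1, rfl⟩, Filter.EventuallyEq.rfl⟩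
    refine le_of_mul_le_mul_right (h1 ▸ hC _ _ h) (integral_norm_sq_pos h.grad_memLp ?_)
    filter_upwards [ae_yCoord_pos] with X hX
    exact smul_basisVec_ne_zero ha' hX
  · have h := isH1Half_affine (N := N) ha 0 (Pi.single ⟨0, hN⟩ 1)
    have h1 := (hhalf _ _ h).2.2 ⟨_, ⟨0, _, rfl⟩, Filter.EventuallyEq.rfl⟩
    exact le_of_mul_le_mul_right (h1 ▸ hC _ _ h) (integral_norm_sq_pos h.grad_memLp
      (MeasureTheory.ae_of_all _ fun _ => horizontal_single_ne_zero ⟨0, hN⟩))
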